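/- Let $n\ge 1$ and $0\le r\le n-1$. Let $M^n$ be a connected Riemannian manifold and $\bar M^{n+1}$ a Riemannian manifold (smooth, Hausdorff, second countable, without boundary), let $x:M\to\bar M$ be a smooth isometric immersion and let $N$ be a smooth unit normal field along $x$ (which exists if $M$ is orientable and $\bar M$ is oriented). Let $A v=-(\bar\nabla_v N)^T$ be the shape operator, $k_1,\dots,k_n$ its eigenvalues, $S_j$ the $j$-th elementary symmetric function of $k_1,\dots,k_n$ ($S_0=1$), $H_j=S_j/\binom nj$, and let $P_0=I$, $P_j=S_jI-AP_{j-1}$ be the Newton transformations. Put $\bar R_N(Y)=(\bar R(Y,N)N)^T$, where $\bar R(Y,Z)=\bar\nabla_Y\bar\nabla_Z-\bar\nabla_Z\bar\nabla_Y-\bar\nabla_{[Y,Z]}$ is the curvature of $\bar M$. Assume that $x$ is an admissible $H_{r+1}$-hypersurface: $H_{r+1}$ is constant, and $P_r$ is either positive definite on $M$ or negative definite on $M$. Put $\varepsilon=1$ in the first case and $\varepsilon=-1$ in the second. The $r$-stability operator is $$T_r u=\varepsilon\left(\operatorname{trace}(P_r\operatorname{Hess}u)+\operatorname{trace}(P_rA^2)\,u+\operatorname{trace}(P_r\bar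 R_N)\,u\right).$$ Assume that there is a function $u\in C^\infty(M)$ with $u>0$ and $T_ru\le 0$ on $M$. (In particular this holds if $M$ is $r$-stable in the sense that such a $u$ exists with, in addition, $T_ru\not\equiv0$.) Let $X=-P_r^{-1}\operatorname{trace}(\nabla P_r)$, where $\operatorname{trace}(\nabla P_r)=\sum_i(\nabla_{e_i}P_r)e_i$ for an orthonormal basis $(e_i)$, and let the symmetrized $r$-stability operator be $$\mathcal T_rf=\varepsilon\left(\operatorname{div}(P_r\nabla f)+\Big(\operatorname{trace}(P_rA^2)+\operatorname{trace}(P_r\bar R_N)-\tfrac12\operatorname{div}(P_rX)-\tfrac14|\sqrt{P_r}X|^2\Big)f\right),$$ where $|\sqrt{P_r}X|^2$ stands for $\langle P_rX,X\rangle$. Then for every $f\in C^2(M)$ with compact support the function $f\,\mathcal T_rf$ is integrable on $M$ for the Riemannian volume measure, and $$-\int_M f\,\mathcal T_rf\,dM\ \ge\ 0 .$$ -/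

import Mathlib

open Bundle MeasureTheory
open scoped Manifold ContDiff

noncomputable section

namespace RiemGeom

section Intrinsic

/-! ### Riemannian geometry of one manifold

`M` is a manifold without boundary of dimension `m`; its Riemannian metric is the instance
`RiemannianBundle` on the tangent bundle, read through `inner ℝ`. -/

variable {m : ℕ} {M : Type*} [TopologicalSpace M] [ChartedSpace (EuclideanSpace ℝ (Fin m)) M]
  [IsManifold (𝓡 m) ∞ M]

instance instFiniteDimensionalTangentSpace (p : M) :
    FiniteDimensional ℝ (TangentSpace (𝓡 m) p) :=
  inferInstanceAs (FiniteDimensional ℝ (EuclideanSpace ℝ (Fin m)))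

/-- A tangent vector at `p`, extended to a vector field which is smooth near `p`
(it has constant coefficients in the preferred chart at `p`). -/
def ext {p : M} (v : TangentSpace (𝓡 m) p) : (q : M) → TangentSpace (𝓡 m) q :=
  FiberBundle.extend (EuclideanSpace ℝ (Fin m)) v

variable [RiemannianBundle (fun p : M => TangentSpace (𝓡 m) p)]

/-- An orthonormal basis of the tangent space at `p`. -/
def frame (p : M) :
    OrthonormalBasis (Fin (Module.finrank ℝ (TangentSpace (𝓡 m) p))) ℝ (TangentSpace (𝓡 m) p) :=
  stdOrthonormalBasis ℝ (TangentSpace (𝓡 m) p)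

/-- The right-hand side of the Koszul formula, i.e. `⟨∇_X Y, Z⟩` at `p`. -/
def koszul (X Y Z : (q : M) → TangentSpace (𝓡 m) q) (p : M) : ℝ :=
  (1 / 2 : ℝ) *
    (mvfderiv (𝓡 m) (fun q => inner ℝ (Y q) (Z q)) p (X p)
      + mvfderiv (𝓡 m) (fun q => inner ℝ (X q) (Z q)) p (Y p)
      - mvfderiv (𝓡 m) (fun q => inner ℝ (X q) (Y q)) p (Z p)
      + inner ℝ (VectorField.mlieBracket (𝓡 m) X Y p) (Z p)
      - inner ℝ (VectorField.mlieBracket (𝓡 m) X Z p) (Y p)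
      - inner ℝ (VectorField.mlieBracket (𝓡 m) Y Z p) (X p))

/-- The Levi-Civita connection: `nabla Y p v` is `∇_v Y`, the vector at `p` whose inner products
with the vectors of an orthonormal basis are given by the Koszul formula. -/
def nabla (Y : (q : M) → TangentSpace (𝓡 m) q) (p : M) :
    TangentSpace (𝓡 m) p →ₗ[ℝ] TangentSpace (𝓡 m) p :=
  (frame p).toBasis.constr ℝ fun i =>
    ∑ j, koszul (ext (frame p i)) Y (ext (frame p j)) p • frame p j

/-- The curvature `R(X, Y) Z = ∇_X ∇_Y Z - ∇_Y ∇_X Z - ∇_[X, Y] Z` on tangent vectors at `p`. -/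
def curvature (p : M) (X Y Z : TangentSpace (𝓡 m) p) : TangentSpace (𝓡 m) p :=
  nabla (fun q => nabla (ext Z) q (ext Y q)) p X
    - nabla (fun q => nabla (ext Z) q (ext X q)) p Y
    - nabla (ext Z) p (VectorField.mlieBracket (𝓡 m) (ext X) (ext Y) p)

/-- The gradient of a function. -/
def grad (f : M → ℝ) (p : M) : TangentSpace (𝓡 m) p :=
  ∑ i, mvfderiv (𝓡 m) f p (frame p i) • frame p i

/-- The divergence of a vector field: the trace of its covariant derivative. -/
def div (V : (q : M) → TangentSpace (𝓡 m) q) (p : M) : ℝ :=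
  LinearMap.trace ℝ (TangentSpace (𝓡 m) p) (nabla V p)

/-- The Hessian of a function, as the endomorphism `v ↦ ∇_v (grad f)`. -/
def hess (f : M → ℝ) (p : M) : TangentSpace (𝓡 m) p →ₗ[ℝ] TangentSpace (𝓡 m) p :=
  nabla (fun q => grad f q) p

/-- The vector field `trace (∇P) = ∑ i, (∇_{e_i} P) e_i` of a field `P` of endomorphisms, where
`(∇_v P) Y = ∇_v (P Y) - P (∇_v Y)`. -/
def traceNabla (P : (q : M) → TangentSpace (𝓡 m) q →ₗ[ℝ] TangentSpace (𝓡 m) q) (p : M) :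
    TangentSpace (𝓡 m) p :=
  ∑ i, (nabla (fun q => P q (ext (frame p i) q)) p (frame p i)
    - P p (nabla (ext (frame p i)) p (frame p i)))

/-- The Gram matrix `g_ij` of the metric, at the point with coordinates `y` in the preferred chart
at `c`. -/
def gram (c : M) (y : EuclideanSpace ℝ (Fin m)) : Matrix (Fin m) (Fin m) ℝ :=
  Matrix.of fun i j =>
    inner ℝ
      (mfderiv (𝓡 m) (𝓡 m) (extChartAt (𝓡 m) c).symm y (EuclideanSpace.single i (1 : ℝ)))
      (mfderiv (𝓡 m) (𝓡 m) (extChartAt (𝓡 m) c).symm y (EuclideanSpace.single j (1 : ℝ)))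

variable [MeasurableSpace M]

/-- The Riemannian measure `√(det g_ij) dy` on the domain of the preferred chart at `c`. -/
def chartVolume (c : M) : Measure M :=
  Measure.map (extChartAt (𝓡 m) c).symm
    ((volume.restrict (extChartAt (𝓡 m) c).target).withDensity
      fun y => ENNReal.ofReal (Real.sqrt (gram c y).det))

end Intrinsic

section Volume

variable {m : ℕ} {M : Type*} [TopologicalSpace M] [ChartedSpace (EuclideanSpace ℝ (Fin m)) M]

theorem exists_seq_chart_cover (m : ℕ) (M : Type*) [TopologicalSpace M]
    [ChartedSpace (EuclideanSpace ℝ (Fin m)) M] [SecondCountableTopology M] [Nonempty M] :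
    ∃ c : ℕ → M, ⋃ i, (extChartAt (𝓡 m) (c i)).source = Set.univ := by
  obtain ⟨s, hs, hU⟩ := TopologicalSpace.countable_cover_nhds
    (fun p : M => extChartAt_source_mem_nhds (I := 𝓡 m) p)
  have hne : s.Nonempty := by
    by_contra h
    rw [Set.not_nonempty_iff_eq_empty] at h
    obtain ⟨p⟩ := ‹Nonempty M›
    have hp : p ∈ ⋃ x ∈ s, (extChartAt (𝓡 m) x).source := hU ▸ Set.mem_univ p
    simp [h] at hp
  obtain ⟨c, rfl⟩ := hs.exists_eq_range hne
  exact ⟨c, by simpa using hU⟩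

/-- The Riemannian volume measure of `M`: the manifold is cut into countably many disjoint pieces,
each contained in the domain of a chart, and each piece is measured by `√(det g_ij) dy`.
By the change of variables formula the result does not depend on the charts. -/
def riemVolume [SecondCountableTopology M] [Nonempty M]
    [RiemannianBundle (fun p : M => TangentSpace (𝓡 m) p)] [MeasurableSpace M] : Measure M :=
  Measure.sum fun i : ℕ =>
    (chartVolume (m := m) ((exists_seq_chart_cover m M).choose i)).restrict
      (disjointed (fun j => (extChartAt (𝓡 m) ((exists_seq_chart_cover m M).choose j)).source) i)

end Volume

section Hypersurface

/-! ### Hypersurfaces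

`x : M → Mbar` is an isometric immersion of an `n`-manifold into an `(n + 1)`-manifold and
`N` a unit normal field along `x`. -/

variable {n : ℕ}
  {M : Type*} [TopologicalSpace M] [ChartedSpace (EuclideanSpace ℝ (Fin n)) M]
  [IsManifold (𝓡 n) ∞ M] [RiemannianBundle (fun p : M => TangentSpace (𝓡 n) p)]
  {Mbar : Type*} [TopologicalSpace Mbar] [ChartedSpace (EuclideanSpace ℝ (Fin (n + 1))) Mbar]
  [IsManifold (𝓡 (n + 1)) ∞ Mbar]
  [RiemannianBundle (fun p : Mbar => TangentSpace (𝓡 (n + 1)) p)]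

/-- The differential of `x` at `p`. -/
abbrev dx (x : M → Mbar) (p : M) :
    TangentSpace (𝓡 n) p →L[ℝ] TangentSpace (𝓡 (n + 1)) (x p) :=
  mfderiv (𝓡 n) (𝓡 (n + 1)) x p

/-- `x` is a smooth isometric immersion (an isometric map is automatically an immersion). -/
structure IsIsometricImmersion (x : M → Mbar) : Prop where
  smooth : ContMDiff (𝓡 n) (𝓡 (n + 1)) ∞ x
  isometric : ∀ (p : M) (v w : TangentSpace (𝓡 n) p),
    inner ℝ (dx x p v) (dx x p w) = inner ℝ v w

/-- `N` is a smooth unit normal field along `x`. -/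
structure IsUnitNormal (x : M → Mbar) (N : (p : M) → TangentSpace (𝓡 (n + 1)) (x p)) : Prop where
  smooth : ContMDiff (𝓡 n) (𝓡 (n + 1)).tangent ∞
    (fun p => (⟨x p, N p⟩ : TangentBundle (𝓡 (n + 1)) Mbar))
  unit : ∀ p, inner ℝ (N p) (N p) = 1
  normal : ∀ (p : M) (v : TangentSpace (𝓡 n) p), inner ℝ (N p) (dx x p v) = 0

/-- The tangent part `W^T` of an ambient vector, as a tangent vector of the hypersurface. -/
def tangentPart (x : M → Mbar) (p : M) (W : TangentSpace (𝓡 (n + 1)) (x p)) :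
    TangentSpace (𝓡 n) p :=
  ∑ j, inner ℝ W (dx x p (frame p j)) • frame p j

/-- The ambient covariant derivative of a vector field `s` along `x`, in direction `v`.
If `s = ∑ a, s^a E_a` with `E_a` the coordinate fields of the preferred chart at `x p`, this is
`∑ a, ds^a(v) E_a + ∑ a, s^a(p) ∇_{dx v} E_a`. -/
def nablaAlong (x : M → Mbar) (s : (q : M) → TangentSpace (𝓡 (n + 1)) (x q)) (p : M)
    (v : TangentSpace (𝓡 n) p) : TangentSpace (𝓡 (n + 1)) (x p) :=
  (trivializationAt (EuclideanSpace ℝ (Fin (n + 1)))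
      (fun y : Mbar => TangentSpace (𝓡 (n + 1)) y) (x p)).symm (x p)
    (mvfderiv (𝓡 n)
      (fun q => (trivializationAt (EuclideanSpace ℝ (Fin (n + 1)))
        (fun y : Mbar => TangentSpace (𝓡 (n + 1)) y) (x p) ⟨x q, s q⟩).2) p v)
  + nabla (ext (s p)) (x p) (dx x p v)

variable (x : M → Mbar) (N : (p : M) → TangentSpace (𝓡 (n + 1)) (x p))

/-- The shape operator `A v = -(∇_v N)^T`. -/
def shape (p : M) : TangentSpace (𝓡 n) p →ₗ[ℝ] TangentSpace (𝓡 n) p :=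
  (frame p).toBasis.constr ℝ fun i => -tangentPart x p (nablaAlong x N p (frame p i))

/-- `S_r`, the `r`-th elementary symmetric function of the principal curvatures, which are the
eigenvalues of the shape operator with multiplicity. -/
def symmCurv (r : ℕ) (p : M) : ℝ :=
  (shape x N p).charpoly.roots.esymm r

/-- The `r`-mean curvature `H_r`, where `S_r = (n choose r) H_r`. -/
def meanCurv (r : ℕ) (p : M) : ℝ :=
  symmCurv x N r p / (n.choose r : ℝ)

/-- The Newton transformations `P_0 = I`, `P_r = S_r I - A P_{r-1}`. -/
def newton : ℕ → (p : M) → TangentSpace (𝓡 n) p →ₗ[ℝ] TangentSpace (𝓡 n) p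
  | 0, _ => LinearMap.id
  | r + 1, p => symmCurv x N (r + 1) p • LinearMap.id - shape x N p ∘ₗ newton r p

/-- `R_N Y = (R(Y, N) N)^T`, with `R` the curvature of the ambient manifold. -/
def curvN (p : M) : TangentSpace (𝓡 n) p →ₗ[ℝ] TangentSpace (𝓡 n) p :=
  (frame p).toBasis.constr ℝ fun i =>
    tangentPart x p (curvature (x p) (dx x p (frame p i)) (N p) (N p))

/-- `P_r` is positive definite on all of `M`. -/
def NewtonPosDef (r : ℕ) : Prop :=
  ∀ (p : M) (v : TangentSpace (𝓡 n) p), v ≠ 0 → 0 < inner ℝ (newton x N r p v) v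

/-- `P_r` is negative definite on all of `M`. -/
def NewtonNegDef (r : ℕ) : Prop :=
  ∀ (p : M) (v : TangentSpace (𝓡 n) p), v ≠ 0 → inner ℝ (newton x N r p v) v < 0

/-- `x`, with unit normal `N`, is an admissible `H_{r+1}`-hypersurface: an isometric immersion with
constant `(r+1)`-mean curvature and with `P_r` positive or negative definite. -/
structure IsAdmissible (r : ℕ) : Prop where
  immersion : IsIsometricImmersion (n := n) x
  normal : IsUnitNormal (n := n) x N
  const : ∃ H : ℝ, ∀ p, meanCurv x N (r + 1) p = H
  definite : NewtonPosDef x N r ∨ NewtonNegDef x N r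

open Classical in
/-- The sign of `P_r`: `1` in the positive definite case, `-1` in the negative definite case. -/
def newtonSign (r : ℕ) : ℝ := if NewtonPosDef x N r then 1 else -1

/-- The zeroth order term `trace (P_r A²) + trace (P_r R_N)`. -/
def potential (r : ℕ) (p : M) : ℝ :=
  LinearMap.trace ℝ (TangentSpace (𝓡 n) p) (newton x N r p ∘ₗ shape x N p ∘ₗ shape x N p)
    + LinearMap.trace ℝ (TangentSpace (𝓡 n) p) (newton x N r p ∘ₗ curvN x N p)

/-- The `r`-stability operator: `T_r u = L_r u + trace (P_r A²) u + trace (P_r R_N) u` with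
`L_r u = trace (P_r Hess u)` if `P_r` is positive definite, and the opposite of this if `P_r` is
negative definite. -/
def stabOp (r : ℕ) (u : M → ℝ) (p : M) : ℝ :=
  newtonSign x N r *
    (LinearMap.trace ℝ (TangentSpace (𝓡 n) p) (newton x N r p ∘ₗ hess u p)
      + potential x N r p * u p)

/-- `r`-stability: some positive smooth `u` has `T_r u ≤ 0` on `M`. It is not required that
`T_r u` is not identically zero, so hypersurfaces that are `r`-stable with this additional
requirement are included. -/
def IsRStable (r : ℕ) : Prop :=
  ∃ u : M → ℝ, ContMDiff (𝓡 n) 𝓘(ℝ) ∞ u ∧ (∀ p, 0 < u p) ∧ ∀ p, stabOp x N r u p ≤ 0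

/-- The vector field `X = - P_r⁻¹ trace (∇P_r)`; `Ring.inverse` is the inverse endomorphism. -/
def driftField (r : ℕ) (p : M) : TangentSpace (𝓡 n) p :=
  -(Ring.inverse (newton x N r p : Module.End ℝ (TangentSpace (𝓡 n) p))
      (traceNabla (fun q => newton x N r q) p))

/-- The symmetrized `r`-stability operator
`div (P_r ∇f) + (trace (P_r A²) + trace (P_r R_N) - ½ div (P_r X) - ¼ |√P_r X|²) f`
if `P_r` is positive definite, and the opposite of this expression if `P_r` is negative definite.
Here `|√P_r X|²` is written as `⟨P_r X, X⟩`, which is the same thing for positive definite `P_r`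
and which has a meaning for negative definite `P_r` as well. -/
def symmStabOp (r : ℕ) (f : M → ℝ) (p : M) : ℝ :=
  newtonSign x N r *
    (div (fun q => newton x N r q (grad f q)) p
      + (potential x N r p
          - (1 / 2 : ℝ) * div (fun q => newton x N r q (driftField x N r q)) p
          - inner ℝ (newton x N r p (driftField x N r p)) (driftField x N r p) / 4) * f p)

end Hypersurface

end RiemGeom

end

/-!
The proof tests the symmetrized operator against the logarithmic gradient of the positive
supersolution, as in the classical argument of Barta and of Fischer-Colbrie and Schoen.

Put `P = ε P_r`, a smooth field of symmetric positive definite endomorphisms, `τ = trace (∇P)` and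
let `q` be `ε` times the zeroth order term of the stability operator, so that the hypothesis reads
`trace (P Hess u) + q u ≤ 0`. As `P` is symmetric, `div (P Y) = trace (P ∇Y) + ⟨τ, Y⟩`
(`div_endomorphism_apply`), and `P X = -τ` for the drift field `X`. With
`W = u⁻¹ P ∇u - τ / 2` (`riccatiField`) one finds
`div W ≤ -q + ½ div (P X) - ⟨P ∇u, ∇u⟩ / u² - ⟨P X, ∇u⟩ / u`, and completing the square gives the
pointwise inequality `-f 𝒯 f ≥ div (f² W - f P ∇f)` (`div_le_neg_mul_of_supersolution`). The field
on the right is of class `C^1` and compactly supported, so its divergence integrates to zero.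

Two things have to be supplied. The first is smoothness of all fields which occur, since the
shape operator, the curvature term and `trace (∇P)` are defined through orthonormal bases chosen
point by point: they are expressed through smooth local orthonormal frames. The functions `S_r` are
coefficients of the characteristic polynomial of the shape operator, which is symmetric because the
connection along the immersion is torsion-free (`nablaAlong_dx_sub`), and the inverse of `P_r` is a
polynomial in `P_r` by the Cayley-Hamilton theorem. The second is the divergence theorem
(`integral_div_eq_zero`): in a chart `σ div V = ∑ ∂_i (σ V^i)` with `σ = √(det g)`
(`volDensity_mul_div`, from Jacobi's formula), the chart measures agree on overlaps
(`chartVolume_eq_of_subset`), and a partition of unity reduces the global statement to one chart.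
-/

noncomputable section

namespace RiemGeom

open Filter Topology

set_option linter.unusedSectionVars false

/-- A shortcut for instance search, which finds this topology only after a long detour. -/
local instance instTopologicalSpaceTotalSpaceTangent {m : ℕ} {M : Type*} [TopologicalSpace M]
    [ChartedSpace (EuclideanSpace ℝ (Fin m)) M] [IsManifold (𝓡 m) ∞ M] :
    TopologicalSpace (TotalSpace (EuclideanSpace ℝ (Fin m))
      (fun p : M => TangentSpace (𝓡 m) p)) :=
  inferInstance

/-! ### Vector fields and the Levi-Civita connection -/

section LeviCivita

variable {m : ℕ} {M : Type*} [TopologicalSpace M] [ChartedSpace (EuclideanSpace ℝ (Fin m)) M]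
  [IsManifold (𝓡 m) ∞ M] [RiemannianBundle (fun p : M => TangentSpace (𝓡 m) p)]
  [IsContMDiffRiemannianBundle (𝓡 m) ∞ (EuclideanSpace ℝ (Fin m))
    (fun p : M => TangentSpace (𝓡 m) p)]

/-- The vector field `X` is of class `C^k` at `p`. -/
abbrev FieldCkAt (k : ℕ∞ω) (X : (q : M) → TangentSpace (𝓡 m) q) (p : M) : Prop :=
  ContMDiffAt (𝓡 m) ((𝓡 m).prod 𝓘(ℝ, EuclideanSpace ℝ (Fin m))) k
    (fun q => (⟨q, X q⟩ : TangentBundle (𝓡 m) M)) p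

/-- The vector field `X` is differentiable at `p`. -/
abbrev FieldDiffAt (X : (q : M) → TangentSpace (𝓡 m) q) (p : M) : Prop :=
  MDifferentiableAt (𝓡 m) ((𝓡 m).prod 𝓘(ℝ, EuclideanSpace ℝ (Fin m)))
    (fun q => (⟨q, X q⟩ : TangentBundle (𝓡 m) M)) p

section Algebra

variable {X Y : (q : M) → TangentSpace (𝓡 m) q} {p : M} {k : ℕ∞ω}

lemma FieldDiffAt.add (hX : FieldDiffAt X p) (hY : FieldDiffAt Y p) : FieldDiffAt (X + Y) p :=
  mdifferentiableAt_add_section hX hY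

lemma FieldDiffAt.smul {f : M → ℝ} (hf : MDifferentiableAt (𝓡 m) 𝓘(ℝ) f p)
    (hX : FieldDiffAt X p) : FieldDiffAt (f • X) p :=
  hf.smul_section hX

lemma FieldDiffAt.const_smul (c : ℝ) (hX : FieldDiffAt X p) : FieldDiffAt (c • X) p :=
  (mdifferentiableAt_const (c := c)).smul_section hX

lemma FieldDiffAt.sum {ι : Type*} (s : Finset ι) {X : ι → (q : M) → TangentSpace (𝓡 m) q}
    (hX : ∀ i, FieldDiffAt (X i) p) : FieldDiffAt (∑ i ∈ s, X i) p := by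
  have h := MDifferentiableAt.sum_section (s := s) (t := X) (x₀ := p) (I := 𝓡 m) fun i _ => hX i
  convert h using 3
  simp

lemma FieldCkAt.sub (hX : FieldCkAt k X p) (hY : FieldCkAt k Y p) : FieldCkAt k (X - Y) p :=
  ContMDiffAt.sub_section hX hY

lemma FieldCkAt.smul {f : M → ℝ} (hf : ContMDiffAt (𝓡 m) 𝓘(ℝ) k f p)
    (hX : FieldCkAt k X p) : FieldCkAt k (f • X) p :=
  hf.smul_section hX

lemma FieldCkAt.const_smul (c : ℝ) (hX : FieldCkAt k X p) : FieldCkAt k (c • X) p :=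
  (contMDiffAt_const (c := c)).smul_section hX

lemma FieldCkAt.sum {ι : Type*} (s : Finset ι) {X : ι → (q : M) → TangentSpace (𝓡 m) q}
    (hX : ∀ i, FieldCkAt k (X i) p) : FieldCkAt k (∑ i ∈ s, X i) p := by
  have h := ContMDiffAt.sum_section (s := s) (t := X) (x₀ := p) (I := 𝓡 m) fun i _ => hX i
  convert h using 3
  simp

end Algebra

lemma ext_self {p : M} (v : TangentSpace (𝓡 m) p) : ext v p = v := by
  simp [ext]

lemma mdifferentiableAt_ext {p : M} (v : TangentSpace (𝓡 m) p) : FieldDiffAt (ext v) p :=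
  FiberBundle.mdifferentiableAt_extend ..

lemma contMDiffAt_ext {p : M} (v : TangentSpace (𝓡 m) p) : FieldCkAt ∞ (ext v) p :=
  FiberBundle.contMDiffAt_extend ..

variable {X Y Z : (q : M) → TangentSpace (𝓡 m) q} {p : M}

lemma mdiffAt_inner (hY : FieldDiffAt Y p) (hZ : FieldDiffAt Z p) :
    MDifferentiableAt (𝓡 m) 𝓘(ℝ) (fun q => (inner ℝ (Y q) (Z q) : ℝ)) p := by
  have : IsContMDiffRiemannianBundle (𝓡 m) 1 (EuclideanSpace ℝ (Fin m))
    (fun p : M => TangentSpace (𝓡 m) p) := IsContMDiffRiemannianBundle.of_le (n := ∞) (by simp)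
  exact MDifferentiableAt.inner_bundle (IB := 𝓡 m) (F := EuclideanSpace ℝ (Fin m))
    (E := fun p : M => TangentSpace (𝓡 m) p) (b := id) hY hZ

lemma contMDiffAt_inner {k : ℕ∞ω} (hk : k ≤ ∞) (hY : FieldCkAt k Y p) (hZ : FieldCkAt k Z p) :
    ContMDiffAt (𝓡 m) 𝓘(ℝ) k (fun q => (inner ℝ (Y q) (Z q) : ℝ)) p := by
  have : IsContMDiffRiemannianBundle (𝓡 m) k (EuclideanSpace ℝ (Fin m))
    (fun p : M => TangentSpace (𝓡 m) p) := IsContMDiffRiemannianBundle.of_le (n := ∞) hk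
  exact ContMDiffAt.inner_bundle (IB := 𝓡 m) (F := EuclideanSpace ℝ (Fin m))
    (E := fun p : M => TangentSpace (𝓡 m) p) (b := id) hY hZ

/-- The Koszul formula depends on `X` only through its value at `p`. -/
lemma koszul_tensorial_left (hY : FieldDiffAt Y p) (hZ : FieldDiffAt Z p) :
    TensorialAt (𝓡 m) (EuclideanSpace ℝ (Fin m)) (fun X => koszul X Y Z p) p where
  smul {f σ} hf hσ := by
    have h1 := mvfderiv_fun_mul hf (mdiffAt_inner hσ hZ)
    have h2 := mvfderiv_fun_mul hf (mdiffAt_inner hσ hY)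
    simp only [koszul, Pi.smul_apply', real_inner_smul_left, h1, h2,
      VectorField.mlieBracket_smul_left hf hσ]
    simp [inner_add_left, inner_smul_left, real_inner_comm]
    ring
  add {σ σ'} hσ hσ' := by
    have h1 := mvfderiv_fun_add (mdiffAt_inner hσ hZ) (mdiffAt_inner hσ' hZ)
    have h2 := mvfderiv_fun_add (mdiffAt_inner hσ hY) (mdiffAt_inner hσ' hY)
    simp only [koszul, Pi.add_apply, inner_add_left, h1, h2,
      VectorField.mlieBracket_add_left hσ hσ', map_add, inner_add_right]
    simp
    ring

/-- The Koszul formula depends on `Z` only through its value at `p`. -/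
lemma koszul_tensorial_right (hX : FieldDiffAt X p) (hY : FieldDiffAt Y p) :
    TensorialAt (𝓡 m) (EuclideanSpace ℝ (Fin m)) (fun Z => koszul X Y Z p) p where
  smul {f σ} hf hσ := by
    have h1 := mvfderiv_fun_mul hf (mdiffAt_inner hY hσ)
    have h2 := mvfderiv_fun_mul hf (mdiffAt_inner hX hσ)
    simp only [koszul, Pi.smul_apply', real_inner_smul_right, h1, h2,
      VectorField.mlieBracket_smul_right hf hσ]
    simp [inner_add_left, inner_smul_left, real_inner_comm]
    ring
  add {σ σ'} hσ hσ' := by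
    have h1 := mvfderiv_fun_add (mdiffAt_inner hY hσ) (mdiffAt_inner hY hσ')
    have h2 := mvfderiv_fun_add (mdiffAt_inner hX hσ) (mdiffAt_inner hX hσ')
    simp only [koszul, Pi.add_apply, inner_add_right, h1, h2,
      VectorField.mlieBracket_add_right hσ hσ', map_add, inner_add_left]
    simp
    ring

/-- The connection `nabla`, defined through one orthonormal basis and extensions of its vectors,
satisfies the Koszul formula for all vector fields. This is tensoriality of the formula in `X`
and `Z`. -/
lemma inner_nabla (hX : FieldDiffAt X p) (hY : FieldDiffAt Y p) (hZ : FieldDiffAt Z p) :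
    inner ℝ (nabla Y p (X p)) (Z p) = koszul X Y Z p := by
  let B := TensorialAt.mkHom₂ (I := 𝓡 m) (F := EuclideanSpace ℝ (Fin m))
    (F' := EuclideanSpace ℝ (Fin m)) (fun X Z => koszul X Y Z p) p
    (fun Z hZ => koszul_tensorial_left hY hZ) (fun X hX => koszul_tensorial_right hX hY)
  have hB : ∀ X Z : (q : M) → TangentSpace (𝓡 m) q, FieldDiffAt X p → FieldDiffAt Z p →
      B (X p) (Z p) = koszul X Y Z p := fun X Z hX hZ => TensorialAt.mkHom₂_apply _ _ hX hZ
  rw [← hB X Z hX hZ]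
  generalize X p = v
  generalize Z p = w
  have hk : ∀ v w : TangentSpace (𝓡 m) p, koszul (ext v) Y (ext w) p = B v w := fun v w => by
    rw [← hB _ _ (mdifferentiableAt_ext v) (mdifferentiableAt_ext w), ext_self, ext_self]
  have h1 : ∀ i, inner ℝ (nabla Y p (frame p i)) w = B (frame p i) w := by
    intro i
    have : nabla Y p (frame p i) =
        ∑ j, koszul (ext (frame p i)) Y (ext (frame p j)) p • frame p j := by
      have := (frame p).toBasis.constr_basis ℝ (fun i =>
        ∑ j, koszul (ext (frame p i)) Y (ext (frame p j)) p • frame p j) i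
      simp [nabla]
    rw [this, sum_inner]
    conv_rhs => rw [← (frame p).sum_repr' w, map_sum]
    refine Finset.sum_congr rfl fun j _ => ?_
    rw [inner_smul_left, hk, map_smul]
    simp [mul_comm]
  rw [← (frame p).sum_repr' v]
  simp only [map_sum, map_smul, sum_inner, inner_smul_left, h1]
  simp

lemma inner_nabla_ext (hY : FieldDiffAt Y p) (v w : TangentSpace (𝓡 m) p) :
    inner ℝ (nabla Y p v) w = koszul (ext v) Y (ext w) p := by
  simpa only [ext_self] using inner_nabla (mdifferentiableAt_ext v) hY (mdifferentiableAt_ext w)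

/-- The Levi-Civita connection is compatible with the metric. -/
lemma mvfderiv_inner (hY : FieldDiffAt Y p) (hZ : FieldDiffAt Z p)
    (v : TangentSpace (𝓡 m) p) :
    mvfderiv (𝓡 m) (fun q => (inner ℝ (Y q) (Z q) : ℝ)) p v =
      inner ℝ (nabla Y p v) (Z p) + inner ℝ (Y p) (nabla Z p v) := by
  have hX := mdifferentiableAt_ext v
  have h1 := inner_nabla hX hY hZ
  have h2 := inner_nabla hX hZ hY
  rw [ext_self] at h1 h2
  rw [real_inner_comm (nabla Z p v), h1, h2]
  simp only [koszul, ext_self, VectorField.mlieBracket_swap_apply (V := Z) (W := Y),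
    inner_neg_left, real_inner_comm]
  ring

/-- The Levi-Civita connection is torsion-free. -/
lemma nabla_sub_nabla (hX : FieldDiffAt X p) (hY : FieldDiffAt Y p) :
    nabla Y p (X p) - nabla X p (Y p) = VectorField.mlieBracket (𝓡 m) X Y p := by
  refine ext_inner_right ℝ fun w => ?_
  have hw := mdifferentiableAt_ext w
  have h1 := inner_nabla hX hY hw
  have h2 := inner_nabla hY hX hw
  rw [ext_self] at h1 h2
  rw [inner_sub_left, h1, h2]
  simp only [koszul, ext_self, VectorField.mlieBracket_swap_apply (V := Y) (W := X),
    inner_neg_left, real_inner_comm]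
  ring

lemma nabla_add (hY : FieldDiffAt Y p) (hZ : FieldDiffAt Z p) :
    nabla (Y + Z) p = nabla Y p + nabla Z p := by
  ext1 v
  refine ext_inner_right ℝ fun w => ?_
  have hw := mdifferentiableAt_ext w
  have hv := mdifferentiableAt_ext v
  rw [LinearMap.add_apply, inner_add_left, inner_nabla_ext hY, inner_nabla_ext hZ,
    inner_nabla_ext (mdifferentiableAt_add_section hY hZ)]
  have h1 := mvfderiv_fun_add (mdiffAt_inner hY hw) (mdiffAt_inner hZ hw)
  have h2 := mvfderiv_fun_add (mdiffAt_inner hv hY) (mdiffAt_inner hv hZ)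
  simp only [koszul, Pi.add_apply, inner_add_left, h1, h2, inner_add_right,
    VectorField.mlieBracket_add_left hY hZ, VectorField.mlieBracket_add_right hY hZ, map_add]
  simp
  ring

/-- The Leibniz rule for the Levi-Civita connection. -/
lemma nabla_smul {f : M → ℝ} (hf : MDifferentiableAt (𝓡 m) 𝓘(ℝ) f p) (hY : FieldDiffAt Y p)
    (v : TangentSpace (𝓡 m) p) :
    nabla (f • Y) p v = mvfderiv (𝓡 m) f p v • Y p + f p • nabla Y p v := by
  refine ext_inner_right ℝ fun w => ?_
  have hw := mdifferentiableAt_ext w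
  have hv := mdifferentiableAt_ext v
  rw [inner_add_left, real_inner_smul_left, real_inner_smul_left, inner_nabla_ext hY,
    inner_nabla_ext (hf.smul_section hY)]
  have h1 := mvfderiv_fun_mul hf (mdiffAt_inner hY hw)
  have h2 := mvfderiv_fun_mul hf (mdiffAt_inner hv hY)
  simp only [koszul, Pi.smul_apply', real_inner_smul_left, h1, h2, real_inner_smul_right,
    VectorField.mlieBracket_smul_left hf hY, VectorField.mlieBracket_smul_right hf hY, ext_self]
  simp [inner_add_left, inner_smul_left]
  rw [real_inner_comm (Y p) v]
  ring

lemma mvfderiv_congr {F : Type*} [NormedAddCommGroup F] [NormedSpace ℝ F] {f g : M → F}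
    (h : f =ᶠ[𝓝 p] g) : mvfderiv (𝓡 m) f p = mvfderiv (𝓡 m) g p := by
  ext v
  simp only [mvfderiv, h.mfderiv_eq]
  rfl

lemma FieldDiffAt.congr_of_eventuallyEq (hY : FieldDiffAt Y p) (h : Z =ᶠ[𝓝 p] Y) :
    FieldDiffAt Z p :=
  MDifferentiableAt.congr_of_eventuallyEq hY (h.mono fun q hq => by simp [hq])

lemma FieldCkAt.congr_of_eventuallyEq {k : ℕ∞ω} (hY : FieldCkAt k Y p) (h : Z =ᶠ[𝓝 p] Y) :
    FieldCkAt k Z p :=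
  ContMDiffAt.congr_of_eventuallyEq hY (h.mono fun q hq => by simp [hq])

lemma FieldCkAt.diffAt {k : ℕ∞ω} (hY : FieldCkAt k Y p) (hk : k ≠ 0 := by simp) :
    FieldDiffAt Y p :=
  ContMDiffAt.mdifferentiableAt hY hk

/-- `nabla Y p` depends only on the germ of `Y` at `p`. -/
lemma nabla_congr (hY : FieldDiffAt Y p) (h : Z =ᶠ[𝓝 p] Y) : nabla Z p = nabla Y p := by
  ext1 v
  refine ext_inner_right ℝ fun w => ?_
  rw [inner_nabla_ext hY, inner_nabla_ext (FieldDiffAt.congr_of_eventuallyEq hY h)]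
  have h1 : (fun q => (inner ℝ (Z q) (ext w q) : ℝ)) =ᶠ[𝓝 p] fun q => inner ℝ (Y q) (ext w q) :=
    h.mono fun q hq => by simp [hq]
  have h2 : (fun q => (inner ℝ (ext v q) (Z q) : ℝ)) =ᶠ[𝓝 p] fun q => inner ℝ (ext v q) (Y q) :=
    h.mono fun q hq => by simp [hq]
  have h3 := (EventuallyEq.refl (𝓝 p) (ext v)).mlieBracket_vectorField_eq (I := 𝓡 m) h
  have h4 := h.mlieBracket_vectorField_eq (I := 𝓡 m) (EventuallyEq.refl (𝓝 p) (ext w))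
  simp only [koszul, mvfderiv_congr h1, mvfderiv_congr h2, h3, h4, h.self_of_nhds]

lemma nabla_const_smul (c : ℝ) (hY : FieldDiffAt Y p) : nabla (c • Y) p = c • nabla Y p := by
  ext1 v
  have := nabla_smul (f := fun _ => c) mdifferentiableAt_const hY v
  rw [mvfderiv_const] at this
  simpa using! this

lemma nabla_sub (hY : FieldDiffAt Y p) (hZ : FieldDiffAt Z p) :
    nabla (Y - Z) p = nabla Y p - nabla Z p := by
  have h : Y - Z = Y + (-1 : ℝ) • Z := by simp [sub_eq_add_neg]
  have hZ' : FieldDiffAt ((-1 : ℝ) • Z) p :=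
    hZ.const_smul _
  rw [h, nabla_add hY hZ', nabla_const_smul _ hZ]
  simp [sub_eq_add_neg]

lemma nabla_zero : nabla (0 : (q : M) → TangentSpace (𝓡 m) q) p = 0 := by
  have h : FieldDiffAt (0 : (q : M) → TangentSpace (𝓡 m) q) p :=
    mdifferentiableAt_zeroSection ..
  simpa using nabla_const_smul 0 h

lemma nabla_sum {ι : Type*} (s : Finset ι) {Y : ι → (q : M) → TangentSpace (𝓡 m) q}
    (hY : ∀ i, FieldDiffAt (Y i) p) :
    nabla (∑ i ∈ s, Y i) p = ∑ i ∈ s, nabla (Y i) p := by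
  classical
  induction s using Finset.induction_on with
  | empty => simpa using nabla_zero
  | insert a s ha ih =>
    have hs : FieldDiffAt (∑ i ∈ s, Y i) p := .sum s hY
    rw [Finset.sum_insert ha, Finset.sum_insert ha, nabla_add (hY a) hs, ih]

end LeviCivita

section Intrinsic

variable {m : ℕ} {M : Type*} [TopologicalSpace M] [ChartedSpace (EuclideanSpace ℝ (Fin m)) M]
  [IsManifold (𝓡 m) ∞ M] [RiemannianBundle (fun p : M => TangentSpace (𝓡 m) p)]
  [IsContMDiffRiemannianBundle (𝓡 m) ∞ (EuclideanSpace ℝ (Fin m))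
    (fun p : M => TangentSpace (𝓡 m) p)]
  {X Y Z : (q : M) → TangentSpace (𝓡 m) q} {p : M}

/-! ### Smooth orthonormal frames and smoothness of covariant derivatives -/

section Smoothness

/-- The image of a vector field under the differential of a map is a vector field along that map,
and one derivative is lost. -/
lemma contMDiffAt_mfderiv_field {m' : ℕ} {M' : Type*} [TopologicalSpace M']
    [ChartedSpace (EuclideanSpace ℝ (Fin m')) M'] [IsManifold (𝓡 m') ∞ M'] {f : M → M'}
    {k l : ℕ∞ω} (hf : ContMDiffAt (𝓡 m) (𝓡 m') l f p) (hX : FieldCkAt k X p) (h : k + 1 ≤ l) :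
    ContMDiffAt (𝓡 m) ((𝓡 m').prod 𝓘(ℝ, EuclideanSpace ℝ (Fin m'))) k
      (fun q => (⟨f q, mfderiv (𝓡 m) (𝓡 m') f q (X q)⟩ : TangentBundle (𝓡 m') M')) p :=
  ContMDiffAt.clm_apply_of_inCoordinates (F₁ := EuclideanSpace ℝ (Fin m))
    (E₁ := fun q : M => TangentSpace (𝓡 m) q) (F₂ := EuclideanSpace ℝ (Fin m'))
    (E₂ := fun q : M' => TangentSpace (𝓡 m') q) (b₁ := id) (b₂ := f)
    (ϕ := fun q => mfderiv (𝓡 m) (𝓡 m') f q)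
    (hf.mfderiv_const h) hX (hf.of_le (le_trans le_self_add h))

lemma contMDiffAt_mvfderiv_field {F : Type*} [NormedAddCommGroup F] [NormedSpace ℝ F] {f : M → F}
    {k l : ℕ∞ω} (hf : ContMDiffAt (𝓡 m) 𝓘(ℝ, F) l f p) (hX : FieldCkAt k X p) (h : k + 1 ≤ l) :
    ContMDiffAt (𝓡 m) 𝓘(ℝ, F) k (fun q => mvfderiv (𝓡 m) f q (X q)) p := by
  have := ContMDiffAt.clm_apply_of_inCoordinates (F₁ := EuclideanSpace ℝ (Fin m))
    (E₁ := fun q : M => TangentSpace (𝓡 m) q) (F₂ := F)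
    (E₂ := fun q : F => TangentSpace 𝓘(ℝ, F) q) (b₁ := id) (b₂ := f)
    (ϕ := fun q => mfderiv (𝓡 m) 𝓘(ℝ, F) f q)
    (hf.mfderiv_const h) hX (hf.of_le (le_trans le_self_add h))
  have h2 := (contMDiffAt_totalSpace.1 this).2
  refine h2.congr_of_eventuallyEq (Eventually.of_forall fun q => ?_)
  simp [mvfderiv]
  rfl

lemma FieldCkAt.eventually_diffAt {k : ℕ∞ω} (hX : FieldCkAt k X p) (hk : k ≠ 0 := by simp) :
    ∀ᶠ q in 𝓝 p, FieldDiffAt X q := by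
  have h1 : FieldCkAt 1 X p := ContMDiffAt.of_le hX (ENat.one_le_iff_ne_zero_withTop.mpr hk)
  exact ((contMDiffAt_iff_contMDiffAt_nhds (n := 1) (by simp)).1 h1).mono fun q hq =>
    FieldCkAt.diffAt hq (by simp)

/-- Gram-Schmidt preserves smoothness. -/
lemma FieldCkAt.gramSchmidt {s : Fin m → (q : M) → TangentSpace (𝓡 m) q}
    (hs : ∀ i, FieldCkAt ∞ (s i) p) (hli : LinearIndependent ℝ (fun i => s i p)) (i : Fin m) :
    FieldCkAt ∞ (fun q => InnerProductSpace.gramSchmidt ℝ (fun j => s j q) i) p := by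
  induction i using WellFoundedLT.induction with
  | ind i ih =>
    set g : Fin m → (q : M) → TangentSpace (𝓡 m) q :=
      fun i q => InnerProductSpace.gramSchmidt ℝ (fun j => s j q) i with hg
    have key : g i = s i - ∑ j ∈ Finset.Iio i,
        (fun q => (inner ℝ (g j q) (s i q) : ℝ) / inner ℝ (g j q) (g j q)) • g j := by
      funext q
      simp only [hg]
      rw [InnerProductSpace.gramSchmidt_def]
      simp [Submodule.starProjection_singleton]
    change FieldCkAt ∞ (g i) p
    rw [key]
    refine (hs i).sub ?_
    have : ∀ j ∈ Finset.Iio i, FieldCkAt ∞ ((fun q => (inner ℝ (g j q) (s i q) : ℝ) /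
        inner ℝ (g j q) (g j q)) • g j) p := by
      intro j hj
      have hj' := ih j (Finset.mem_Iio.1 hj)
      refine FieldCkAt.smul ?_ hj'
      refine ContMDiffAt.div₀ (contMDiffAt_inner le_rfl hj' (hs i))
        (contMDiffAt_inner le_rfl hj' hj') ?_
      exact inner_self_ne_zero.2 (InnerProductSpace.gramSchmidt_ne_zero j hli)
    have h := ContMDiffAt.sum_section (s := Finset.Iio i) (x₀ := p) (I := 𝓡 m) this
    convert h using 3
    simp

/-- A family of vector fields which are smooth at `p` and orthonormal near `p`. -/
structure IsOrthonormalFrameAt (e : Fin m → (q : M) → TangentSpace (𝓡 m) q) (p : M) : Prop where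
  smooth : ∀ i, FieldCkAt ∞ (e i) p
  orthonormal : ∀ᶠ q in 𝓝 p, Orthonormal ℝ (fun i => e i q)

lemma exists_orthonormalFrameAt (p : M) :
    ∃ e : Fin m → (q : M) → TangentSpace (𝓡 m) q, IsOrthonormalFrameAt e p := by
  let t := trivializationAt (EuclideanSpace ℝ (Fin m)) (fun q : M => TangentSpace (𝓡 m) q) p
  let s := t.localFrame (EuclideanSpace.basisFun (Fin m) ℝ).toBasis
  have hp : p ∈ t.baseSet := FiberBundle.mem_baseSet_trivializationAt' p
  have hs : ∀ i, FieldCkAt ∞ (s i) p := fun i => contMDiffAt_localFrame_of_mem ∞ _ _ i hp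
  have hli : ∀ q ∈ t.baseSet, LinearIndependent ℝ (fun i => s i q) := fun q hq =>
    (t.isLocalFrameOn_localFrame_baseSet (𝓡 m) 1
      (EuclideanSpace.basisFun (Fin m) ℝ).toBasis).linearIndependent hq
  refine ⟨fun i q => InnerProductSpace.gramSchmidtNormed ℝ (fun j => s j q) i, fun i => ?_, ?_⟩
  · have hg := FieldCkAt.gramSchmidt hs (hli p hp) i
    have h0 : (0 : ℝ) < inner ℝ (InnerProductSpace.gramSchmidt ℝ (fun j => s j p) i)
        (InnerProductSpace.gramSchmidt ℝ (fun j => s j p) i) :=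
      real_inner_self_pos.2 (InnerProductSpace.gramSchmidt_ne_zero i (hli p hp))
    have h1 := (Real.contDiffAt_sqrt (n := ∞) h0.ne').contMDiffAt.comp p
      (contMDiffAt_inner le_rfl hg hg)
    have h2 := FieldCkAt.smul (h1.inv₀ (Real.sqrt_ne_zero'.2 h0)) hg
    refine h2.congr_of_eventuallyEq (Eventually.of_forall fun q => ?_)
    simp only [InnerProductSpace.gramSchmidtNormed, norm_eq_sqrt_real_inner (F := TangentSpace _ q)]
    rfl
  · filter_upwards [t.open_baseSet.mem_nhds hp] with q hq
    exact InnerProductSpace.gramSchmidtNormed_orthonormal (hli q hq)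

/-- The number of vectors is the dimension, so that an orthonormal family is a basis. -/
lemma exists_orthonormalBasis_of_orthonormal {v : Fin m → TangentSpace (𝓡 m) p}
    (hv : Orthonormal ℝ v) :
    ∃ b : OrthonormalBasis (Fin m) ℝ (TangentSpace (𝓡 m) p), ∀ i, b i = v i := by
  have hc : Module.finrank ℝ (TangentSpace (𝓡 m) p) = Fintype.card (Fin m) := by
    change Module.finrank ℝ (EuclideanSpace ℝ (Fin m)) = _
    simp
  obtain ⟨b, hb⟩ := Orthonormal.exists_orthonormalBasis_extension_of_card_eq (v := v)
    (s := Set.univ) hc (hv.comp _ Subtype.val_injective)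
  exact ⟨b, fun i => hb i trivial⟩

variable {e : Fin m → (q : M) → TangentSpace (𝓡 m) q}

lemma IsOrthonormalFrameAt.eventually_sum (he : IsOrthonormalFrameAt e p) :
    ∀ᶠ q in 𝓝 p, ∀ v : TangentSpace (𝓡 m) q, ∑ i, (inner ℝ (e i q) v : ℝ) • e i q = v := by
  filter_upwards [he.orthonormal] with q hq v
  obtain ⟨b, hb⟩ := exists_orthonormalBasis_of_orthonormal hq
  simp only [← hb]
  exact b.sum_repr' v

lemma IsOrthonormalFrameAt.eventually_diffAt (he : IsOrthonormalFrameAt e p) :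
    ∀ᶠ q in 𝓝 p, ∀ i, FieldDiffAt (e i) q :=
  eventually_all.2 fun i => (he.smooth i).eventually_diffAt

/-- A field is of class `C^k` as soon as its components in an orthonormal frame are. -/
lemma IsOrthonormalFrameAt.fieldCkAt (he : IsOrthonormalFrameAt e p) {k : ℕ∞ω} (hk : k ≤ ∞)
    (h : ∀ i, ContMDiffAt (𝓡 m) 𝓘(ℝ) k (fun q => (inner ℝ (e i q) (X q) : ℝ)) p) :
    FieldCkAt k X p := by
  refine FieldCkAt.congr_of_eventuallyEq (FieldCkAt.sum Finset.univ fun i =>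
    FieldCkAt.smul (h i) (ContMDiffAt.of_le (he.smooth i) hk)) ?_
  filter_upwards [he.eventually_sum] with q hq
  rw [← hq (X q), Finset.sum_apply]
  simp only [hq, Pi.smul_apply']
  rfl

lemma contMDiffAt_koszul {k l : ℕ∞} (h : k + 1 ≤ l) (hX : FieldCkAt l X p) (hY : FieldCkAt l Y p)
    (hZ : FieldCkAt l Z p) : ContMDiffAt (𝓡 m) 𝓘(ℝ) k (koszul X Y Z) p := by
  have h' : (k : ℕ∞ω) + 1 ≤ l := by exact_mod_cast h
  have hkl : (k : ℕ∞ω) ≤ l := le_trans le_self_add h'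
  have hl : (l : ℕ∞ω) ≤ ∞ := by exact_mod_cast le_top
  have hkk : (k : ℕ∞ω) ≤ ∞ := hkl.trans hl
  have : IsManifold (𝓡 m) ((l : ℕ∞ω) + 1) M := IsManifold.of_le (n := ∞) (by exact_mod_cast le_top)
  have : IsManifold (𝓡 m) (minSmoothness ℝ 2) M := by
    rw [minSmoothness_of_isRCLikeNormedField]; infer_instance
  have br : ∀ {U V : (q : M) → TangentSpace (𝓡 m) q}, FieldCkAt l U p → FieldCkAt l V p →
      FieldCkAt k (VectorField.mlieBracket (𝓡 m) U V) p := fun hU hV =>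
    ContMDiffAt.mlieBracket_vectorField hU hV (by simpa using h')
  have dd : ∀ {U V W : (q : M) → TangentSpace (𝓡 m) q}, FieldCkAt l U p → FieldCkAt l V p →
      FieldCkAt l W p → ContMDiffAt (𝓡 m) 𝓘(ℝ) k
        (fun q => mvfderiv (𝓡 m) (fun q => (inner ℝ (U q) (V q) : ℝ)) q (W q)) p :=
    fun hU hV hW => contMDiffAt_mvfderiv_field (contMDiffAt_inner hl hU hV)
      (ContMDiffAt.of_le hW hkl) h'
  have ii : ∀ {U V : (q : M) → TangentSpace (𝓡 m) q}, FieldCkAt k U p → FieldCkAt l V p →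
      ContMDiffAt (𝓡 m) 𝓘(ℝ) k (fun q => (inner ℝ (U q) (V q) : ℝ)) p :=
    fun hU hV => contMDiffAt_inner hkk hU (ContMDiffAt.of_le hV hkl)
  exact contMDiffAt_const.mul ((((((dd hY hZ hX).add (dd hX hZ hY)).sub (dd hX hY hZ)).add
    (ii (br hX hY) hZ)).sub (ii (br hX hZ) hY)).sub (ii (br hY hZ) hX))

lemma FieldCkAt.nabla {k l : ℕ∞} (h : k + 1 ≤ l) (hX : FieldCkAt k X p) (hY : FieldCkAt l Y p) :
    FieldCkAt k (fun q => RiemGeom.nabla Y q (X q)) p := by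
  obtain ⟨e, he⟩ := exists_orthonormalFrameAt (m := m) p
  have hl : (l : ℕ∞ω) ≤ ∞ := by exact_mod_cast le_top
  have hkk : (k : ℕ∞ω) ≤ ∞ := by exact_mod_cast le_top
  have hl0 : (l : ℕ∞ω) ≠ 0 := by
    have : l ≠ 0 := by rintro rfl; simp at h
    exact_mod_cast this
  refine he.fieldCkAt hkk fun j => ?_
  have hc : ∀ i, ContMDiffAt (𝓡 m) 𝓘(ℝ) k
      (fun q => (inner ℝ (e i q) (X q) : ℝ) * koszul (e i) Y (e j) q) p := fun i =>
    (contMDiffAt_inner hkk (ContMDiffAt.of_le (he.smooth i) hkk) hX).mul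
      (contMDiffAt_koszul h (ContMDiffAt.of_le (he.smooth i) hl) hY
        (ContMDiffAt.of_le (he.smooth j) hl))
  refine (ContMDiffAt.sum (t := Finset.univ) fun i _ => hc i).congr_of_eventuallyEq ?_
  filter_upwards [he.eventually_sum, he.eventually_diffAt, hY.eventually_diffAt hl0]
    with q hq hd hYd
  conv_lhs => rw [← hq (X q)]
  simp only [map_sum, map_smul, inner_sum, real_inner_smul_right]
  refine Finset.sum_congr rfl fun i _ => ?_
  rw [← inner_nabla (hd i) hYd (hd j), real_inner_comm (RiemGeom.nabla Y q (e i q)),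
    real_inner_comm (X q)]

end Smoothness

/-! ### Smooth fields of endomorphisms -/

section Endomorphisms

lemma FieldDiffAt.nabla (hX : FieldDiffAt X p) (hY : FieldCkAt 2 Y p) :
    FieldDiffAt (fun q => RiemGeom.nabla Y q (X q)) p := by
  obtain ⟨e, he⟩ := exists_orthonormalFrameAt (m := m) p
  refine FieldDiffAt.congr_of_eventuallyEq (Y := ∑ i, (fun q => (inner ℝ (e i q) (X q) : ℝ)) •
    fun q => RiemGeom.nabla Y q (e i q)) (FieldDiffAt.sum Finset.univ fun i =>
    FieldDiffAt.smul (mdiffAt_inner (he.smooth i).diffAt hX) ?_) ?_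
  · have h1 : FieldCkAt ((1 : ℕ∞) : ℕ∞ω) (fun q => RiemGeom.nabla Y q (e i q)) p :=
      FieldCkAt.nabla (k := 1) (l := 2) (by norm_num)
        (ContMDiffAt.of_le (he.smooth i) (by exact_mod_cast le_top)) hY
    exact h1.diffAt
  · filter_upwards [he.eventually_sum] with q hq
    conv_lhs => rw [← hq (X q)]
    simp
    rfl

/-- The field of endomorphisms `L` maps vector fields smooth at `p` to vector fields smooth
at `p`. This encoding of smoothness avoids the bundle of endomorphisms. -/
def EndSmoothAt (L : (q : M) → TangentSpace (𝓡 m) q →ₗ[ℝ] TangentSpace (𝓡 m) q) (p : M) : Prop :=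
  ∀ X : (q : M) → TangentSpace (𝓡 m) q, FieldCkAt ∞ X p → FieldCkAt ∞ (fun q => L q (X q)) p

variable {L L' : (q : M) → TangentSpace (𝓡 m) q →ₗ[ℝ] TangentSpace (𝓡 m) q}

/-- A smooth field of endomorphisms also preserves lower regularity of vector fields. -/
lemma EndSmoothAt.apply (hL : EndSmoothAt L p) {k : ℕ∞ω} (hk : k ≤ ∞) (hX : FieldCkAt k X p) :
    FieldCkAt k (fun q => L q (X q)) p := by
  obtain ⟨e, he⟩ := exists_orthonormalFrameAt (m := m) p
  refine FieldCkAt.congr_of_eventuallyEq (Y := ∑ i, (fun q => (inner ℝ (e i q) (X q) : ℝ)) •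
    fun q => L q (e i q)) (FieldCkAt.sum Finset.univ fun i =>
    FieldCkAt.smul (contMDiffAt_inner hk (ContMDiffAt.of_le (he.smooth i) hk) hX)
      (ContMDiffAt.of_le (hL _ (he.smooth i)) hk)) ?_
  filter_upwards [he.eventually_sum] with q hq
  conv_lhs => rw [← hq (X q)]
  simp
  rfl

/-- A field of endomorphisms is smooth as soon as its matrix in an orthonormal frame is. -/
lemma IsOrthonormalFrameAt.endSmoothAt {e : Fin m → (q : M) → TangentSpace (𝓡 m) q}
    (he : IsOrthonormalFrameAt e p)
    (h : ∀ i j, ContMDiffAt (𝓡 m) 𝓘(ℝ) ∞ (fun q => (inner ℝ (e j q) (L q (e i q)) : ℝ)) p) :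
    EndSmoothAt L p := fun X hX => by
  refine FieldCkAt.congr_of_eventuallyEq (Y := ∑ i, (fun q => (inner ℝ (e i q) (X q) : ℝ)) •
    fun q => L q (e i q)) (FieldCkAt.sum Finset.univ fun i =>
    FieldCkAt.smul (contMDiffAt_inner le_rfl (he.smooth i) hX)
      (he.fieldCkAt le_rfl (h i))) ?_
  filter_upwards [he.eventually_sum] with q hq
  conv_lhs => rw [← hq (X q)]
  simp
  rfl

lemma EndSmoothAt.id : EndSmoothAt (fun q : M =>
    (LinearMap.id : TangentSpace (𝓡 m) q →ₗ[ℝ] TangentSpace (𝓡 m) q)) p := fun _ hX => hX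

lemma EndSmoothAt.comp (hL : EndSmoothAt L p) (hL' : EndSmoothAt L' p) :
    EndSmoothAt (fun q => L q ∘ₗ L' q) p := fun _ hX => hL _ (hL' _ hX)

lemma EndSmoothAt.sub (hL : EndSmoothAt L p) (hL' : EndSmoothAt L' p) :
    EndSmoothAt (fun q => L q - L' q) p := fun _ hX => (hL _ hX).sub (hL' _ hX)

lemma EndSmoothAt.smul {f : M → ℝ} (hf : ContMDiffAt (𝓡 m) 𝓘(ℝ) ∞ f p) (hL : EndSmoothAt L p) :
    EndSmoothAt (fun q => f q • L q) p := fun _ hX => FieldCkAt.smul hf (hL _ hX)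

lemma EndSmoothAt.pow (hL : EndSmoothAt L p) (n : ℕ) :
    EndSmoothAt (fun q => (L q : Module.End ℝ (TangentSpace (𝓡 m) q)) ^ n) p := by
  induction n with
  | zero => exact fun X hX => hX
  | succ n ih =>
    intro X hX
    have := ih _ (hL X hX)
    refine this.congr_of_eventuallyEq (Eventually.of_forall fun q => ?_)
    simp [pow_succ]
    rfl

/-- Regularity of the trace. The field `L` need not be smooth: it is only required to map smooth
vector fields to fields of class `C^k`, as `∇Y` does for `Y` of class `C^(k+1)`. -/
lemma contMDiffAt_trace {k : ℕ∞ω} (hk : k ≤ ∞)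
    (hL : ∀ X : (q : M) → TangentSpace (𝓡 m) q, FieldCkAt ∞ X p →
      FieldCkAt k (fun q => L q (X q)) p) :
    ContMDiffAt (𝓡 m) 𝓘(ℝ) k (fun q => LinearMap.trace ℝ (TangentSpace (𝓡 m) q) (L q)) p := by
  obtain ⟨e, he⟩ := exists_orthonormalFrameAt (m := m) p
  refine (ContMDiffAt.sum (t := Finset.univ) fun i _ => contMDiffAt_inner hk
    (ContMDiffAt.of_le (he.smooth i) hk) (hL _ (he.smooth i))).congr_of_eventuallyEq ?_
  filter_upwards [he.orthonormal] with q hq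
  obtain ⟨b, hb⟩ := exists_orthonormalBasis_of_orthonormal hq
  rw [LinearMap.trace_eq_sum_inner _ b]
  simp [hb]

/-- The coefficients of the characteristic polynomial are polynomials in the matrix entries. -/
lemma EndSmoothAt.charpoly_coeff (hL : EndSmoothAt L p) (n : ℕ) :
    ContMDiffAt (𝓡 m) 𝓘(ℝ) ∞ (fun q => (L q).charpoly.coeff n) p := by
  obtain ⟨e, he⟩ := exists_orthonormalFrameAt (m := m) p
  have h1 : ContMDiffAt (𝓡 m) 𝓘(ℝ, Fin m × Fin m → ℝ) ∞
      (fun q => fun ij : Fin m × Fin m => (inner ℝ (e ij.1 q) (L q (e ij.2 q)) : ℝ)) p :=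
    contMDiffAt_pi_space.2 fun ij =>
      contMDiffAt_inner le_rfl (he.smooth _) (hL _ (he.smooth _))
  have h2 := ((AnalyticOnNhd.eval_mvPolynomial (𝕜 := ℝ)
    ((Matrix.charpoly.univ ℝ (Fin m)).coeff n)).contDiff (n := ∞)).contDiffAt.contMDiffAt.comp p h1
  refine h2.congr_of_eventuallyEq ?_
  filter_upwards [he.orthonormal] with q hq
  obtain ⟨b, hb⟩ := exists_orthonormalBasis_of_orthonormal hq
  have h3 := Matrix.charpoly.univ_coeff_eval₂Hom (n := Fin m) (RingHom.id ℝ)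
    (fun ij : Fin m × Fin m => (inner ℝ (e ij.1 q) (L q (e ij.2 q)) : ℝ)) n
  rw [← LinearMap.charpoly_toMatrix (L q) b.toBasis]
  simp only [Function.comp_apply]
  refine Eq.trans ?_ h3.symm
  congr 2
  ext i j
  simp [LinearMap.toMatrix_apply, Function.curry, hb, b.repr_apply_apply]

/-- By the Cayley-Hamilton theorem the inverse of an invertible endomorphism is a polynomial in
it. -/
lemma _root_.LinearMap.ringInverse_eq_aeval_divX {V : Type*} [AddCommGroup V] [Module ℝ V]
    [FiniteDimensional ℝ V] (T : Module.End ℝ V) (hT : IsUnit T) :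
    T.charpoly.coeff 0 ≠ 0 ∧
      Ring.inverse T = -(T.charpoly.coeff 0)⁻¹ • Polynomial.aeval T T.charpoly.divX := by
  have hc : T.charpoly.coeff 0 ≠ 0 := by
    have h1 : IsUnit (LinearMap.det T) := (LinearMap.isUnit_iff_isUnit_det T).1 hT
    intro h
    rw [LinearMap.det_eq_sign_charpoly_coeff, h] at h1
    simp at h1
  refine ⟨hc, ?_⟩
  have h2 : Polynomial.aeval T T.charpoly = 0 := LinearMap.aeval_self_charpoly T
  rw [← Polynomial.X_mul_divX_add T.charpoly, map_add, map_mul, Polynomial.aeval_X,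
    Polynomial.aeval_C, add_eq_zero_iff_eq_neg] at h2
  obtain ⟨u, rfl⟩ := hT
  rw [Ring.inverse_unit]
  refine Units.inv_eq_of_mul_eq_one_right ?_
  simp only [Polynomial.coeff_zero_eq_eval_zero] at *
  rw [mul_smul_comm, h2, smul_neg, neg_smul, neg_neg, Algebra.algebraMap_eq_smul_one, smul_smul,
    inv_mul_cancel₀ hc, one_smul]

/-- The inverse of a smooth field of invertible endomorphisms is smooth, being a polynomial in it
with smooth coefficients. -/
lemma EndSmoothAt.ringInverse (hL : EndSmoothAt L p)
    (hu : ∀ q, IsUnit (L q : Module.End ℝ (TangentSpace (𝓡 m) q))) :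
    EndSmoothAt (fun q => Ring.inverse (L q : Module.End ℝ (TangentSpace (𝓡 m) q))) p := by
  intro X hX
  have h1 : FieldCkAt ∞ ((fun q => -((L q).charpoly.coeff 0)⁻¹) • ∑ i ∈ Finset.range m,
      (fun q => (L q).charpoly.coeff (i + 1)) •
        fun q => ((L q : Module.End ℝ (TangentSpace (𝓡 m) q)) ^ i) (X q)) p := by
    refine FieldCkAt.smul ((hL.charpoly_coeff 0).inv₀
      (LinearMap.ringInverse_eq_aeval_divX _ (hu p)).1).neg ?_
    exact FieldCkAt.sum _ fun i => FieldCkAt.smul (hL.charpoly_coeff _) (hL.pow i X hX)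
  refine h1.congr_of_eventuallyEq (Eventually.of_forall fun q => ?_)
  simp only
  rw [(LinearMap.ringInverse_eq_aeval_divX _ (hu q)).2]
  have h : (L q).charpoly.natDegree = m := by
    rw [LinearMap.charpoly_natDegree]
    change Module.finrank ℝ (EuclideanSpace ℝ (Fin m)) = _
    simp
  have h' : Polynomial.aeval (L q : Module.End ℝ (TangentSpace (𝓡 m) q)) (L q).charpoly.divX
      = ∑ i ∈ Finset.range m, (L q).charpoly.coeff (i + 1) •
        (L q : Module.End ℝ (TangentSpace (𝓡 m) q)) ^ i := by
    rcases Nat.eq_zero_or_pos m with hm | hm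
    · have h0 : (L q).charpoly.divX = 0 := by
        rw [Polynomial.divX_eq_zero_iff]
        exact Polynomial.eq_C_of_natDegree_eq_zero (h.trans hm)
      have h1 : Finset.range m = ∅ := by simp [hm]
      rw [h0, map_zero, h1, Finset.sum_empty]
    · rw [Polynomial.aeval_eq_sum_range' (n := m)]
      · simp [Polynomial.coeff_divX]
      · rw [Polynomial.natDegree_divX_eq_natDegree_tsub_one, h]
        omega
  rw [h']
  simp
  rfl

end Endomorphisms

/-! ### Gradient and divergence -/

section DivGrad

lemma inner_grad (f : M → ℝ) (p : M) (v : TangentSpace (𝓡 m) p) :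
    inner ℝ (grad f p) v = mvfderiv (𝓡 m) f p v := by
  conv_rhs => rw [← (frame p).sum_repr v]
  simp only [grad, sum_inner, real_inner_smul_left, map_sum, map_smul, smul_eq_mul,
    OrthonormalBasis.repr_apply_apply]
  exact Finset.sum_congr rfl fun i _ => mul_comm _ _

lemma fieldCkAt_grad {k : ℕ∞} {l : ℕ∞ω} {f : M → ℝ} (hf : ContMDiffAt (𝓡 m) 𝓘(ℝ) l f p)
    (h : (k : ℕ∞ω) + 1 ≤ l) : FieldCkAt (k : ℕ∞ω) (fun q : M => grad (m := m) f q) p := by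
  obtain ⟨e, he⟩ := exists_orthonormalFrameAt (m := m) p
  have hk : (k : ℕ∞ω) ≤ ∞ := by exact_mod_cast le_top
  refine he.fieldCkAt hk fun i => ?_
  have := contMDiffAt_mvfderiv_field hf (ContMDiffAt.of_le (he.smooth i) hk) h
  refine this.congr_of_eventuallyEq (Eventually.of_forall fun q => ?_)
  simp only
  rw [real_inner_comm, inner_grad]

lemma div_eq_sum_inner {ι : Type*} [Fintype ι] (b : OrthonormalBasis ι ℝ (TangentSpace (𝓡 m) p))
    (V : (q : M) → TangentSpace (𝓡 m) q) :
    div V p = ∑ i, inner ℝ (b i) (nabla V p (b i)) := by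
  rw [div, LinearMap.trace_eq_sum_inner _ b]

lemma div_congr (hY : FieldDiffAt Y p) (h : Z =ᶠ[𝓝 p] Y) : div Z p = div Y p := by
  rw [div, div, nabla_congr hY h]

lemma div_sub (hY : FieldDiffAt Y p) (hZ : FieldDiffAt Z p) :
    div (Y - Z) p = div Y p - div Z p := by
  rw [div, nabla_sub hY hZ, map_sub]; rfl

lemma div_const_smul (c : ℝ) (hY : FieldDiffAt Y p) : div (c • Y) p = c * div Y p := by
  rw [div, nabla_const_smul c hY, map_smul]; rfl

lemma div_sum {ι : Type*} (s : Finset ι) {Y : ι → (q : M) → TangentSpace (𝓡 m) q}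
    (hY : ∀ i, FieldDiffAt (Y i) p) : div (∑ i ∈ s, Y i) p = ∑ i ∈ s, div (Y i) p := by
  rw [div, nabla_sum s hY, map_sum]; rfl

lemma div_zero : div (0 : (q : M) → TangentSpace (𝓡 m) q) p = 0 := by
  rw [div, nabla_zero, map_zero]

lemma div_smul {f : M → ℝ} (hf : MDifferentiableAt (𝓡 m) 𝓘(ℝ) f p) (hY : FieldDiffAt Y p) :
    div (f • Y) p = f p * div Y p + mvfderiv (𝓡 m) f p (Y p) := by
  rw [div_eq_sum_inner (frame p), div_eq_sum_inner (frame p), Finset.mul_sum]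
  conv_rhs => rw [← (frame p).sum_repr (Y p)]
  simp only [nabla_smul hf hY, inner_add_right, real_inner_smul_right, map_sum, map_smul,
    smul_eq_mul, OrthonormalBasis.repr_apply_apply, Finset.sum_add_distrib]
  rw [add_comm]
  congr 1
  exact Finset.sum_congr rfl fun i _ => mul_comm _ _

lemma contMDiffAt_div {k l : ℕ∞} (h : k + 1 ≤ l) (hX : FieldCkAt l X p) :
    ContMDiffAt (𝓡 m) 𝓘(ℝ) k (div X) p :=
  contMDiffAt_trace (by exact_mod_cast le_top) fun _ hV =>
    FieldCkAt.nabla h (ContMDiffAt.of_le hV (by exact_mod_cast le_top)) hX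

end DivGrad

/-! ### The divergence of a field of endomorphisms -/

section TraceNabla

variable {P : (q : M) → TangentSpace (𝓡 m) q →ₗ[ℝ] TangentSpace (𝓡 m) q}

lemma EndSmoothAt.fieldDiffAt (hP : EndSmoothAt P p) (hX : FieldDiffAt X p) :
    FieldDiffAt (fun q => P q (X q)) p := by
  obtain ⟨e, he⟩ := exists_orthonormalFrameAt (m := m) p
  refine FieldDiffAt.congr_of_eventuallyEq (Y := ∑ i, (fun q => (inner ℝ (e i q) (X q) : ℝ)) •
    fun q => P q (e i q)) (FieldDiffAt.sum Finset.univ fun i =>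
    FieldDiffAt.smul (mdiffAt_inner (he.smooth i).diffAt hX)
      (FieldCkAt.diffAt (hP _ (he.smooth i)))) ?_
  filter_upwards [he.eventually_sum] with q hq
  conv_lhs => rw [← hq (X q)]
  simp
  rfl

/-- The product rule for the divergence of `P V`, where `P` is a field of symmetric
endomorphisms. -/
lemma div_endomorphism_apply (hP : EndSmoothAt P p) (hs : ∀ q, (P q).IsSymmetric)
    (hX : FieldDiffAt X p) :
    div (fun q => P q (X q)) p =
      LinearMap.trace ℝ (TangentSpace (𝓡 m) p) (P p ∘ₗ nabla X p) +
        inner ℝ (traceNabla P p) (X p) := by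
  rw [div_eq_sum_inner (frame p), LinearMap.trace_eq_sum_inner _ (frame p), traceNabla, sum_inner,
    ← Finset.sum_add_distrib]
  refine Finset.sum_congr rfl fun i _ => ?_
  have hE := mdifferentiableAt_ext (m := m) (frame p i)
  have h1 := mvfderiv_inner (hP.fieldDiffAt hE) hX (frame p i)
  have h2 := mvfderiv_inner hE (hP.fieldDiffAt hX) (frame p i)
  have h3 : (fun q => (inner ℝ (P q (ext (frame p i) q)) (X q) : ℝ)) =
      fun q => inner ℝ (ext (frame p i) q) (P q (X q)) := funext fun q => hs q _ _
  rw [h3, h2, ext_self] at h1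
  rw [inner_sub_left, hs p, LinearMap.comp_apply, ← hs p (frame p i)]
  linarith

/-- Although `traceNabla` is defined through orthonormal bases chosen point by point, it is a smooth
field: its components are given by the product rule for the divergence. -/
lemma fieldCkAt_traceNabla (hP : ∀ q, EndSmoothAt P q) (hs : ∀ q, (P q).IsSymmetric) :
    FieldCkAt ∞ (fun q => traceNabla P q) p := by
  obtain ⟨e, he⟩ := exists_orthonormalFrameAt (m := m) p
  refine he.fieldCkAt le_rfl fun i => ?_
  have h1 : ContMDiffAt (𝓡 m) 𝓘(ℝ) ∞ (div fun q => P q (e i q)) p :=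
    contMDiffAt_div (k := ⊤) (l := ⊤) le_top (hP p _ (he.smooth i))
  have h2 : ContMDiffAt (𝓡 m) 𝓘(ℝ) ∞ (fun q => LinearMap.trace ℝ (TangentSpace (𝓡 m) q)
      (P q ∘ₗ nabla (e i) q)) p :=
    contMDiffAt_trace le_rfl fun V hV => hP p _
      (FieldCkAt.nabla (k := ⊤) (l := ⊤) le_top hV (he.smooth i))
  refine (h1.sub h2).congr_of_eventuallyEq ?_
  filter_upwards [he.eventually_diffAt] with q hq
  rw [div_endomorphism_apply (hP q) hs (hq i), real_inner_comm]
  ring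

end TraceNabla

/-! ### The pointwise inequality -/

section Pointwise

variable {P : (q : M) → TangentSpace (𝓡 m) q →ₗ[ℝ] TangentSpace (𝓡 m) q}

/-- The field `P (∇u) / u - τ / 2` with `τ = trace (∇P)`; for a supersolution `u` it satisfies a
Riccati inequality. -/
def riccatiField (P : (q : M) → TangentSpace (𝓡 m) q →ₗ[ℝ] TangentSpace (𝓡 m) q) (u : M → ℝ)
    (q : M) : TangentSpace (𝓡 m) q :=
  (u q)⁻¹ • P q (grad u q) - (1 / 2 : ℝ) • traceNabla P q

/-- A positive supersolution `u` of `trace (P Hess u) + c u` turns the quadratic form of the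
symmetrized operator into a nonnegative quadratic form plus a divergence. With `W` the Riccati field
of `u`, the difference of the two sides is the sum of `⟨P ξ, ξ⟩`, where
`ξ = ∇f - f (∇u / u + X / 2)`, and of `-f² / u` times the supersolution expression. -/
lemma div_le_neg_mul_of_supersolution (hP : ∀ q, EndSmoothAt P q) (hs : ∀ q, (P q).IsSymmetric)
    (hpos : ∀ v : TangentSpace (𝓡 m) p, 0 ≤ inner ℝ (P p v) v) {c : ℝ} {u f : M → ℝ}
    (hu : ContMDiff (𝓡 m) 𝓘(ℝ) ∞ u) (hu0 : ∀ q, 0 < u q)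
    (huc : LinearMap.trace ℝ (TangentSpace (𝓡 m) p) (P p ∘ₗ hess u p) + c * u p ≤ 0)
    (hf : ContMDiff (𝓡 m) 𝓘(ℝ) 2 f) (hX : ∀ q, P q (X q) = -traceNabla P q) :
    div ((fun q => f q ^ 2) • (fun q => riccatiField P u q) - f • fun q => P q (grad f q)) p ≤
      -(f p * (div (fun q => P q (grad f q)) p + (c - (1 / 2 : ℝ) * div (fun q => P q (X q)) p
        - inner ℝ (P p (X p)) (X p) / 4) * f p)) := by
  have hfd : MDifferentiableAt (𝓡 m) 𝓘(ℝ) f p := (hf p).mdifferentiableAt (by simp)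
  have hud : MDifferentiableAt (𝓡 m) 𝓘(ℝ) u p := (hu p).mdifferentiableAt (by simp)
  have hgf : FieldDiffAt (fun q => grad f q) p :=
    FieldCkAt.diffAt (k := ((1 : ℕ∞) : ℕ∞ω)) (fieldCkAt_grad (hf p) (by norm_num))
  have hgu : FieldDiffAt (fun q => grad u q) p :=
    FieldCkAt.diffAt (k := ((1 : ℕ∞) : ℕ∞ω)) (fieldCkAt_grad (hu p) (by exact_mod_cast le_top))
  have hτ : FieldDiffAt (fun q => traceNabla P q) p := (fieldCkAt_traceNabla hP hs).diffAt
  have hui : ContMDiffAt (𝓡 m) 𝓘(ℝ) ∞ (fun q => (u q)⁻¹) p := (hu p).inv₀ (hu0 p).ne'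
  have huid := hui.mdifferentiableAt (by simp)
  have hf2 : MDifferentiableAt (𝓡 m) 𝓘(ℝ) (fun q => f q ^ 2) p :=
    ((hf p).pow 2).mdifferentiableAt (by simp)
  have hW1 : FieldDiffAt ((fun q => (u q)⁻¹) • fun q => P q (grad u q)) p :=
    FieldDiffAt.smul huid ((hP p).fieldDiffAt hgu)
  have hW2 : FieldDiffAt ((1 / 2 : ℝ) • fun q => traceNabla P q) p := FieldDiffAt.const_smul _ hτ
  have hW : FieldDiffAt (fun q => riccatiField P u q) p := by
    have := mdifferentiableAt_sub_section hW1 hW2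
    exact this
  have e1 : div (fun q => riccatiField P u q) p =
      (u p)⁻¹ * div (fun q => P q (grad u q)) p
        + mvfderiv (𝓡 m) (fun q => (u q)⁻¹) p (P p (grad u p))
        - (1 / 2) * div (fun q => traceNabla P q) p := by
    have h := div_sub hW1 hW2
    rw [div_smul huid ((hP p).fieldDiffAt hgu), div_const_smul _ hτ] at h
    exact h
  have e2 : ∀ v, mvfderiv (𝓡 m) (fun q => (u q)⁻¹) p v =
      -((u p)⁻¹ * (u p)⁻¹) * inner ℝ (grad u p) v := fun v => by
    have h := congrArg (fun T => T v) (mvfderiv_mul huid hud)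
    have h1 : (fun q => (u q)⁻¹) * u = fun _ => (1 : ℝ) := by
      funext q; exact inv_mul_cancel₀ (hu0 q).ne'
    rw [h1, mvfderiv_const] at h
    simp only [zero_apply, add_apply,
      smul_apply, smul_eq_mul] at h
    rw [inner_grad]
    have := (hu0 p).ne'
    field_simp at h ⊢
    linarith
  have e3 : ∀ v, mvfderiv (𝓡 m) (fun q => f q ^ 2) p v = 2 * f p * inner ℝ (grad f p) v :=
    fun v => by
    have h := congrArg (fun T => T v) (mvfderiv_mul hfd hfd)
    simp only [add_apply, smul_apply, smul_eq_mul] at h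
    have h1 : (fun q => f q ^ 2) = f * f := by funext q; exact sq (f q)
    rw [h1, h, inner_grad]
    ring
  have e4 : div (fun q => P q (X q)) p = - div (fun q => traceNabla P q) p := by
    have h : (fun q => P q (X q)) = (-1 : ℝ) • fun q => traceNabla P q := by
      funext q; simp [hX]
    rw [h, div_const_smul _ hτ]; ring
  rw [div_sub (FieldDiffAt.smul hf2 hW) (FieldDiffAt.smul hfd ((hP p).fieldDiffAt hgf)),
    div_smul hf2 hW, div_smul hfd ((hP p).fieldDiffAt hgf), e1, e2, e3, e4,
    div_endomorphism_apply (hP p) hs hgu, ← inner_grad]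
  -- completing the square: this is the only use of the positivity of `P`
  have hnn := hpos (grad f p - f p • ((u p)⁻¹ • grad u p + (1 / 2 : ℝ) • X p))
  have s1 := hs p (grad u p) (X p)
  have s2 := hs p (grad f p) (X p)
  have s3 := hs p (grad f p) (grad u p)
  have s4 : traceNabla P p = - P p (X p) := by rw [hX, neg_neg]
  have hu' : (u p)⁻¹ * u p = 1 := inv_mul_cancel₀ (hu0 p).ne'
  have hui0 : 0 < (u p)⁻¹ := inv_pos.2 (hu0 p)
  have huc' := mul_le_mul_of_nonneg_left huc (mul_nonneg hui0.le (sq_nonneg (f p)))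
  simp only [hess] at huc'
  simp only [map_sub, map_add, map_smul, inner_sub_left, inner_sub_right,
    inner_add_left, inner_add_right, real_inner_smul_left, real_inner_smul_right] at hnn
  simp only [riccatiField, s4, inner_sub_right,
    real_inner_smul_right, inner_neg_left, inner_neg_right, smul_neg,
    real_inner_comm (P p (X p)) (grad f p), real_inner_comm (P p (grad f p)) (grad f p),
    real_inner_comm (P p (grad u p))]
  rw [s1, s2, s3, real_inner_comm (P p (X p)) (grad f p), real_inner_comm (P p (X p)) (grad u p),
    real_inner_comm (P p (grad u p)) (grad f p)] at hnn
  linear_combination hnn + huc' - c * f p ^ 2 * hu'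

end Pointwise

/-! ### Second derivatives and the Lie bracket -/

section Commutator

open VectorField

lemma eventually_mdifferentiableAt_of_contMDiffAt {f : M → ℝ} {k : ℕ∞ω} (hf : ContMDiffAt (𝓡 m) 𝓘(ℝ) k f p)
    (hk : 1 ≤ k) : ∀ᶠ q in 𝓝 p, MDifferentiableAt (𝓡 m) 𝓘(ℝ) f q := by
  filter_upwards [(contMDiffAt_iff_contMDiffAt_nhds (n := 1) (by simp)).1
    (ContMDiffAt.of_le hf hk)] with q hq
  exact ContMDiffAt.mdifferentiableAt hq (by simp)

lemma fieldDiffAt_mlieBracket (hX : FieldCkAt 2 X p) (hY : FieldCkAt 2 Y p) :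
    FieldDiffAt (mlieBracket (𝓡 m) X Y) p := by
  have h : FieldCkAt ((1 : ℕ∞) : ℕ∞ω) (mlieBracket (𝓡 m) X Y) p := by
    have : IsManifold (𝓡 m) (((2 : ℕ∞) : ℕ∞ω) + 1) M :=
      IsManifold.of_le (n := ∞) (by exact_mod_cast le_top)
    have : IsManifold (𝓡 m) (minSmoothness ℝ 2) M := by
      rw [minSmoothness_of_isRCLikeNormedField]; infer_instance
    exact ContMDiffAt.mlieBracket_vectorField (n := 2) (m := 1) hX hY
      (by simp; norm_num)
  exact h.diffAt

/-- The Lie bracket of vector fields is the commutator of the corresponding derivations. The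
identity is the coefficient of `Z` in the Jacobi identity for `X`, `Y`, `f • Z`. -/
lemma mvfderiv_mvfderiv_sub {f : M → ℝ} (hf : ContMDiffAt (𝓡 m) 𝓘(ℝ) 2 f p)
    (hX : FieldCkAt 2 X p) (hY : FieldCkAt 2 Y p) :
    mvfderiv (𝓡 m) (fun q => mvfderiv (𝓡 m) f q (Y q)) p (X p)
      - mvfderiv (𝓡 m) (fun q => mvfderiv (𝓡 m) f q (X q)) p (Y p)
      = mvfderiv (𝓡 m) f p (mlieBracket (𝓡 m) X Y p) := by
  rcases isEmpty_or_nonempty (Fin m) with hm | ⟨⟨i⟩⟩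
  · have h0 : ∀ v : TangentSpace (𝓡 m) p, v = 0 := fun v => by
      have : Subsingleton (EuclideanSpace ℝ (Fin m)) := inferInstance
      exact this.elim v 0
    rw [h0 (X p), h0 (Y p), h0 (mlieBracket (𝓡 m) X Y p)]
    simp
  -- any smooth field which does not vanish at `p` will do for `Z`
  obtain ⟨e, he⟩ := exists_orthonormalFrameAt (m := m) p
  have hZ : FieldCkAt 2 (e i) p := ContMDiffAt.of_le (he.smooth i)
    ENat.LEInfty.out
  set Z := e i with hZdef
  have hZ0 : Z p ≠ 0 := he.orthonormal.self_of_nhds.ne_zero i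
  have hfd : MDifferentiableAt (𝓡 m) 𝓘(ℝ) f p := hf.mdifferentiableAt (by simp)
  have hms : minSmoothness ℝ 2 = 2 := minSmoothness_of_isRCLikeNormedField
  have hms3 : minSmoothness ℝ 3 = 3 := minSmoothness_of_isRCLikeNormedField
  have : IsManifold (𝓡 m) (minSmoothness ℝ 3) M := by
    rw [hms3]; exact IsManifold.of_le (n := ∞) ENat.LEInfty.out
  have key : ∀ W : (q : M) → TangentSpace (𝓡 m) q, FieldCkAt 2 W p →
      mlieBracket (𝓡 m) X (mlieBracket (𝓡 m) Y W) p =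
        mlieBracket (𝓡 m) (mlieBracket (𝓡 m) X Y) W p +
          mlieBracket (𝓡 m) Y (mlieBracket (𝓡 m) X W) p := fun W hW =>
    leibniz_identity_mlieBracket_apply (by rw [hms]; exact hX) (by rw [hms]; exact hY)
      (by rw [hms]; exact hW)
  have hder : ∀ U : (q : M) → TangentSpace (𝓡 m) q, FieldCkAt 2 U p →
      MDifferentiableAt (𝓡 m) 𝓘(ℝ) (fun q => mvfderiv (𝓡 m) f q (U q)) p := fun U hU =>
    (contMDiffAt_mvfderiv_field (k := 1) hf (ContMDiffAt.of_le hU (by norm_num))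
      (by norm_num)).mdifferentiableAt (by simp)
  have h2 : ∀ U V : (q : M) → TangentSpace (𝓡 m) q, FieldCkAt 2 U p → FieldCkAt 2 V p →
      mlieBracket (𝓡 m) U (mlieBracket (𝓡 m) V (f • Z)) p =
        (mvfderiv (𝓡 m) (fun q => mvfderiv (𝓡 m) f q (V q)) p (U p) • Z p +
          mvfderiv (𝓡 m) f p (V p) • mlieBracket (𝓡 m) U Z p) +
        (mvfderiv (𝓡 m) f p (U p) • mlieBracket (𝓡 m) V Z p +
          f p • mlieBracket (𝓡 m) U (mlieBracket (𝓡 m) V Z) p) := by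
    intro U V hU hV
    have he : mlieBracket (𝓡 m) V (f • Z) =ᶠ[𝓝 p]
        (fun q => mvfderiv (𝓡 m) f q (V q)) • Z + f • mlieBracket (𝓡 m) V Z := by
      filter_upwards [eventually_mdifferentiableAt_of_contMDiffAt hf (by norm_num), hZ.eventually_diffAt]
        with q hq hq'
      exact mlieBracket_smul_right hq hq'
    have hb := fieldDiffAt_mlieBracket hV hZ
    rw [EventuallyEq.mlieBracket_vectorField_eq (EventuallyEq.refl _ U) he,
      mlieBracket_add_right ((hder V hV).smul_section hZ.diffAt) (hfd.smul_section hb),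
      mlieBracket_smul_right (hder V hV) hZ.diffAt, mlieBracket_smul_right hfd hb]
  have h := key (f • Z) (FieldCkAt.smul hf hZ)
  rw [h2 X Y hX hY, h2 Y X hY hX, mlieBracket_smul_right hfd hZ.diffAt, key Z hZ] at h
  have h' : (mvfderiv (𝓡 m) (fun q => mvfderiv (𝓡 m) f q (Y q)) p (X p)
      - mvfderiv (𝓡 m) (fun q => mvfderiv (𝓡 m) f q (X q)) p (Y p)
      - mvfderiv (𝓡 m) f p (mlieBracket (𝓡 m) X Y p)) • Z p = 0 := by
    rw [sub_smul, sub_smul, ← sub_eq_zero.2 h]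
    module
  rcases smul_eq_zero.1 h' with h' | h'
  · linarith
  · exact absurd h' hZ0

end Commutator

/-! ### Tensoriality and smoothness of the curvature -/

section Curvature

open VectorField

/-- The curvature `R(X, Y) Z` computed from vector fields. -/
def curvatureField (X Y Z : (q : M) → TangentSpace (𝓡 m) q) (p : M) : TangentSpace (𝓡 m) p :=
  nabla (fun q => nabla Z q (Y q)) p (X p) - nabla (fun q => nabla Z q (X q)) p (Y p)
    - nabla Z p (mlieBracket (𝓡 m) X Y p)

lemma curvatureField_swap : curvatureField X Y Z p = -curvatureField Y X Z p := by
  rw [curvatureField, curvatureField, mlieBracket_swap_apply, map_neg]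
  abel

variable {X' Z' : (q : M) → TangentSpace (𝓡 m) q}

lemma curvatureField_congr_left (hX : FieldDiffAt X p) (hZ : FieldCkAt 2 Z p)
    (h : X' =ᶠ[𝓝 p] X) :
    curvatureField X' Y Z p = curvatureField X Y Z p := by
  rw [curvatureField, curvatureField, h.self_of_nhds,
    h.mlieBracket_vectorField_eq (EventuallyEq.refl _ Y),
    nabla_congr (hX.nabla hZ) (Z := fun q => nabla Z q (X' q))]
  filter_upwards [h] with q hq
  rw [hq]

lemma curvatureField_add_left (hX : FieldDiffAt X p) (hX' : FieldDiffAt X' p)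
    (hZ : FieldCkAt 2 Z p) :
    curvatureField (X + X') Y Z p = curvatureField X Y Z p + curvatureField X' Y Z p := by
  have h : (fun q => nabla Z q ((X + X') q)) =
      (fun q => nabla Z q (X q)) + fun q => nabla Z q (X' q) := by
    funext q; exact map_add (nabla Z q) _ _
  simp only [curvatureField]
  rw [h, nabla_add (hX.nabla hZ) (hX'.nabla hZ), mlieBracket_add_left hX hX', Pi.add_apply,
    map_add, map_add, LinearMap.add_apply]
  abel

lemma curvatureField_smul_left {f : M → ℝ} (hf : MDifferentiableAt (𝓡 m) 𝓘(ℝ) f p)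
    (hX : FieldDiffAt X p) (hZ : FieldCkAt 2 Z p) :
    curvatureField (f • X) Y Z p = f p • curvatureField X Y Z p := by
  have h : (fun q => nabla Z q ((f • X) q)) = f • fun q => nabla Z q (X q) := by
    funext q; exact map_smul (nabla Z q) _ _
  simp only [curvatureField]
  rw [h, nabla_smul hf (hX.nabla hZ), mlieBracket_smul_left hf hX, Pi.smul_apply',
    map_smul, map_add, map_smul, map_smul]
  module

lemma curvatureField_congr_right (hX : FieldDiffAt X p) (hY : FieldDiffAt Y p)
    (hZ : FieldCkAt 2 Z p) (h : Z' =ᶠ[𝓝 p] Z) :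
    curvatureField X Y Z' p = curvatureField X Y Z p := by
  have h1 : ∀ W : (q : M) → TangentSpace (𝓡 m) q,
      (fun q => nabla Z' q (W q)) =ᶠ[𝓝 p] fun q => nabla Z q (W q) := fun W => by
    filter_upwards [h.eventuallyEq_nhds, hZ.eventually_diffAt] with q hq hq'
    rw [nabla_congr hq' hq]
  rw [curvatureField, curvatureField, nabla_congr (hY.nabla hZ) (h1 Y),
    nabla_congr (hX.nabla hZ) (h1 X), nabla_congr hZ.diffAt h]

lemma curvatureField_add_right (hX : FieldDiffAt X p) (hY : FieldDiffAt Y p)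
    (hZ : FieldCkAt 2 Z p) (hZ' : FieldCkAt 2 Z' p) :
    curvatureField X Y (Z + Z') p = curvatureField X Y Z p + curvatureField X Y Z' p := by
  have h1 : ∀ W : (q : M) → TangentSpace (𝓡 m) q,
      (fun q => nabla (Z + Z') q (W q)) =ᶠ[𝓝 p]
        (fun q => nabla Z q (W q)) + fun q => nabla Z' q (W q) := fun W => by
    filter_upwards [hZ.eventually_diffAt, hZ'.eventually_diffAt] with q hq hq'
    rw [nabla_add hq hq']; rfl
  simp only [curvatureField]
  rw [nabla_congr ((hY.nabla hZ).add (hY.nabla hZ')) (h1 Y),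
    nabla_congr ((hX.nabla hZ).add (hX.nabla hZ')) (h1 X), nabla_add hZ.diffAt hZ'.diffAt,
    nabla_add (hY.nabla hZ) (hY.nabla hZ'), nabla_add (hX.nabla hZ) (hX.nabla hZ')]
  simp only [LinearMap.add_apply]
  abel

lemma curvatureField_smul_right {f : M → ℝ} (hf : ContMDiffAt (𝓡 m) 𝓘(ℝ) 2 f p)
    (hX : FieldCkAt 2 X p) (hY : FieldCkAt 2 Y p) (hZ : FieldCkAt 2 Z p) :
    curvatureField X Y (f • Z) p = f p • curvatureField X Y Z p := by
  have hder : ∀ U : (q : M) → TangentSpace (𝓡 m) q, FieldCkAt 2 U p →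
      MDifferentiableAt (𝓡 m) 𝓘(ℝ) (fun q => mvfderiv (𝓡 m) f q (U q)) p := fun U hU =>
    (contMDiffAt_mvfderiv_field (k := 1) hf (ContMDiffAt.of_le hU (by norm_num))
      (by norm_num)).mdifferentiableAt (by simp)
  have hfd : MDifferentiableAt (𝓡 m) 𝓘(ℝ) f p := hf.mdifferentiableAt (by simp)
  have h1 : ∀ W : (q : M) → TangentSpace (𝓡 m) q,
      (fun q => nabla (f • Z) q (W q)) =ᶠ[𝓝 p]
        (fun q => mvfderiv (𝓡 m) f q (W q)) • Z + f • fun q => nabla Z q (W q) := fun W => by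
    filter_upwards [eventually_mdifferentiableAt_of_contMDiffAt hf (by norm_num), hZ.eventually_diffAt]
      with q hq hq'
    rw [nabla_smul hq hq']; rfl
  have h2 : ∀ U V : (q : M) → TangentSpace (𝓡 m) q, FieldCkAt 2 U p → FieldCkAt 2 V p →
      nabla (fun q => nabla (f • Z) q (V q)) p (U p) =
        (mvfderiv (𝓡 m) (fun q => mvfderiv (𝓡 m) f q (V q)) p (U p) • Z p +
          mvfderiv (𝓡 m) f p (V p) • nabla Z p (U p)) +
        (mvfderiv (𝓡 m) f p (U p) • nabla Z p (V p) +
          f p • nabla (fun q => nabla Z q (V q)) p (U p)) := by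
    intro U V hU hV
    have ha := FieldDiffAt.smul (hder V hV) hZ.diffAt
    have hb := FieldDiffAt.smul hfd (hV.diffAt.nabla hZ)
    rw [nabla_congr (ha.add hb) (h1 V), nabla_add ha hb, LinearMap.add_apply,
      nabla_smul (hder V hV) hZ.diffAt, nabla_smul hfd (hV.diffAt.nabla hZ)]
  simp only [curvatureField]
  rw [h2 X Y hX hY, h2 Y X hY hX, nabla_smul hfd hZ.diffAt, ← mvfderiv_mvfderiv_sub hf hX hY]
  module

lemma curvatureField_sum_left {ι : Type*} (s : Finset ι) {f : ι → M → ℝ}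
    {e : ι → (q : M) → TangentSpace (𝓡 m) q}
    (hf : ∀ i, MDifferentiableAt (𝓡 m) 𝓘(ℝ) (f i) p) (he : ∀ i, FieldDiffAt (e i) p)
    (hZ : FieldCkAt 2 Z p) :
    curvatureField (∑ i ∈ s, f i • e i) Y Z p = ∑ i ∈ s, f i p • curvatureField (e i) Y Z p := by
  classical
  induction s using Finset.induction_on with
  | empty =>
    have h := curvatureField_smul_left (Y := Y) (f := fun _ : M => (0 : ℝ)) (X := 0) (p := p)
      mdifferentiableAt_const (FieldCkAt.diffAt (k := 1) (contMDiff_zeroSection ℝ _ p)) hZ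
    simpa using h
  | insert a s ha ih =>
    rw [Finset.sum_insert ha, Finset.sum_insert ha, curvatureField_add_left
      (FieldDiffAt.smul (hf a) (he a)) (FieldDiffAt.sum s fun i => FieldDiffAt.smul (hf i) (he i))
      hZ, ih, curvatureField_smul_left (hf a) (he a) hZ]

lemma curvatureField_sum_right {ι : Type*} (s : Finset ι) {f : ι → M → ℝ}
    {e : ι → (q : M) → TangentSpace (𝓡 m) q}
    (hf : ∀ i, ContMDiffAt (𝓡 m) 𝓘(ℝ) 2 (f i) p) (he : ∀ i, FieldCkAt 2 (e i) p)
    (hX : FieldCkAt 2 X p) (hY : FieldCkAt 2 Y p) :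
    curvatureField X Y (∑ i ∈ s, f i • e i) p = ∑ i ∈ s, f i p • curvatureField X Y (e i) p := by
  classical
  induction s using Finset.induction_on with
  | empty =>
    have h := curvatureField_smul_right (f := fun _ : M => (0 : ℝ)) (Z := 0) (p := p)
      contMDiffAt_const hX hY (contMDiff_zeroSection ℝ _ p)
    simpa using h
  | insert a s ha ih =>
    rw [Finset.sum_insert ha, Finset.sum_insert ha, curvatureField_add_right hX.diffAt hY.diffAt
      (FieldCkAt.smul (hf a) (he a)) (FieldCkAt.sum s fun i => FieldCkAt.smul (hf i) (he i)),
      ih, curvatureField_smul_right (hf a) hX hY (he a)]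

/-- The curvature is a tensor: it is computed by the components of the vectors in any
orthonormal frame. -/
lemma curvature_eq_sum {e : Fin m → (q : M) → TangentSpace (𝓡 m) q}
    (he : ∀ i, FieldCkAt 2 (e i) p)
    (hsum : ∀ᶠ q in 𝓝 p, ∀ v : TangentSpace (𝓡 m) q, ∑ i, (inner ℝ (e i q) v : ℝ) • e i q = v)
    (u v w : TangentSpace (𝓡 m) p) :
    curvature p u v w = ∑ a, ∑ b, ∑ c, ((inner ℝ (e a p) u * inner ℝ (e b p) v *
      inner ℝ (e c p) w : ℝ) • curvatureField (e a) (e b) (e c) p) := by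
  have h2 : (2 : ℕ∞ω) ≤ ∞ := ENat.LEInfty.out
  have hext : ∀ v : TangentSpace (𝓡 m) p, FieldCkAt 2 (ext v) p := fun v =>
    ContMDiffAt.of_le (contMDiffAt_ext v) h2
  have hin : ∀ (v : TangentSpace (𝓡 m) p) (i : Fin m), ContMDiffAt (𝓡 m) 𝓘(ℝ) 2
      (fun q => (inner ℝ (e i q) (ext v q) : ℝ)) p := fun v i =>
    contMDiffAt_inner h2 (he i) (hext v)
  have hex : ∀ v : TangentSpace (𝓡 m) p,
      ext v =ᶠ[𝓝 p] ∑ i, (fun q => (inner ℝ (e i q) (ext v q) : ℝ)) • e i := fun v => by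
    filter_upwards [hsum] with q hq
    refine (hq (ext v q)).symm.trans ?_
    exact (Finset.sum_apply (M := fun q : M => TangentSpace (𝓡 m) q) q Finset.univ
      fun i => (fun q => (inner ℝ (e i q) (ext v q) : ℝ)) • e i).symm
  have hck : ∀ v : TangentSpace (𝓡 m) p,
      FieldCkAt 2 (∑ i, (fun q => (inner ℝ (e i q) (ext v q) : ℝ)) • e i) p := fun v =>
    FieldCkAt.sum _ fun i => FieldCkAt.smul (hin v i) (he i)
  have hl : ∀ (v : TangentSpace (𝓡 m) p) (Y Z : (q : M) → TangentSpace (𝓡 m) q),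
      FieldCkAt 2 Z p → curvatureField (ext v) Y Z p =
        ∑ i, (inner ℝ (e i p) v : ℝ) • curvatureField (e i) Y Z p := fun v Y Z hZ => by
    rw [curvatureField_congr_left (hck v).diffAt hZ (hex v), curvatureField_sum_left _
      (fun i => (hin v i).mdifferentiableAt (by simp)) (fun i => (he i).diffAt) hZ]
    simp only [ext_self]
  have hr : ∀ a b, curvatureField (e a) (e b) (ext w) p =
        ∑ i, (inner ℝ (e i p) w : ℝ) • curvatureField (e a) (e b) (e i) p := fun a b => by
    rw [curvatureField_congr_right (he a).diffAt (he b).diffAt (hck w) (hex w),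
      curvatureField_sum_right _ (hin w) he (he a) (he b)]
    simp only [ext_self]
  have h0 : curvature p u v w = curvatureField (ext u) (ext v) (ext w) p := by
    simp only [curvature, curvatureField, ext_self]
  rw [h0, hl u _ _ (hext w)]
  refine Finset.sum_congr rfl fun a _ => ?_
  rw [curvatureField_swap, hl v _ _ (hext w), smul_neg, Finset.smul_sum, ← Finset.sum_neg_distrib]
  refine Finset.sum_congr rfl fun b _ => ?_
  rw [curvatureField_swap, smul_neg, smul_neg, neg_neg, hr a b, Finset.smul_sum, Finset.smul_sum]
  exact Finset.sum_congr rfl fun c _ => by module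

lemma fieldCkAt_curvatureField (hX : FieldCkAt ∞ X p) (hY : FieldCkAt ∞ Y p)
    (hZ : FieldCkAt ∞ Z p) : FieldCkAt ∞ (fun q => curvatureField X Y Z q) p := by
  have hn : ∀ {U V : (q : M) → TangentSpace (𝓡 m) q}, FieldCkAt ∞ U p → FieldCkAt ∞ V p →
      FieldCkAt ∞ (fun q => nabla V q (U q)) p := fun hU hV =>
    FieldCkAt.nabla (k := ⊤) (l := ⊤) le_top hU hV
  have hb : FieldCkAt ((⊤ : ℕ∞) : ℕ∞ω) (mlieBracket (𝓡 m) X Y) p := by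
    have : IsManifold (𝓡 m) (((⊤ : ℕ∞) : ℕ∞ω) + 1) M :=
      IsManifold.of_le (n := ∞) (by exact_mod_cast le_top)
    have : IsManifold (𝓡 m) (minSmoothness ℝ 2) M := by
      rw [minSmoothness_of_isRCLikeNormedField]; infer_instance
    exact ContMDiffAt.mlieBracket_vectorField (n := ⊤) (m := ⊤) hX hY (by simp)
  exact ((hn hX (hn hY hZ)).sub (hn hY (hn hX hZ))).sub (hn hb hZ)

end Curvature

/-! ### Coordinate vector fields -/

section Coordinates

open VectorField

/-- The coordinate vector field with constant components `v` in the preferred chart at `c`. -/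
def coordField (c : M) (v : EuclideanSpace ℝ (Fin m)) (q : M) : TangentSpace (𝓡 m) q :=
  (trivializationAt (EuclideanSpace ℝ (Fin m)) (fun q : M => TangentSpace (𝓡 m) q) c).symmL ℝ q v

variable {c : M} {q : M} {v w : EuclideanSpace ℝ (Fin m)}

lemma trivializationAt_snd_eq_mvfderiv (hq : q ∈ (chartAt (EuclideanSpace ℝ (Fin m)) c).source)
    (w : TangentSpace (𝓡 m) q) :
    (trivializationAt (EuclideanSpace ℝ (Fin m)) (fun q : M => TangentSpace (𝓡 m) q) c
      ⟨q, w⟩).2 = mvfderiv (𝓡 m) (extChartAt (𝓡 m) c) q w := by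
  have h := congrArg (fun T => T w) (TangentBundle.continuousLinearMapAt_trivializationAt
    (I := 𝓡 m) hq)
  rw [← Trivialization.continuousLinearMapAt_apply_of_mem (R := ℝ)]
  · exact h
  · simpa using hq

lemma mvfderiv_extChartAt_coordField (hq : q ∈ (chartAt (EuclideanSpace ℝ (Fin m)) c).source)
    (v : EuclideanSpace ℝ (Fin m)) :
    mvfderiv (𝓡 m) (extChartAt (𝓡 m) c) q (coordField c v q) = v := by
  have hb : q ∈ (trivializationAt (EuclideanSpace ℝ (Fin m))
    (fun q : M => TangentSpace (𝓡 m) q) c).baseSet := by simpa using hq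
  have h := Trivialization.continuousLinearMapAt_symmL (R := ℝ) _ hb v
  rw [TangentBundle.continuousLinearMapAt_trivializationAt hq] at h
  exact h

lemma coordField_mvfderiv_extChartAt (hq : q ∈ (chartAt (EuclideanSpace ℝ (Fin m)) c).source)
    (w : TangentSpace (𝓡 m) q) :
    coordField c (mvfderiv (𝓡 m) (extChartAt (𝓡 m) c) q w) q = w := by
  have hb : q ∈ (trivializationAt (EuclideanSpace ℝ (Fin m))
    (fun q : M => TangentSpace (𝓡 m) q) c).baseSet := by simpa using hq
  have h := Trivialization.symmL_continuousLinearMapAt (R := ℝ) _ hb w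
  rw [TangentBundle.continuousLinearMapAt_trivializationAt hq] at h
  exact h

lemma coordField_add (v w : EuclideanSpace ℝ (Fin m)) :
    coordField c (v + w) = coordField c v + coordField c w := by
  funext q; exact map_add _ v w

lemma coordField_smul (a : ℝ) (v : EuclideanSpace ℝ (Fin m)) :
    coordField c (a • v) = a • coordField c v := by
  funext q; exact map_smul _ a v

lemma coordField_eq_sum (v : EuclideanSpace ℝ (Fin m)) :
    coordField c v = ∑ a, v a • coordField c (EuclideanSpace.basisFun (Fin m) ℝ a) := by
  funext q
  conv_lhs => rw [← (EuclideanSpace.basisFun (Fin m) ℝ).sum_repr v]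
  rw [Finset.sum_apply, coordField, map_sum]
  simp only [map_smul]
  rfl

lemma ext_eq_coordField {p : M} (v : TangentSpace (𝓡 m) p) :
    ext v =ᶠ[𝓝 p] coordField p (mvfderiv (𝓡 m) (extChartAt (𝓡 m) p) p v) := by
  filter_upwards [(chartAt (EuclideanSpace ℝ (Fin m)) p).open_source.mem_nhds
    (mem_chart_source _ p)] with q hq
  rw [ext, FiberBundle.extend, coordField, Trivialization.symmL_apply,
    trivializationAt_snd_eq_mvfderiv (mem_chart_source _ p)]
  simpa using hq

lemma fieldCkAt_coordField (hq : q ∈ (chartAt (EuclideanSpace ℝ (Fin m)) c).source)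
    (v : EuclideanSpace ℝ (Fin m)) : FieldCkAt ∞ (coordField c v) q := by
  have hb : q ∈ (trivializationAt (EuclideanSpace ℝ (Fin m))
    (fun q : M => TangentSpace (𝓡 m) q) c).baseSet := by simpa using hq
  refine (Trivialization.contMDiffAt_section_iff (IB := 𝓡 m) _ hb).2 ?_
  refine (contMDiffAt_const (c := v)).congr_of_eventuallyEq ?_
  filter_upwards [(chartAt (EuclideanSpace ℝ (Fin m)) c).open_source.mem_nhds hq] with y hy
  rw [trivializationAt_snd_eq_mvfderiv hy, mvfderiv_extChartAt_coordField hy]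

lemma mvfderiv_clm_comp {F G : Type*} [NormedAddCommGroup F] [NormedSpace ℝ F]
    [NormedAddCommGroup G] [NormedSpace ℝ G] (L : F →L[ℝ] G) {f : M → F}
    (hf : MDifferentiableAt (𝓡 m) 𝓘(ℝ, F) f p) (v : TangentSpace (𝓡 m) p) :
    mvfderiv (𝓡 m) (fun q => L (f q)) p v = L (mvfderiv (𝓡 m) f p v) := by
  have h := mfderiv_comp_apply p (L.mdifferentiableAt (x := f p)) hf v
  rw [L.mfderiv_eq] at h
  exact h

lemma contMDiffAt_extChartAt_apply (hq : q ∈ (chartAt (EuclideanSpace ℝ (Fin m)) c).source) :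
    ContMDiffAt (𝓡 m) 𝓘(ℝ, EuclideanSpace ℝ (Fin m)) ∞ (extChartAt (𝓡 m) c) q :=
  contMDiffAt_extChartAt' hq

/-- Coordinate vector fields of one chart commute. -/
lemma mlieBracket_coordField (hq : q ∈ (chartAt (EuclideanSpace ℝ (Fin m)) c).source)
    (v w : EuclideanSpace ℝ (Fin m)) :
    mlieBracket (𝓡 m) (coordField c v) (coordField c w) q = 0 := by
  have hφ := contMDiffAt_extChartAt_apply hq
  have hφd : MDifferentiableAt (𝓡 m) 𝓘(ℝ, EuclideanSpace ℝ (Fin m)) (extChartAt (𝓡 m) c) q :=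
    hφ.mdifferentiableAt (by simp)
  have h0 : mvfderiv (𝓡 m) (extChartAt (𝓡 m) c) q
      (mlieBracket (𝓡 m) (coordField c v) (coordField c w) q) = 0 := by
    ext a
    have ha : ContMDiffAt (𝓡 m) 𝓘(ℝ) 2 (fun y => EuclideanSpace.proj (𝕜 := ℝ) a
        (extChartAt (𝓡 m) c y)) q :=
      ContMDiffAt.of_le ((EuclideanSpace.proj (𝕜 := ℝ) a).contMDiff.contMDiffAt.comp q hφ)
        ENat.LEInfty.out
    have h := mvfderiv_mvfderiv_sub ha
      (ContMDiffAt.of_le (fieldCkAt_coordField hq v) ENat.LEInfty.out)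
      (ContMDiffAt.of_le (fieldCkAt_coordField hq w) ENat.LEInfty.out)
    have hc : ∀ u : EuclideanSpace ℝ (Fin m), (fun y => mvfderiv (𝓡 m)
        (fun y => EuclideanSpace.proj (𝕜 := ℝ) a (extChartAt (𝓡 m) c y)) y (coordField c u y))
          =ᶠ[𝓝 q] fun _ => u a := fun u => by
      filter_upwards [(chartAt (EuclideanSpace ℝ (Fin m)) c).open_source.mem_nhds hq] with y hy
      rw [mvfderiv_clm_comp _ ((contMDiffAt_extChartAt_apply hy).mdifferentiableAt (by simp)),
        mvfderiv_extChartAt_coordField hy]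
      rfl
    rw [mvfderiv_congr (hc v), mvfderiv_congr (hc w), mvfderiv_const, mvfderiv_const,
      mvfderiv_clm_comp _ hφd] at h
    simpa using h.symm
  rw [← coordField_mvfderiv_extChartAt hq (mlieBracket (𝓡 m) (coordField c v) (coordField c w) q),
    h0]
  exact map_zero _

/-- The components of a vector field in a chart. -/
def coords (c : M) (V : (q : M) → TangentSpace (𝓡 m) q) (q : M) : EuclideanSpace ℝ (Fin m) :=
  mvfderiv (𝓡 m) (extChartAt (𝓡 m) c) q (V q)

lemma eventuallyEq_sum_coords (hq : q ∈ (chartAt (EuclideanSpace ℝ (Fin m)) c).source)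
    (V : (q : M) → TangentSpace (𝓡 m) q) :
    V =ᶠ[𝓝 q] ∑ a, (fun y => coords c V y a) •
      coordField c (EuclideanSpace.basisFun (Fin m) ℝ a) := by
  filter_upwards [(chartAt (EuclideanSpace ℝ (Fin m)) c).open_source.mem_nhds hq] with y hy
  conv_lhs => rw [← coordField_mvfderiv_extChartAt hy (V y), coordField_eq_sum]
  exact (Finset.sum_apply (M := fun q : M => TangentSpace (𝓡 m) q) y Finset.univ _).trans
    (Finset.sum_apply (M := fun q : M => TangentSpace (𝓡 m) q) y Finset.univ fun a =>
      (fun y => coords c V y a) • coordField c (EuclideanSpace.basisFun (Fin m) ℝ a)).symm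

lemma contMDiffAt_coords (hq : q ∈ (chartAt (EuclideanSpace ℝ (Fin m)) c).source) {k : ℕ∞}
    (hX : FieldCkAt k X q) :
    ContMDiffAt (𝓡 m) 𝓘(ℝ, EuclideanSpace ℝ (Fin m)) k (coords c X) q :=
  contMDiffAt_mvfderiv_field (contMDiffAt_extChartAt_apply hq) hX (by exact_mod_cast le_top)

lemma mdifferentiableAt_coords (hq : q ∈ (chartAt (EuclideanSpace ℝ (Fin m)) c).source)
    (hX : FieldDiffAt X q) :
    MDifferentiableAt (𝓡 m) 𝓘(ℝ, EuclideanSpace ℝ (Fin m)) (coords c X) q := by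
  have hb : q ∈ (trivializationAt (EuclideanSpace ℝ (Fin m))
    (fun q : M => TangentSpace (𝓡 m) q) c).baseSet := by simpa using hq
  refine ((Trivialization.mdifferentiableAt_totalSpace_iff (IB := 𝓡 m) _ _
    (Trivialization.mem_source _ |>.2 hb)).1 hX).2.congr_of_eventuallyEq ?_
  filter_upwards [(chartAt (EuclideanSpace ℝ (Fin m)) c).open_source.mem_nhds hq] with y hy
  exact (trivializationAt_snd_eq_mvfderiv hy _).symm

lemma nabla_const_smul_apply (a : ℝ) (hX : FieldDiffAt X q) (v : TangentSpace (𝓡 m) q) :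
    nabla (a • X) q v = a • nabla X q v := by
  rw [nabla_const_smul a hX, LinearMap.smul_apply]

lemma nabla_coordField (hq : q ∈ (chartAt (EuclideanSpace ℝ (Fin m)) c).source)
    (v : EuclideanSpace ℝ (Fin m)) (u : TangentSpace (𝓡 m) q) :
    nabla (coordField c v) q u =
      ∑ a, v a • nabla (coordField c (EuclideanSpace.basisFun (Fin m) ℝ a)) q u := by
  rw [coordField_eq_sum, nabla_sum _ fun a =>
    FieldDiffAt.const_smul _ (fieldCkAt_coordField hq _).diffAt, LinearMap.sum_apply]
  exact Finset.sum_congr rfl fun a _ => nabla_const_smul_apply _ (fieldCkAt_coordField hq _).diffAt u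

/-- The Levi-Civita connection in coordinates: the derivative of the components plus a
zeroth order term. -/
lemma nabla_eq_coords (hX : FieldDiffAt X p) (u : TangentSpace (𝓡 m) p) :
    nabla X p u = coordField p (mvfderiv (𝓡 m) (coords p X) p u) p + nabla (ext (X p)) p u := by
  have hp := mem_chart_source (EuclideanSpace ℝ (Fin m)) p
  have hc := mdifferentiableAt_coords hp hX
  have hca : ∀ a : Fin m, MDifferentiableAt (𝓡 m) 𝓘(ℝ) (fun y => coords p X y a) p := fun a =>
    (EuclideanSpace.proj (𝕜 := ℝ) a).mdifferentiableAt.comp p hc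
  have hE : ∀ v, FieldDiffAt (coordField p v) p := fun v => (fieldCkAt_coordField hp v).diffAt
  rw [nabla_congr (FieldDiffAt.sum _ fun a => FieldDiffAt.smul (hca a) (hE _))
    (eventuallyEq_sum_coords hp X), nabla_sum _ fun a => FieldDiffAt.smul (hca a) (hE _),
    LinearMap.sum_apply, nabla_congr (hE _) (ext_eq_coordField (X p)), nabla_coordField hp,
    coordField_eq_sum]
  rw [Finset.sum_apply (M := fun q : M => TangentSpace (𝓡 m) q), ← Finset.sum_add_distrib]
  refine Finset.sum_congr rfl fun a _ => ?_
  rw [nabla_smul (hca a) (hE _)]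
  congr 2
  exact mvfderiv_clm_comp (EuclideanSpace.proj (𝕜 := ℝ) a) hc u

end Coordinates

/-! ### The derivative of a determinant -/

section JacobiFormula

open Matrix

/-- Jacobi's formula, for matrices regarded as functions of two indices. -/
lemma hasFDerivAt_det {k : ℕ} (A : Fin k → Fin k → ℝ) :
    ∃ L : (Fin k → Fin k → ℝ) →L[ℝ] ℝ,
      HasFDerivAt (fun B : Fin k → Fin k → ℝ => (Matrix.of B).det) L A ∧
        ∀ B, L B = ((Matrix.of A).adjugate * Matrix.of B).trace := by
  let D : ContinuousMultilinearMap ℝ (fun _ : Fin k => Fin k → ℝ) ℝ :=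
    { (Matrix.detRowAlternating (R := ℝ) (n := Fin k)).toMultilinearMap with
      cont := (continuous_id (X := Matrix (Fin k) (Fin k) ℝ)).matrix_det }
  refine ⟨D.linearDeriv A, D.hasFDerivAt A, fun B => ?_⟩
  rw [ContinuousMultilinearMap.linearDeriv_apply, Matrix.trace_mul_comm, Matrix.trace]
  refine Finset.sum_congr rfl fun i _ => ?_
  change (Matrix.of A |>.updateRow i (B i)).det = _
  rw [← Matrix.cramer_transpose_apply, Matrix.cramer_eq_adjugate_mulVec, ← Matrix.adjugate_transpose,
    Matrix.diag_apply, Matrix.mul_apply]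
  exact Finset.sum_congr (s₁ := Finset.univ) rfl fun j _ => mul_comm (((Matrix.of A).adjugate) j i) (B i j)

/-- The derivative of the determinant of a field `G` of matrices whose derivative is
`C G + G Cᵀ`. -/
lemma mvfderiv_det {k : ℕ} {G : M → Matrix (Fin k) (Fin k) ℝ} {C : Matrix (Fin k) (Fin k) ℝ}
    (hG : ∀ i j, ContMDiffAt (𝓡 m) 𝓘(ℝ) 1 (fun q => G q i j) p) {v : TangentSpace (𝓡 m) p}
    (hC : ∀ i j, mvfderiv (𝓡 m) (fun q => G q i j) p v = (C * G p + G p * Cᵀ) i j) :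
    mvfderiv (𝓡 m) (fun q => (G q).det) p v = 2 * (G p).det * C.trace := by
  obtain ⟨L, hL, hLB⟩ := hasFDerivAt_det (fun i j => G p i j)
  have hG' : MDifferentiableAt (𝓡 m) 𝓘(ℝ, Fin k → Fin k → ℝ) (fun q i j => G q i j) p :=
    (contMDiffAt_pi_space.2 fun i => contMDiffAt_pi_space.2 fun j => hG i j).mdifferentiableAt
      one_ne_zero
  have h1 := mfderiv_comp_apply p hL.hasMFDerivAt.mdifferentiableAt hG' v
  rw [hL.hasMFDerivAt.mfderiv] at h1
  have h2 : mvfderiv (𝓡 m) (fun q i j => G q i j) p v = (C * G p + G p * Cᵀ) := by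
    ext i j
    rw [← hC]
    exact (mvfderiv_clm_comp ((ContinuousLinearMap.proj (R := ℝ) (φ := fun _ : Fin k => ℝ) j).comp
      (ContinuousLinearMap.proj (R := ℝ) (φ := fun _ : Fin k => Fin k → ℝ) i)) hG' v).symm
  have h3 : mvfderiv (𝓡 m) (fun q => (G q).det) p v =
    L (mvfderiv (𝓡 m) (fun q i j => G q i j) p v) := h1
  rw [h3, h2]
  refine (hLB _).trans ?_
  change ((G p).adjugate * (C * G p + G p * Cᵀ)).trace = _
  rw [Matrix.mul_add, Matrix.trace_add, Matrix.trace_mul_comm, Matrix.mul_assoc C,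
    ← Matrix.mul_assoc (G p).adjugate,    Matrix.mul_adjugate, Matrix.adjugate_mul]
  simp
  ring

end JacobiFormula

/-! ### The volume density and the divergence in coordinates -/

section VolumeDensity

variable {c q : M}

/-- The coordinate vector fields of the preferred chart at `c`. -/
abbrev coordFrame (c : M) (i : Fin m) : (q : M) → TangentSpace (𝓡 m) q :=
  coordField c (EuclideanSpace.basisFun (Fin m) ℝ i)

/-- The Gram matrix of the coordinate vector fields, as a function on the manifold. -/
def gramField (c : M) (q : M) : Matrix (Fin m) (Fin m) ℝ :=
  Matrix.gram ℝ fun i => coordFrame c i q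

/-- The density of the Riemannian volume with respect to Lebesgue measure in a chart. -/
def volDensity (c : M) (q : M) : ℝ := Real.sqrt (gramField (m := m) c q).det

lemma gramField_apply (c q : M) (i j : Fin m) :
    gramField (m := m) c q i j = inner ℝ (coordFrame c i q) (coordFrame c j q) := rfl

lemma det_gramField_pos (hq : q ∈ (chartAt (EuclideanSpace ℝ (Fin m)) c).source) :
    0 < (gramField (m := m) c q).det := by
  refine (Matrix.posDef_gram_of_linearIndependent ?_).det_pos
  refine LinearIndependent.of_comp (mvfderiv (𝓡 m) (extChartAt (𝓡 m) c) q).toLinearMap ?_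
  convert! (EuclideanSpace.basisFun (Fin m) ℝ).toBasis.linearIndependent using 1
  funext i
  exact (mvfderiv_extChartAt_coordField hq _).trans (by simp)

lemma volDensity_pos (hq : q ∈ (chartAt (EuclideanSpace ℝ (Fin m)) c).source) :
    0 < volDensity (m := m) c q := Real.sqrt_pos.2 (det_gramField_pos hq)

lemma contMDiffAt_gramField (hq : q ∈ (chartAt (EuclideanSpace ℝ (Fin m)) c).source)
    (i j : Fin m) : ContMDiffAt (𝓡 m) 𝓘(ℝ) ∞ (fun y => gramField (m := m) c y i j) q :=
  contMDiffAt_inner le_rfl (fieldCkAt_coordField hq _) (fieldCkAt_coordField hq _)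

/-- The determinant is a polynomial in the entries. -/
lemma contMDiffAt_det_gramField (hq : q ∈ (chartAt (EuclideanSpace ℝ (Fin m)) c).source) :
    ContMDiffAt (𝓡 m) 𝓘(ℝ) ∞ (fun y => (gramField (m := m) c y).det) q := by
  simp only [Matrix.det_apply']
  exact contMDiffAt_finsetSum fun σ _ => contMDiffAt_const.mul
    (contMDiffAt_finsetProd fun i _ => contMDiffAt_gramField hq _ _)

lemma contMDiffAt_volDensity (hq : q ∈ (chartAt (EuclideanSpace ℝ (Fin m)) c).source) :
    ContMDiffAt (𝓡 m) 𝓘(ℝ) ∞ (volDensity (m := m) c) q :=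
  (Real.contDiffAt_sqrt (det_gramField_pos hq).ne').contMDiffAt.comp q
    (contMDiffAt_det_gramField hq)

/-- The divergence as the trace of the matrix of `∇V` in a coordinate frame. -/
lemma div_eq_sum_coords (hq : q ∈ (chartAt (EuclideanSpace ℝ (Fin m)) c).source)
    (V : (q : M) → TangentSpace (𝓡 m) q) :
    div V q = ∑ i, mvfderiv (𝓡 m) (extChartAt (𝓡 m) c) q (nabla V q (coordFrame c i q)) i := by
  let b := (EuclideanSpace.basisFun (Fin m) ℝ)
  let e : TangentSpace (𝓡 m) q ≃ₗ[ℝ] EuclideanSpace ℝ (Fin m) :=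
    LinearEquiv.ofLinearMap (mvfderiv (𝓡 m) (extChartAt (𝓡 m) c) q).toLinearMap
      ((trivializationAt (EuclideanSpace ℝ (Fin m)) (fun q : M => TangentSpace (𝓡 m) q) c).symmL
        ℝ q).toLinearMap
      (LinearMap.ext fun v => mvfderiv_extChartAt_coordField hq v)
      (LinearMap.ext fun v => coordField_mvfderiv_extChartAt hq v)
  rw [div, ← LinearMap.trace_conj' _ e, LinearMap.trace_eq_sum_inner _ b]
  refine Finset.sum_congr rfl fun i _ => ?_
  rw [EuclideanSpace.basisFun_inner]
  rfl

/-- The expansion of a tangent vector in the coordinate frame. -/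
lemma eq_sum_coordFrame (hq : q ∈ (chartAt (EuclideanSpace ℝ (Fin m)) c).source)
    (w : TangentSpace (𝓡 m) q) :
    w = ∑ l, mvfderiv (𝓡 m) (extChartAt (𝓡 m) c) q w l • coordFrame c l q := by
  conv_lhs => rw [← coordField_mvfderiv_extChartAt hq w, coordField_eq_sum]
  exact Finset.sum_apply (M := fun q : M => TangentSpace (𝓡 m) q) q Finset.univ fun a =>
      mvfderiv (𝓡 m) (extChartAt (𝓡 m) c) q w a • coordFrame c a

/-- The logarithmic derivative of the density along a coordinate field is the divergence of that
field. -/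
lemma mvfderiv_volDensity (hq : q ∈ (chartAt (EuclideanSpace ℝ (Fin m)) c).source)
    (i : Fin m) :
    mvfderiv (𝓡 m) (volDensity (m := m) c) q (coordFrame c i q) =
      volDensity (m := m) c q * div (coordFrame c i) q := by
  have hE : ∀ j, FieldDiffAt (coordFrame c j) q := fun j => (fieldCkAt_coordField hq _).diffAt
  -- the matrix of `∇ E_i`, which is also that of `∇_{E_i}` since the coordinate fields commute
  let C : Matrix (Fin m) (Fin m) ℝ := Matrix.of fun j l =>
    mvfderiv (𝓡 m) (extChartAt (𝓡 m) c) q (nabla (coordFrame c j) q (coordFrame c i q)) l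
  have hexp : ∀ j, nabla (coordFrame c j) q (coordFrame c i q) = ∑ l, C j l • coordFrame c l q :=
    fun j => eq_sum_coordFrame hq _
  have hC : C.trace = div (coordFrame c i) q := by
    rw [div_eq_sum_coords hq, Matrix.trace]
    refine Finset.sum_congr rfl fun j _ => ?_
    have h := nabla_sub_nabla (hE i) (hE j)
    rw [mlieBracket_coordField hq, sub_eq_zero] at h
    rw [← h]
    rfl
  have hdet := mvfderiv_det (C := C) (v := coordFrame c i q)
    (fun j k => (contMDiffAt_gramField hq j k).of_le (by simp)) fun j k => by
      have h := mvfderiv_inner (hE j) (hE k) (coordFrame c i q)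
      refine h.trans ?_
      rw [hexp, hexp, sum_inner, inner_sum, Matrix.add_apply, Matrix.mul_apply, Matrix.mul_apply]
      congr 1
      · exact Finset.sum_congr rfl fun l _ => real_inner_smul_left _ _ _
      · exact Finset.sum_congr rfl fun l _ => (real_inner_smul_right _ _ _).trans (mul_comm _ _)
  have hσ := (contMDiffAt_volDensity hq).mdifferentiableAt (by simp)
  have hsq : (fun y => (gramField (m := m) c y).det) =ᶠ[𝓝 q] (volDensity (m := m) c * volDensity (m := m) c) := by
    filter_upwards [(chartAt (EuclideanSpace ℝ (Fin m)) c).open_source.mem_nhds hq] with y hy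
    exact (Real.mul_self_sqrt (det_gramField_pos hy).le).symm
  have hd : (gramField (m := m) c q).det = volDensity (m := m) c q * volDensity (m := m) c q := hsq.eq_of_nhds
  rw [mvfderiv_congr hsq, mvfderiv_mul hσ hσ, hd, hC] at hdet
  have h0 := (volDensity_pos hq).ne'
  have h2 : volDensity (m := m) c q * mvfderiv (𝓡 m) (volDensity (m := m) c) q (coordFrame c i q) +
    volDensity (m := m) c q * mvfderiv (𝓡 m) (volDensity (m := m) c) q (coordFrame c i q) =
    2 * (volDensity (m := m) c q * volDensity (m := m) c q) * div (coordFrame c i) q := hdet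
  apply mul_left_cancel₀ h0
  linarith

/-- The divergence in coordinates: `σ div V = ∑ ∂_i (σ V^i)` with `σ` the volume density. -/
lemma volDensity_mul_div (hq : q ∈ (chartAt (EuclideanSpace ℝ (Fin m)) c).source)
    (hV : FieldDiffAt X q) :
    volDensity (m := m) c q * div X q =
      ∑ i, mvfderiv (𝓡 m) (fun y => volDensity (m := m) c y * coords c X y i) q (coordFrame c i q) := by
  have hE : ∀ j, FieldDiffAt (coordFrame c j) q := fun j => (fieldCkAt_coordField hq _).diffAt
  have hca : ∀ a : Fin m, MDifferentiableAt (𝓡 m) 𝓘(ℝ) (fun y => coords c X y a) q := fun a =>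
    (EuclideanSpace.proj (𝕜 := ℝ) a).mdifferentiableAt.comp q (mdifferentiableAt_coords hq hV)
  have hσ := (contMDiffAt_volDensity hq).mdifferentiableAt (by simp)
  rw [div_congr (FieldDiffAt.sum _ fun a => FieldDiffAt.smul (hca a) (hE _))
    (eventuallyEq_sum_coords hq X), div_sum _ fun a => FieldDiffAt.smul (hca a) (hE _),
    Finset.mul_sum]
  refine Finset.sum_congr rfl fun i _ => ?_
  have h := congrArg (fun L => L (coordFrame c i q)) (mvfderiv_mul hσ (hca i))
  refine Eq.trans ?_ h.symm
  rw [div_smul (hca i) (hE i)]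
  change _ = volDensity (m := m) c q * mvfderiv (𝓡 m) (fun y => coords c X y i) q (coordFrame c i q) +
    coords c X q i * mvfderiv (𝓡 m) (volDensity (m := m) c) q (coordFrame c i q)
  rw [mvfderiv_volDensity hq]
  ring

end VolumeDensity

/-! ### The Riemannian volume measure in charts -/

section ChangeOfChart

variable {c c' q : M} {y : EuclideanSpace ℝ (Fin m)}

lemma mfderiv_extChartAt_symm (hy : y ∈ (extChartAt (𝓡 m) c).target)
    (v : EuclideanSpace ℝ (Fin m)) :
    mfderiv (𝓡 m) (𝓡 m) (extChartAt (𝓡 m) c).symm y v =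
      coordField c v ((extChartAt (𝓡 m) c).symm y) := by
  have hs : (extChartAt (𝓡 m) c).symm y ∈ (chartAt (EuclideanSpace ℝ (Fin m)) c).source := by
    simpa using (extChartAt (𝓡 m) c).map_target hy
  have h := TangentBundle.symmL_trivializationAt (I := 𝓡 m) hs
  rw [(extChartAt (𝓡 m) c).right_inv hy] at h
  have h2 := congrArg (fun T => T v) h
  simp only [ModelWithCorners.range_eq_univ, mfderivWithin_univ] at h2
  exact h2.symm

lemma gram_eq_gramField (hy : y ∈ (extChartAt (𝓡 m) c).target) :
    gram c y = gramField (m := m) c ((extChartAt (𝓡 m) c).symm y) := by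
  ext i j
  rw [gram, Matrix.of_apply, mfderiv_extChartAt_symm hy, mfderiv_extChartAt_symm hy,
    gramField_apply, coordFrame, coordFrame, EuclideanSpace.basisFun_apply,
    EuclideanSpace.basisFun_apply]

/-- The derivative of the change of charts from `c` to `c'`, as a function of the point of the
manifold. -/
def transitionDeriv (c c' q : M) : EuclideanSpace ℝ (Fin m) →L[ℝ] EuclideanSpace ℝ (Fin m) :=
  (mvfderiv (𝓡 m) (extChartAt (𝓡 m) c') q).comp
    ((trivializationAt (EuclideanSpace ℝ (Fin m)) (fun q : M => TangentSpace (𝓡 m) q) c).symmL ℝ q)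

lemma hasFDerivAt_transition (hy : y ∈ (extChartAt (𝓡 m) c).target)
    (hy' : (extChartAt (𝓡 m) c).symm y ∈ (chartAt (EuclideanSpace ℝ (Fin m)) c').source) :
    HasFDerivAt (fun y => extChartAt (𝓡 m) c' ((extChartAt (𝓡 m) c).symm y))
      (transitionDeriv c c' ((extChartAt (𝓡 m) c).symm y)) y := by
  have h1 : MDifferentiableAt (𝓡 m) (𝓡 m) (extChartAt (𝓡 m) c).symm y := by
    have h := mdifferentiableWithinAt_extChartAt_symm (I := 𝓡 m) hy
    rwa [ModelWithCorners.range_eq_univ, mdifferentiableWithinAt_univ] at h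
  have h2 := (contMDiffAt_extChartAt_apply hy').mdifferentiableAt (by simp)
  have h3 := (h2.hasMFDerivAt.comp y h1.hasMFDerivAt).hasFDerivAt
  refine h3.congr_fderiv ?_
  ext1 v
  exact congrArg (mvfderiv (𝓡 m) (extChartAt (𝓡 m) c') _) (mfderiv_extChartAt_symm hy v)

/-- The transformation law of the volume density. -/
lemma volDensity_eq_abs_det_mul (hq : q ∈ (chartAt (EuclideanSpace ℝ (Fin m)) c').source) :
    volDensity (m := m) c q = |(transitionDeriv (m := m) c c' q).det| * volDensity (m := m) c' q := by
  let b := EuclideanSpace.basisFun (Fin m) ℝ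
  let J : Matrix (Fin m) (Fin m) ℝ := Matrix.of fun i l => transitionDeriv (m := m) c c' q (b i) l
  have hJ : gramField (m := m) c q = J * gramField (m := m) c' q * J.transpose := by
    ext i j
    rw [gramField_apply, eq_sum_coordFrame hq (coordFrame c i q),
      eq_sum_coordFrame hq (coordFrame c j q), inner_sum, Matrix.mul_apply]
    refine Finset.sum_congr rfl fun k _ => ?_
    rw [real_inner_smul_right, sum_inner, Matrix.mul_apply, mul_comm]
    exact congrArg (· * _) (Finset.sum_congr rfl fun l _ => real_inner_smul_left _ _ _)
  have hdet : (transitionDeriv (m := m) c c' q).det = J.det := by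
    rw [ContinuousLinearMap.det, ← LinearMap.det_toMatrix b.toBasis, ← Matrix.det_transpose]
    congr 1
    ext i j
    rw [Matrix.transpose_apply, LinearMap.toMatrix_apply]
    simp [J, b]
  rw [volDensity, volDensity, hJ, hdet, Matrix.det_mul, Matrix.det_mul, Matrix.det_transpose,
    show J.det * (gramField (m := m) c' q).det * J.det =
      J.det ^ 2 * (gramField (m := m) c' q).det by ring, Real.sqrt_mul (sq_nonneg _),
    Real.sqrt_sq_eq_abs]

variable [MeasurableSpace M] [BorelSpace M]

lemma aemeasurable_extChartAt_symm (c : M) :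
    AEMeasurable (extChartAt (𝓡 m) c).symm (volume.restrict (extChartAt (𝓡 m) c).target) :=
  (continuousOn_extChartAt_symm c).aemeasurable (isOpen_extChartAt_target c).measurableSet

lemma measurableSet_target_inter_preimage (c : M) {A : Set M} (hA : MeasurableSet A) :
    MeasurableSet ((extChartAt (𝓡 m) c).target ∩ (extChartAt (𝓡 m) c).symm ⁻¹' A) := by
  have h := (continuousOn_iff_continuous_domRestrict.1
    (continuousOn_extChartAt_symm (I := 𝓡 m) c)).measurable hA
  have h2 := (MeasurableEmbedding.subtype_coe
    (isOpen_extChartAt_target (I := 𝓡 m) c).measurableSet).measurableSet_image.2 h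
  convert! h2 using 1
  ext y
  simp [and_comm]

/-- The integrand in the definition of the volume of a chart, in terms of the volume density. -/
lemma chartVolume_eq (c : M) : chartVolume (m := m) c =
    Measure.map (extChartAt (𝓡 m) c).symm
      ((volume.restrict (extChartAt (𝓡 m) c).target).withDensity
        fun y => ENNReal.ofReal (volDensity (m := m) c ((extChartAt (𝓡 m) c).symm y))) := by
  rw [chartVolume]
  congr 1
  refine withDensity_congr_ae ?_
  filter_upwards [ae_restrict_mem (isOpen_extChartAt_target c).measurableSet] with y hy
  rw [gram_eq_gramField hy, volDensity]

lemma chartVolume_apply (c : M) {A : Set M} (hA : MeasurableSet A) :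
    chartVolume (m := m) c A =
      ∫⁻ y in (extChartAt (𝓡 m) c).target ∩ (extChartAt (𝓡 m) c).symm ⁻¹' A,
        ENNReal.ofReal (volDensity (m := m) c ((extChartAt (𝓡 m) c).symm y)) := by
  have hm := aemeasurable_extChartAt_symm (m := m) c
  rw [chartVolume_eq, Measure.map_apply_of_aemeasurable
    (hm.mono_ac (withDensity_absolutelyContinuous _ _)) hA, withDensity_apply' ,
    Measure.restrict_restrict₀, Set.inter_comm]
  exact hm.nullMeasurableSet_preimage hA

/-- The volumes of two charts agree where both are defined, by the change of variables formula. -/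
lemma chartVolume_eq_of_subset {A : Set M} (hA : MeasurableSet A)
    (h : A ⊆ (extChartAt (𝓡 m) c).source) (h' : A ⊆ (extChartAt (𝓡 m) c').source) :
    chartVolume (m := m) c A = chartVolume (m := m) c' A := by
  have himage : (fun y => extChartAt (𝓡 m) c' ((extChartAt (𝓡 m) c).symm y)) ''
      ((extChartAt (𝓡 m) c).target ∩ (extChartAt (𝓡 m) c).symm ⁻¹' A) =
      (extChartAt (𝓡 m) c').target ∩ (extChartAt (𝓡 m) c').symm ⁻¹' A := by
    ext z
    constructor
    · rintro ⟨y, ⟨hy, hyA⟩, rfl⟩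
      exact ⟨(extChartAt (𝓡 m) c').map_source (h' hyA), by
        rw [Set.mem_preimage, (extChartAt (𝓡 m) c').left_inv (h' hyA)]
        exact hyA⟩
    · rintro ⟨hz, hzA⟩
      refine ⟨extChartAt (𝓡 m) c ((extChartAt (𝓡 m) c').symm z),
        ⟨(extChartAt (𝓡 m) c).map_source (h hzA), ?_⟩, ?_⟩
      · rw [Set.mem_preimage, (extChartAt (𝓡 m) c).left_inv (h hzA)]
        exact hzA
      · beta_reduce
        rw [(extChartAt (𝓡 m) c).left_inv (h hzA), (extChartAt (𝓡 m) c').right_inv hz]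
  have hinj : Set.InjOn (fun y => extChartAt (𝓡 m) c' ((extChartAt (𝓡 m) c).symm y))
      ((extChartAt (𝓡 m) c).target ∩ (extChartAt (𝓡 m) c).symm ⁻¹' A) := by
    intro y hy z hz hyz
    exact (extChartAt (𝓡 m) c).symm.injOn hy.1 hz.1
      ((extChartAt (𝓡 m) c').injOn (h' hy.2) (h' hz.2) hyz)
  have hm := measurableSet_target_inter_preimage (m := m) c hA
  have hsrc : ∀ y ∈ (extChartAt (𝓡 m) c).target ∩ (extChartAt (𝓡 m) c).symm ⁻¹' A,
      (extChartAt (𝓡 m) c).symm y ∈ (chartAt (EuclideanSpace ℝ (Fin m)) c').source := by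
    intro y hy
    simpa using h' hy.2
  rw [chartVolume_apply c hA, chartVolume_apply c' hA, ← himage,
    lintegral_image_eq_lintegral_abs_det_fderiv_mul volume hm
      (fun y hy => (hasFDerivAt_transition hy.1 (hsrc y hy)).hasFDerivWithinAt) hinj]
  refine setLIntegral_congr_fun hm fun y hy => ?_
  rw [volDensity_eq_abs_det_mul (hsrc y hy), ENNReal.ofReal_mul (abs_nonneg _)]
  rw [(extChartAt (𝓡 m) c').left_inv (h' hy.2)]

variable [SecondCountableTopology M] [Nonempty M]

/-- On the domain of any chart, the Riemannian volume is the one of the chart. -/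
lemma riemVolume_apply_of_subset {A : Set M} (hA : MeasurableSet A)
    (h : A ⊆ (extChartAt (𝓡 m) c).source) :
    riemVolume (m := m) A = chartVolume (m := m) c A := by
  set d := (exists_seq_chart_cover m M).choose
  have hd : ⋃ i, (extChartAt (𝓡 m) (d i)).source = Set.univ :=
    (exists_seq_chart_cover m M).choose_spec
  let D := disjointed fun j => (extChartAt (𝓡 m) (d j)).source
  have hDm : ∀ i, MeasurableSet (D i) :=
    MeasurableSet.disjointed fun i => (isOpen_extChartAt_source (d i)).measurableSet
  have hDd : Pairwise (Function.onFun Disjoint D) := disjoint_disjointed _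
  have hDu : ⋃ i, D i = Set.univ := (iUnion_disjointed).trans hd
  have hAu : A = ⋃ i, A ∩ D i := by rw [← Set.inter_iUnion, hDu, Set.inter_univ]
  rw [riemVolume, Measure.sum_apply _ hA]
  conv_rhs => rw [hAu]
  rw [measure_iUnion (fun i j hij => (hDd hij).mono Set.inter_subset_right Set.inter_subset_right)
    fun i => hA.inter (hDm i)]
  refine tsum_congr fun i => ?_
  rw [Measure.restrict_apply hA]
  exact chartVolume_eq_of_subset (hA.inter (hDm i))
    (Set.inter_subset_right.trans (disjointed_subset _ i)) (Set.inter_subset_left.trans h)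

lemma riemVolume_restrict_source (c : M) :
    (riemVolume (m := m) (M := M)).restrict (extChartAt (𝓡 m) c).source =
      (chartVolume (m := m) c).restrict (extChartAt (𝓡 m) c).source := by
  have hU := (isOpen_extChartAt_source (I := 𝓡 m) c).measurableSet
  ext A hA
  rw [Measure.restrict_apply hA, Measure.restrict_apply hA,
    riemVolume_apply_of_subset (hA.inter hU) Set.inter_subset_right]

/-- The volume density is bounded near every point, hence the volume is locally finite. -/
instance : IsLocallyFiniteMeasure (riemVolume (m := m) (M := M)) := by
  refine ⟨fun p => ?_⟩
  have hp := mem_chart_source (EuclideanSpace ℝ (Fin m)) p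
  have h1 : ∀ᶠ q in 𝓝 p, volDensity (m := m) p q < volDensity (m := m) p p + 1 :=
    (contMDiffAt_volDensity hp).continuousAt.eventually_lt_const (by linarith)
  have h2 : ∀ᶠ q in 𝓝 p, extChartAt (𝓡 m) p q ∈ Metric.ball (extChartAt (𝓡 m) p p) 1 :=
    (continuousAt_extChartAt p).eventually (Metric.ball_mem_nhds _ one_pos)
  obtain ⟨O, hO, hOo, hpO⟩ := eventually_nhds_iff.1
    ((h1.and h2).and (extChartAt_source_mem_nhds (I := 𝓡 m) p))
  refine ⟨O, hOo.mem_nhds hpO, ?_⟩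
  rw [riemVolume_apply_of_subset hOo.measurableSet fun q hq => (hO q hq).2,
    chartVolume_apply p hOo.measurableSet]
  calc _ ≤ ∫⁻ _ in (extChartAt (𝓡 m) p).target ∩ (extChartAt (𝓡 m) p).symm ⁻¹' O,
        ENNReal.ofReal (volDensity (m := m) p p + 1) :=
        setLIntegral_mono measurable_const fun y hy =>
          ENNReal.ofReal_le_ofReal (hO _ hy.2).1.1.le
    _ ≤ ∫⁻ _ in Metric.ball (extChartAt (𝓡 m) p p) 1,
        ENNReal.ofReal (volDensity (m := m) p p + 1) := by
        refine lintegral_mono_set fun y hy => ?_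
        have := (hO _ hy.2).1.2
        rwa [(extChartAt (𝓡 m) p).right_inv hy.1] at this
    _ < ⊤ := by
        rw [setLIntegral_const]
        exact ENNReal.mul_lt_top ENNReal.ofReal_lt_top measure_ball_lt_top

end ChangeOfChart

/-! ### The divergence theorem -/

section DivergenceTheorem

variable {c : M} {V : (q : M) → TangentSpace (𝓡 m) q}

lemma contMDiffAt_extChartAt_symm {y : EuclideanSpace ℝ (Fin m)}
    (hy : y ∈ (extChartAt (𝓡 m) c).target) :
    ContMDiffAt (𝓡 m) (𝓡 m) ∞ (extChartAt (𝓡 m) c).symm y :=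
  (contMDiffOn_extChartAt_symm c).contMDiffAt ((isOpen_extChartAt_target c).mem_nhds hy)

lemma div_eq_zero_of_notMem {K : Set M} (hK : IsClosed K) (h0 : ∀ q, q ∉ K → V q = 0)
    (hp : p ∉ K) : div V p = 0 := by
  have h : V =ᶠ[𝓝 p] (0 : (q : M) → TangentSpace (𝓡 m) q) := by
    filter_upwards [hK.isOpen_compl.mem_nhds hp] with q hq
    exact h0 q hq
  rw [div_congr (mdifferentiable_zeroSection ℝ (fun q : M => TangentSpace (𝓡 m) q) p) h]
  exact div_zero

/-- A component of a vector field times the volume density, read in the chart at `c` and extended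
by zero. -/
def densityComponent (c : M) (V : (q : M) → TangentSpace (𝓡 m) q) (i : Fin m) :
    EuclideanSpace ℝ (Fin m) → ℝ :=
  Set.indicator (extChartAt (𝓡 m) c).target fun y =>
    volDensity (m := m) c ((extChartAt (𝓡 m) c).symm y) *
      coords c V ((extChartAt (𝓡 m) c).symm y) i

lemma densityComponent_eventuallyEq {y : EuclideanSpace ℝ (Fin m)}
    (hy : y ∈ (extChartAt (𝓡 m) c).target) (i : Fin m) :
    densityComponent c V i =ᶠ[𝓝 y]
      (fun q => volDensity (m := m) c q * coords c V q i) ∘ (extChartAt (𝓡 m) c).symm := by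
  filter_upwards [(isOpen_extChartAt_target c).mem_nhds hy] with z hz
  exact Set.indicator_of_mem hz _

lemma contMDiffAt_volDensity_mul_coords {q : M}
    (hq : q ∈ (chartAt (EuclideanSpace ℝ (Fin m)) c).source) (hV : FieldCkAt 1 V q) (i : Fin m) :
    ContMDiffAt (𝓡 m) 𝓘(ℝ) 1 (fun q => volDensity (m := m) c q * coords c V q i) q :=
  ContMDiffAt.mul ((contMDiffAt_volDensity hq).of_le (by simp))
    ((EuclideanSpace.proj (𝕜 := ℝ) i).contMDiff.contMDiffAt.comp q
      (contMDiffAt_coords (k := 1) hq hV))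

lemma contDiffAt_densityComponent {y : EuclideanSpace ℝ (Fin m)}
    (hy : y ∈ (extChartAt (𝓡 m) c).target) (hV : ∀ q, FieldCkAt 1 V q) (i : Fin m) :
    ContDiffAt ℝ 1 (densityComponent c V i) y := by
  have hs : (extChartAt (𝓡 m) c).symm y ∈ (chartAt (EuclideanSpace ℝ (Fin m)) c).source := by
    simpa using (extChartAt (𝓡 m) c).map_target hy
  refine ContDiffAt.congr_of_eventuallyEq ?_ (densityComponent_eventuallyEq hy i)
  exact ((contMDiffAt_volDensity_mul_coords hs (hV _) i).comp y
    ((contMDiffAt_extChartAt_symm hy).of_le (by simp))).contDiffAt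

lemma fderiv_densityComponent {y : EuclideanSpace ℝ (Fin m)}
    (hy : y ∈ (extChartAt (𝓡 m) c).target) (hV : ∀ q, FieldCkAt 1 V q) (i : Fin m)
    (v : EuclideanSpace ℝ (Fin m)) :
    fderiv ℝ (densityComponent c V i) y v =
      mvfderiv (𝓡 m) (fun q => volDensity (m := m) c q * coords c V q i)
        ((extChartAt (𝓡 m) c).symm y) (coordField c v ((extChartAt (𝓡 m) c).symm y)) := by
  have hs : (extChartAt (𝓡 m) c).symm y ∈ (chartAt (EuclideanSpace ℝ (Fin m)) c).source := by
    simpa using (extChartAt (𝓡 m) c).map_target hy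
  have h1 := (contMDiffAt_volDensity_mul_coords hs (hV _) i).mdifferentiableAt one_ne_zero
  have h2 := (contMDiffAt_extChartAt_symm hy).mdifferentiableAt (by simp)
  rw [(densityComponent_eventuallyEq hy i).fderiv_eq, ← mfderiv_eq_fderiv,
    ← mfderiv_extChartAt_symm hy]
  exact mfderiv_comp_apply y h1 h2 v

/-- For a field supported in a compact subset `K` of the chart, the extension by zero is supported
in the compact image of `K`, so that it is of class `C^1` also at the boundary of the chart. -/
lemma densityComponent_eq_zero {K : Set M} (h0 : ∀ q, q ∉ K → V q = 0) (i : Fin m)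
    {y : EuclideanSpace ℝ (Fin m)} (hy : y ∉ extChartAt (𝓡 m) c '' K) :
    densityComponent c V i y = 0 := by
  refine Set.indicator_apply_eq_zero.2 fun hyt => ?_
  have h : (extChartAt (𝓡 m) c).symm y ∉ K := fun h =>
    hy ⟨_, h, (extChartAt (𝓡 m) c).right_inv hyt⟩
  have h2 : coords c V ((extChartAt (𝓡 m) c).symm y) = 0 := by
    rw [coords, h0 _ h, map_zero]
  rw [h2]
  simp

lemma hasCompactSupport_div [T2Space M] {K : Set M} (hK : IsCompact K)
    (h0 : ∀ q, q ∉ K → V q = 0) : HasCompactSupport (div V) :=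
  HasCompactSupport.intro hK fun _ hp => div_eq_zero_of_notMem hK.isClosed h0 hp

lemma continuous_div (hV : ∀ q, FieldCkAt 1 V q) : Continuous (div V) :=
  continuous_iff_continuousAt.2 fun q =>
    (contMDiffAt_div (k := 0) (l := 1) (by simp) (hV q)).continuousAt

variable [MeasurableSpace M] [BorelSpace M]

/-- Integration against the volume of a chart, in coordinates. -/
lemma integral_chartVolume (c : M) {g : M → ℝ} (hg : Continuous g) :
    ∫ q, g q ∂(chartVolume (m := m) c) = ∫ y in (extChartAt (𝓡 m) c).target,
      volDensity (m := m) c ((extChartAt (𝓡 m) c).symm y) * g ((extChartAt (𝓡 m) c).symm y) := by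
  have hm := aemeasurable_extChartAt_symm (m := m) c
  have hσ : ContinuousOn (fun y => volDensity (m := m) c ((extChartAt (𝓡 m) c).symm y))
      (extChartAt (𝓡 m) c).target := fun y hy => by
    have hs : (extChartAt (𝓡 m) c).symm y ∈ (chartAt (EuclideanSpace ℝ (Fin m)) c).source := by
      simpa using (extChartAt (𝓡 m) c).map_target hy
    exact (ContinuousAt.comp (contMDiffAt_volDensity hs).continuousAt
      (contMDiffAt_extChartAt_symm hy).continuousAt).continuousWithinAt
  rw [chartVolume_eq, integral_map (hm.mono_ac (withDensity_absolutelyContinuous _ _))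
      hg.aestronglyMeasurable, integral_withDensity_eq_integral_toReal_smul₀
      (hσ.aemeasurable (isOpen_extChartAt_target c).measurableSet).ennreal_ofReal
      (ae_of_all _ fun _ => ENNReal.ofReal_lt_top)]
  refine integral_congr_ae (ae_of_all _ fun y => ?_)
  exact congrArg (· * _) (ENNReal.toReal_ofReal (Real.sqrt_nonneg _))

/-- Integration by parts against the constant function `1`. -/
lemma integral_fderiv_eq_zero {E : Type*} [NormedAddCommGroup E] [NormedSpace ℝ E]
    [FiniteDimensional ℝ E] [MeasurableSpace E] [BorelSpace E] (μ : Measure E)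
    [μ.IsAddHaarMeasure] {h : E → ℝ} (hh : ContDiff ℝ 1 h) (hc : HasCompactSupport h) (v : E) :
    ∫ y, fderiv ℝ h y v ∂μ = 0 := by
  have hi : Integrable h μ := hh.continuous.integrable_of_hasCompactSupport hc
  have hi' : Integrable (fun y => fderiv ℝ h y v) μ :=
    ((hh.continuous_fderiv one_ne_zero).clm_apply
      continuous_const).integrable_of_hasCompactSupport (hc.fderiv_apply ℝ v)
  have := integral_mul_fderiv_eq_neg_fderiv_mul_of_integrable (μ := μ) (f := fun _ : E => (1 : ℝ))
    (g := h) (v := v) (by simp) (by simpa using hi') (by simpa using hi)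
    (fun _ _ => differentiableAt_const _) fun y _ => hh.differentiable one_ne_zero y
  simpa using this

variable [T2Space M] [SecondCountableTopology M] [Nonempty M]

/-- The divergence theorem for fields supported in one chart. In coordinates `σ div V` is the
Euclidean divergence of the compactly supported field `σ V`. -/
lemma integral_div_eq_zero_of_subset_source (hV : ∀ q, FieldCkAt 1 V q) {K : Set M}
    (hK : IsCompact K) (hKc : K ⊆ (extChartAt (𝓡 m) c).source) (h0 : ∀ q, q ∉ K → V q = 0) :
    ∫ q, div V q ∂(riemVolume (m := m)) = 0 := by
  have hU := (isOpen_extChartAt_source (I := 𝓡 m) c).measurableSet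
  have hd : ∀ q, q ∉ (extChartAt (𝓡 m) c).source → div V q = 0 := fun q hq =>
    div_eq_zero_of_notMem hK.isClosed h0 fun h => hq (hKc h)
  have hK' : IsCompact (extChartAt (𝓡 m) c '' K) :=
    hK.image_of_continuousOn ((continuousOn_extChartAt c).mono hKc)
  have hC : ∀ i, ContDiff ℝ 1 (densityComponent c V i) := fun i =>
    contDiff_iff_contDiffAt.2 fun y => by
      by_cases hy : y ∈ extChartAt (𝓡 m) c '' K
      · obtain ⟨q, hq, rfl⟩ := hy
        exact contDiffAt_densityComponent ((extChartAt (𝓡 m) c).map_source (hKc hq)) hV i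
      · refine (contDiffAt_const (c := (0 : ℝ))).congr_of_eventuallyEq ?_
        filter_upwards [hK'.isClosed.isOpen_compl.mem_nhds hy] with z hz
        exact densityComponent_eq_zero h0 i hz
  have hcs : ∀ i, HasCompactSupport (densityComponent c V i) := fun i =>
    HasCompactSupport.intro hK' fun y hy => densityComponent_eq_zero h0 i hy
  have hz : ∀ i y, y ∉ (extChartAt (𝓡 m) c).target → ∀ v,
      fderiv ℝ (densityComponent c V i) y v = 0 := fun i y hy v => by
    have h : densityComponent c V i =ᶠ[𝓝 y] fun _ => 0 := by
      filter_upwards [hK'.isClosed.isOpen_compl.mem_nhds (x := y) fun ⟨q, hq, h⟩ =>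
        hy (h ▸ (extChartAt (𝓡 m) c).map_source (hKc hq))] with z hz
      exact densityComponent_eq_zero h0 i hz
    rw [h.fderiv_eq]
    simp
  calc ∫ q, div V q ∂(riemVolume (m := m))
      = ∫ q in (extChartAt (𝓡 m) c).source, div V q ∂(riemVolume (m := m)) :=
        (setIntegral_eq_integral_of_forall_compl_eq_zero hd).symm
    _ = ∫ q in (extChartAt (𝓡 m) c).source, div V q ∂(chartVolume (m := m) c) := by
        rw [riemVolume_restrict_source]
    _ = ∫ q, div V q ∂(chartVolume (m := m) c) :=
        setIntegral_eq_integral_of_forall_compl_eq_zero hd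
    _ = ∫ y in (extChartAt (𝓡 m) c).target, ∑ i, fderiv ℝ (densityComponent c V i) y
          (EuclideanSpace.basisFun (Fin m) ℝ i) := by
        rw [integral_chartVolume c (continuous_div hV)]
        refine setIntegral_congr_fun (isOpen_extChartAt_target c).measurableSet fun y hy => ?_
        have hs : (extChartAt (𝓡 m) c).symm y ∈
            (chartAt (EuclideanSpace ℝ (Fin m)) c).source := by
          simpa using (extChartAt (𝓡 m) c).map_target hy
        beta_reduce
        rw [volDensity_mul_div hs (FieldCkAt.diffAt (k := ((1 : ℕ∞) : ℕ∞ω)) (hV _))]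
        exact Finset.sum_congr rfl fun i _ => (fderiv_densityComponent hy hV i _).symm
    _ = ∫ y, ∑ i, fderiv ℝ (densityComponent c V i) y (EuclideanSpace.basisFun (Fin m) ℝ i) :=
        setIntegral_eq_integral_of_forall_compl_eq_zero fun y hy =>
          Finset.sum_eq_zero fun i _ => hz i y hy _
    _ = 0 := by
        rw [integral_finsetSum]
        · exact Finset.sum_eq_zero fun i _ => integral_fderiv_eq_zero volume (hC i) (hcs i) _
        · intro i _
          exact (((hC i).continuous_fderiv one_ne_zero).clm_apply
            continuous_const).integrable_of_hasCompactSupport ((hcs i).fderiv_apply ℝ _)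

/-- The divergence theorem for compactly supported vector fields of class `C^1`: a partition of
unity reduces it to fields supported in one chart. -/
theorem integral_div_eq_zero (hV : ∀ q, FieldCkAt 1 V q) {K : Set M} (hK : IsCompact K)
    (h0 : ∀ q, q ∉ K → V q = 0) : ∫ q, div V q ∂(riemVolume (m := m)) = 0 := by
  have : LocallyCompactSpace M :=
    ChartedSpace.locallyCompactSpace (EuclideanSpace ℝ (Fin m)) M
  obtain ⟨χ, hχ⟩ := SmoothPartitionOfUnity.exists_isSubordinate (𝓡 m) hK.isClosed
    (fun c : M => (extChartAt (𝓡 m) c).source) (fun c => isOpen_extChartAt_source c)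
    fun q _ => Set.mem_iUnion.2 ⟨q, mem_extChartAt_source q⟩
  have hfin := χ.locallyFinite.finite_nonempty_inter_compact hK
  have hC : ∀ c, ∀ q, FieldCkAt 1 ((χ c : M → ℝ) • V) q := fun c q =>
    ContMDiffAt.smul_section ((χ c).contMDiff.contMDiffAt.of_le (by simp)) (hV q)
  have hsum : V = ∑ c ∈ hfin.toFinset, (χ c : M → ℝ) • V := by
    funext q
    refine Eq.trans ?_ (Finset.sum_apply (M := fun q : M => TangentSpace (𝓡 m) q) q
      hfin.toFinset fun c => (χ c : M → ℝ) • V).symm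
    change V q = ∑ c ∈ hfin.toFinset, χ c q • V q
    by_cases hq : q ∈ K
    · rw [← Finset.sum_smul, ← finsum_eq_sum_of_support_subset, χ.sum_eq_one hq, one_smul]
      intro c hc
      exact hfin.mem_toFinset.2 ⟨q, hc, hq⟩
    · simp [h0 q hq]
  have hint : ∀ c, Integrable (div ((χ c : M → ℝ) • V)) (riemVolume (m := m)) := fun c =>
    (continuous_div (hC c)).integrable_of_hasCompactSupport
      (hasCompactSupport_div hK fun q hq => by
        change χ c q • V q = 0
        rw [h0 q hq, smul_zero])
  have hdiv : ∀ q, div V q = ∑ c ∈ hfin.toFinset, div ((χ c : M → ℝ) • V) q := fun q => by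
    conv_lhs => rw [hsum]
    exact div_sum _ fun c => FieldCkAt.diffAt (k := ((1 : ℕ∞) : ℕ∞ω)) (hC c q)
  simp_rw [hdiv]
  rw [integral_finsetSum _ fun c _ => hint c]
  refine Finset.sum_eq_zero fun c _ => ?_
  refine integral_div_eq_zero_of_subset_source (c := c) (K := K ∩ tsupport (χ c)) (hC c)
    (hK.inter_right (isClosed_tsupport _)) (Set.inter_subset_right.trans (hχ c)) fun q hq => ?_
  change χ c q • V q = 0
  by_cases hqK : q ∈ K
  · rw [image_eq_zero_of_notMem_tsupport fun h => hq ⟨hqK, h⟩, zero_smul]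
  · rw [h0 q hqK, smul_zero]

end DivergenceTheorem

end Intrinsic

section Hypersurface

variable {n : ℕ} {M : Type*} [TopologicalSpace M] [ChartedSpace (EuclideanSpace ℝ (Fin n)) M]
  [IsManifold (𝓡 n) ∞ M] [RiemannianBundle (fun p : M => TangentSpace (𝓡 n) p)]
  [IsContMDiffRiemannianBundle (𝓡 n) ∞ (EuclideanSpace ℝ (Fin n))
    (fun p : M => TangentSpace (𝓡 n) p)]
  {Mbar : Type*} [TopologicalSpace Mbar] [ChartedSpace (EuclideanSpace ℝ (Fin (n + 1))) Mbar]
  [IsManifold (𝓡 (n + 1)) ∞ Mbar] [RiemannianBundle (fun p : Mbar => TangentSpace (𝓡 (n + 1)) p)]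
  [IsContMDiffRiemannianBundle (𝓡 (n + 1)) ∞ (EuclideanSpace ℝ (Fin (n + 1)))
    (fun p : Mbar => TangentSpace (𝓡 (n + 1)) p)]
  {x : M → Mbar} {p : M}

/-! ### Covariant differentiation along the immersion -/

section Along

variable {s t : (q : M) → TangentSpace (𝓡 (n + 1)) (x q)}

/-- The vector field `s` along `x` is of class `C^k` at `p`. -/
abbrev AlongCkAt (k : ℕ∞ω) (s : (q : M) → TangentSpace (𝓡 (n + 1)) (x q)) (p : M) : Prop :=
  ContMDiffAt (𝓡 n) ((𝓡 (n + 1)).prod 𝓘(ℝ, EuclideanSpace ℝ (Fin (n + 1)))) k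
    (fun q => (⟨x q, s q⟩ : TangentBundle (𝓡 (n + 1)) Mbar)) p

/-- The vector field `s` along `x` is differentiable at `p`. -/
abbrev AlongDiffAt (s : (q : M) → TangentSpace (𝓡 (n + 1)) (x q)) (p : M) : Prop :=
  MDifferentiableAt (𝓡 n) ((𝓡 (n + 1)).prod 𝓘(ℝ, EuclideanSpace ℝ (Fin (n + 1))))
    (fun q => (⟨x q, s q⟩ : TangentBundle (𝓡 (n + 1)) Mbar)) p

lemma AlongCkAt.diffAt {k : ℕ∞ω} (hs : AlongCkAt k s p) (hk : k ≠ 0 := by simp) :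
    AlongDiffAt s p :=
  ContMDiffAt.mdifferentiableAt hs hk

lemma AlongDiffAt.base (hs : AlongDiffAt s p) : MDifferentiableAt (𝓡 n) (𝓡 (n + 1)) x p :=
  ((mdifferentiableAt_totalSpace _ _).1 hs).1

lemma contMDiffAt_inner_along {k : ℕ∞ω} (hk : k ≤ ∞) (hs : AlongCkAt k s p)
    (ht : AlongCkAt k t p) :
    ContMDiffAt (𝓡 n) 𝓘(ℝ) k (fun q => (inner ℝ (s q) (t q) : ℝ)) p := by
  have : IsContMDiffRiemannianBundle (𝓡 (n + 1)) k (EuclideanSpace ℝ (Fin (n + 1)))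
    (fun p : Mbar => TangentSpace (𝓡 (n + 1)) p) := IsContMDiffRiemannianBundle.of_le (n := ∞) hk
  exact ContMDiffAt.inner_bundle (IB := 𝓡 (n + 1)) (F := EuclideanSpace ℝ (Fin (n + 1)))
    (E := fun p : Mbar => TangentSpace (𝓡 (n + 1)) p) (b := x) hs ht

lemma mdiffAt_inner_along (hs : AlongDiffAt s p) (ht : AlongDiffAt t p) :
    MDifferentiableAt (𝓡 n) 𝓘(ℝ) (fun q => (inner ℝ (s q) (t q) : ℝ)) p := by
  have : IsContMDiffRiemannianBundle (𝓡 (n + 1)) 1 (EuclideanSpace ℝ (Fin (n + 1)))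
    (fun p : Mbar => TangentSpace (𝓡 (n + 1)) p) :=
    IsContMDiffRiemannianBundle.of_le (n := ∞) ENat.LEInfty.out
  exact MDifferentiableAt.inner_bundle (IB := 𝓡 (n + 1)) (F := EuclideanSpace ℝ (Fin (n + 1)))
    (E := fun p : Mbar => TangentSpace (𝓡 (n + 1)) p) (b := x) hs ht

lemma FieldCkAt.along {E : (y : Mbar) → TangentSpace (𝓡 (n + 1)) y} {k : ℕ∞ω}
    (hE : FieldCkAt k E (x p)) (hx : ContMDiffAt (𝓡 n) (𝓡 (n + 1)) k x p) :
    AlongCkAt k (fun q => E (x q)) p :=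
  ContMDiffAt.comp p hE hx

lemma FieldDiffAt.along {E : (y : Mbar) → TangentSpace (𝓡 (n + 1)) y}
    (hE : FieldDiffAt E (x p)) (hx : MDifferentiableAt (𝓡 n) (𝓡 (n + 1)) x p) :
    AlongDiffAt (fun q => E (x q)) p :=
  MDifferentiableAt.comp p hE hx

/-- The components of a field along `x` in the preferred chart at `x p`. -/
def alongCoords (p : M) (s : (q : M) → TangentSpace (𝓡 (n + 1)) (x q)) (q : M) :
    EuclideanSpace ℝ (Fin (n + 1)) :=
  mvfderiv (𝓡 (n + 1)) (extChartAt (𝓡 (n + 1)) (x p)) (x q) (s q)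

lemma alongCoords_eventuallyEq (hx : ContinuousAt x p)
    (s : (q : M) → TangentSpace (𝓡 (n + 1)) (x q)) :
    (fun q => (trivializationAt (EuclideanSpace ℝ (Fin (n + 1)))
        (fun y : Mbar => TangentSpace (𝓡 (n + 1)) y) (x p) ⟨x q, s q⟩).2) =ᶠ[𝓝 p]
      alongCoords p s := by
  filter_upwards [hx.preimage_mem_nhds
    ((chartAt (EuclideanSpace ℝ (Fin (n + 1))) (x p)).open_source.mem_nhds
      (mem_chart_source _ (x p)))] with q hq
  exact trivializationAt_snd_eq_mvfderiv hq _

lemma AlongDiffAt.coords (hs : AlongDiffAt s p) :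
    MDifferentiableAt (𝓡 n) 𝓘(ℝ, EuclideanSpace ℝ (Fin (n + 1))) (alongCoords p s) p :=
  ((mdifferentiableAt_totalSpace _ _).1 hs).2.congr_of_eventuallyEq
    (alongCoords_eventuallyEq hs.base.continuousAt s).symm

lemma alongDiffAt_iff (hx : MDifferentiableAt (𝓡 n) (𝓡 (n + 1)) x p) : AlongDiffAt s p ↔
    MDifferentiableAt (𝓡 n) 𝓘(ℝ, EuclideanSpace ℝ (Fin (n + 1))) (alongCoords p s) p :=
  ⟨AlongDiffAt.coords, fun h => (mdifferentiableAt_totalSpace _ _).2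
    ⟨hx, h.congr_of_eventuallyEq (alongCoords_eventuallyEq hx.continuousAt s)⟩⟩

lemma nablaAlong_eq (hx : ContinuousAt x p) (s : (q : M) → TangentSpace (𝓡 (n + 1)) (x q))
    (v : TangentSpace (𝓡 n) p) :
    nablaAlong x s p v = coordField (x p) (mvfderiv (𝓡 n) (alongCoords p s) p v) (x p) +
      nabla (ext (s p)) (x p) (dx x p v) := by
  rw [nablaAlong, mvfderiv_congr (alongCoords_eventuallyEq hx s), coordField,
    Trivialization.symmL_apply]
  exact FiberBundle.mem_baseSet_trivializationAt' _

lemma ext_add {q : M} (v w : TangentSpace (𝓡 n) q) : ext (v + w) =ᶠ[𝓝 q] ext v + ext w := by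
  filter_upwards [ext_eq_coordField v, ext_eq_coordField w, ext_eq_coordField (v + w)]
    with y h1 h2 h3
  rw [h3, map_add, coordField_add, Pi.add_apply, Pi.add_apply, h1, h2]

lemma ext_smul {q : M} (a : ℝ) (v : TangentSpace (𝓡 n) q) : ext (a • v) =ᶠ[𝓝 q] a • ext v := by
  filter_upwards [ext_eq_coordField v, ext_eq_coordField (a • v)] with y h1 h3
  rw [h3, map_smul, coordField_smul, Pi.smul_apply, Pi.smul_apply, h1]

lemma nabla_ext_add {q : M} (v w : TangentSpace (𝓡 n) q) :
    nabla (ext (v + w)) q = nabla (ext v) q + nabla (ext w) q := by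
  rw [nabla_congr ((mdifferentiableAt_ext v).add (mdifferentiableAt_ext w)) (ext_add v w),
    nabla_add (mdifferentiableAt_ext v) (mdifferentiableAt_ext w)]

lemma nabla_ext_smul {q : M} (a : ℝ) (v : TangentSpace (𝓡 n) q) :
    nabla (ext (a • v)) q = a • nabla (ext v) q := by
  rw [nabla_congr ((mdifferentiableAt_ext v).const_smul a) (ext_smul a v),
    nabla_const_smul a (mdifferentiableAt_ext v)]

lemma AlongDiffAt.add (hs : AlongDiffAt s p) (ht : AlongDiffAt t p) :
    AlongDiffAt (fun q => s q + t q) p := by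
  refine (alongDiffAt_iff hs.base).2 ((hs.coords.add ht.coords).congr_of_eventuallyEq
    (Eventually.of_forall fun q => ?_))
  exact map_add _ _ _

lemma AlongDiffAt.smul {f : M → ℝ} (hf : MDifferentiableAt (𝓡 n) 𝓘(ℝ) f p)
    (hs : AlongDiffAt s p) : AlongDiffAt (fun q => f q • s q) p := by
  refine (alongDiffAt_iff hs.base).2 ((hf.smul hs.coords).congr_of_eventuallyEq
    (Eventually.of_forall fun q => ?_))
  exact map_smul _ _ _

lemma nablaAlong_add (hs : AlongDiffAt s p) (ht : AlongDiffAt t p) (v : TangentSpace (𝓡 n) p) :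
    nablaAlong x (fun q => s q + t q) p v = nablaAlong x s p v + nablaAlong x t p v := by
  have hx := hs.base.continuousAt
  have h : alongCoords p (fun q => s q + t q) = alongCoords p s + alongCoords p t :=
    funext fun q => map_add _ _ _
  rw [nablaAlong_eq hx, nablaAlong_eq hx, nablaAlong_eq hx, h, mvfderiv_add hs.coords ht.coords,
    nabla_ext_add, add_apply, LinearMap.add_apply, coordField_add, Pi.add_apply]
  abel

lemma nablaAlong_smul {f : M → ℝ} (hf : MDifferentiableAt (𝓡 n) 𝓘(ℝ) f p)
    (hs : AlongDiffAt s p) (v : TangentSpace (𝓡 n) p) :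
    nablaAlong x (fun q => f q • s q) p v =
      mvfderiv (𝓡 n) f p v • s p + f p • nablaAlong x s p v := by
  have hx := hs.base.continuousAt
  have h : alongCoords p (fun q => f q • s q) = f • alongCoords p s :=
    funext fun q => map_smul _ _ _
  have h2 : coordField (x p) (alongCoords p s p) (x p) = s p :=
    coordField_mvfderiv_extChartAt (mem_chart_source _ _) _
  rw [nablaAlong_eq hx, nablaAlong_eq hx, h, mvfderiv_smul hf hs.coords, nabla_ext_smul,
    add_apply, smul_apply, ContinuousLinearMap.smulRight_apply, coordField_add,
    coordField_smul, coordField_smul, LinearMap.smul_apply, Pi.add_apply, Pi.smul_apply,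
    Pi.smul_apply, h2]
  module

lemma nablaAlong_congr (hx : ContinuousAt x p) (h : ∀ᶠ q in 𝓝 p, s q = t q)
    (v : TangentSpace (𝓡 n) p) : nablaAlong x s p v = nablaAlong x t p v := by
  have h1 : alongCoords p s =ᶠ[𝓝 p] alongCoords p t := by
    filter_upwards [h] with q hq
    rw [alongCoords, hq, alongCoords]
  rw [nablaAlong_eq hx, nablaAlong_eq hx, mvfderiv_congr h1, h.self_of_nhds]

/-- On restrictions of ambient vector fields the derivative along `x` is the ambient
Levi-Civita connection. -/
lemma nablaAlong_comp {E : (y : Mbar) → TangentSpace (𝓡 (n + 1)) y}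
    (hE : FieldDiffAt E (x p)) (hx : MDifferentiableAt (𝓡 n) (𝓡 (n + 1)) x p)
    (v : TangentSpace (𝓡 n) p) :
    nablaAlong x (fun q => E (x q)) p v = nabla E (x p) (dx x p v) := by
  have e : alongCoords p (fun q => E (x q)) = RiemGeom.coords (x p) E ∘ x := rfl
  have h : mvfderiv (𝓡 n) (alongCoords p fun q => E (x q)) p v =
      mvfderiv (𝓡 (n + 1)) (RiemGeom.coords (x p) E) (x p) (dx x p v) := by
    have hd : MDifferentiableAt (𝓡 (n + 1)) 𝓘(ℝ, EuclideanSpace ℝ (Fin (n + 1)))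
        (RiemGeom.coords (x p) E) (x p) := mdifferentiableAt_coords (mem_chart_source _ _) hE
    rw [e]
    exact mfderiv_comp_apply p hd hx v
  rw [nablaAlong_eq hx.continuousAt, nabla_eq_coords hE, h]

lemma nablaAlong_zero (hx : MDifferentiableAt (𝓡 n) (𝓡 (n + 1)) x p) (v : TangentSpace (𝓡 n) p) :
    nablaAlong x (fun q => (0 : TangentSpace (𝓡 (n + 1)) (x q))) p v = 0 := by
  have h := nablaAlong_comp (E := 0) (FieldCkAt.diffAt (k := 1) (contMDiff_zeroSection ℝ _ (x p)))
    hx v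
  rw [nabla_zero] at h
  exact h

lemma AlongDiffAt.sum {ι : Type*} (σ : Finset ι)
    {s : ι → (q : M) → TangentSpace (𝓡 (n + 1)) (x q)}
    (hx : MDifferentiableAt (𝓡 n) (𝓡 (n + 1)) x p) (hs : ∀ i, AlongDiffAt (s i) p) :
    AlongDiffAt (fun q => ∑ i ∈ σ, s i q) p := by
  classical
  induction σ using Finset.induction_on with
  | empty =>
    simp only [Finset.sum_empty]
    exact FieldDiffAt.along (E := 0)
      (FieldCkAt.diffAt (k := 1) (contMDiff_zeroSection ℝ _ (x p))) hx
  | insert a σ ha ih =>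
    simp only [Finset.sum_insert ha]
    exact (hs a).add ih

lemma nablaAlong_sum {ι : Type*} (σ : Finset ι)
    {s : ι → (q : M) → TangentSpace (𝓡 (n + 1)) (x q)}
    (hx : MDifferentiableAt (𝓡 n) (𝓡 (n + 1)) x p) (hs : ∀ i, AlongDiffAt (s i) p)
    (v : TangentSpace (𝓡 n) p) :
    nablaAlong x (fun q => ∑ i ∈ σ, s i q) p v = ∑ i ∈ σ, nablaAlong x (s i) p v := by
  classical
  induction σ using Finset.induction_on with
  | empty =>
    simp only [Finset.sum_empty]
    exact nablaAlong_zero hx v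
  | insert a σ ha ih =>
    simp only [Finset.sum_insert ha]
    rw [nablaAlong_add (hs a) (AlongDiffAt.sum σ hx hs), ih]

lemma nablaAlong_map_add (hx : ContinuousAt x p)
    (s : (q : M) → TangentSpace (𝓡 (n + 1)) (x q)) (v w : TangentSpace (𝓡 n) p) :
    nablaAlong x s p (v + w) = nablaAlong x s p v + nablaAlong x s p w := by
  rw [nablaAlong_eq hx, nablaAlong_eq hx, nablaAlong_eq hx, map_add, map_add, map_add,
    coordField_add, Pi.add_apply]
  abel

lemma nablaAlong_map_smul (hx : ContinuousAt x p)
    (s : (q : M) → TangentSpace (𝓡 (n + 1)) (x q)) (a : ℝ) (v : TangentSpace (𝓡 n) p) :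
    nablaAlong x s p (a • v) = a • nablaAlong x s p v := by
  rw [nablaAlong_eq hx, nablaAlong_eq hx, map_smul, map_smul, map_smul,
    coordField_smul, Pi.smul_apply, smul_add]

end Along

/-! ### Compatibility with the metric and symmetry of the connection along the immersion -/

section Frame

lemma mvfderiv_sum {ι : Type*} (σ : Finset ι) {f : ι → M → ℝ}
    (hf : ∀ i, MDifferentiableAt (𝓡 n) 𝓘(ℝ) (f i) p) (v : TangentSpace (𝓡 n) p) :
    mvfderiv (𝓡 n) (fun q => ∑ i ∈ σ, f i q) p v = ∑ i ∈ σ, mvfderiv (𝓡 n) (f i) p v := by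
  classical
  suffices h : MDifferentiableAt (𝓡 n) 𝓘(ℝ) (fun q => ∑ i ∈ σ, f i q) p ∧
    mvfderiv (𝓡 n) (fun q => ∑ i ∈ σ, f i q) p v = ∑ i ∈ σ, mvfderiv (𝓡 n) (f i) p v from h.2
  induction σ using Finset.induction_on with
  | empty =>
    simp only [Finset.sum_empty, mvfderiv_const]
    exact ⟨mdifferentiableAt_const, rfl⟩
  | insert a σ ha ih =>
    simp only [Finset.sum_insert ha]
    exact ⟨(hf a).add ih.1, by rw [mvfderiv_fun_add (hf a) ih.1, add_apply, ih.2]⟩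

variable {s t : (q : M) → TangentSpace (𝓡 (n + 1)) (x q)}
  {E : Fin (n + 1) → (y : Mbar) → TangentSpace (𝓡 (n + 1)) y}

/-- The derivative of a field along `x` in terms of an ambient orthonormal frame. -/
lemma nablaAlong_eq_sum (hE : ∀ a, FieldDiffAt (E a) (x p))
    (hsum : ∀ᶠ y in 𝓝 (x p), ∀ v : TangentSpace (𝓡 (n + 1)) y,
      ∑ a, (inner ℝ (E a y) v : ℝ) • E a y = v)
    (hs : AlongDiffAt s p) (v : TangentSpace (𝓡 n) p) :
    nablaAlong x s p v = ∑ a, (mvfderiv (𝓡 n) (fun q => (inner ℝ (E a (x q)) (s q) : ℝ)) p v •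
      E a (x p) + (inner ℝ (E a (x p)) (s p) : ℝ) • nabla (E a) (x p) (dx x p v)) := by
  have hx := hs.base
  have hEx : ∀ a, AlongDiffAt (fun q => E a (x q)) p := fun a => (hE a).along hx
  have hc : ∀ a, MDifferentiableAt (𝓡 n) 𝓘(ℝ) (fun q => (inner ℝ (E a (x q)) (s q) : ℝ)) p :=
    fun a => mdiffAt_inner_along (hEx a) hs
  have h1 : ∀ᶠ q in 𝓝 p, s q = ∑ a, (inner ℝ (E a (x q)) (s q) : ℝ) • E a (x q) := by
    filter_upwards [hx.continuousAt.eventually hsum] with q hq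
    exact (hq _).symm
  rw [nablaAlong_congr hx.continuousAt h1, nablaAlong_sum _ hx fun a => (hEx a).smul (hc a)]
  refine Finset.sum_congr rfl fun a _ => ?_
  rw [nablaAlong_smul (hc a) (hEx a), nablaAlong_comp (hE a) hx]

/-- The derivative of fields along `x` is compatible with the ambient metric. -/
lemma mvfderiv_inner_along (hs : AlongDiffAt s p) (ht : AlongDiffAt t p)
    (v : TangentSpace (𝓡 n) p) :
    mvfderiv (𝓡 n) (fun q => (inner ℝ (s q) (t q) : ℝ)) p v =
      inner ℝ (nablaAlong x s p v) (t p) + inner ℝ (s p) (nablaAlong x t p v) := by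
  obtain ⟨E, hE⟩ := exists_orthonormalFrameAt (m := n + 1) (x p)
  have hx := hs.base
  have hd : ∀ a, FieldDiffAt (E a) (x p) := fun a => (hE.smooth a).diffAt
  have hEx : ∀ a, AlongDiffAt (fun q => E a (x q)) p := fun a => (hd a).along hx
  have hcs : ∀ a, MDifferentiableAt (𝓡 n) 𝓘(ℝ) (fun q => (inner ℝ (E a (x q)) (s q) : ℝ)) p :=
    fun a => mdiffAt_inner_along (hEx a) hs
  have hct : ∀ a, MDifferentiableAt (𝓡 n) 𝓘(ℝ) (fun q => (inner ℝ (E a (x q)) (t q) : ℝ)) p :=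
    fun a => mdiffAt_inner_along (hEx a) ht
  have h1 : (fun q => (inner ℝ (s q) (t q) : ℝ)) =ᶠ[𝓝 p] fun q => ∑ a,
      ((inner ℝ (E a (x q)) (s q) : ℝ) * (inner ℝ (E a (x q)) (t q) : ℝ)) := by
    filter_upwards [hx.continuousAt.eventually hE.eventually_sum] with q hq
    conv_lhs => rw [← hq (s q)]
    simp only [sum_inner, real_inner_smul_left]
  have h2 : mvfderiv (𝓡 n) (fun q => ∑ a, ((inner ℝ (E a (x q)) (s q) : ℝ) *
      (inner ℝ (E a (x q)) (t q) : ℝ))) p v = ∑ a,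
        ((inner ℝ (E a (x p)) (s p) : ℝ) *
          mvfderiv (𝓡 n) (fun q => (inner ℝ (E a (x q)) (t q) : ℝ)) p v +
        (inner ℝ (E a (x p)) (t p) : ℝ) *
          mvfderiv (𝓡 n) (fun q => (inner ℝ (E a (x q)) (s q) : ℝ)) p v) := by
    rw [mvfderiv_sum (f := fun a q => (inner ℝ (E a (x q)) (s q) : ℝ) *
      (inner ℝ (E a (x q)) (t q) : ℝ)) _ fun a => (hcs a).mul (hct a)]
    refine Finset.sum_congr rfl fun a _ => ?_
    rw [mvfderiv_fun_mul (hcs a) (hct a)]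
    rfl
  -- the connection form of an orthonormal frame is skew, so its terms cancel below
  have hskew : ∀ a b, (inner ℝ (nabla (E a) (x p) (dx x p v)) (E b (x p)) : ℝ) +
      inner ℝ (E a (x p)) (nabla (E b) (x p) (dx x p v)) = 0 := fun a b => by
    rw [← mvfderiv_inner (hd a) (hd b)]
    have hconst : (fun y => (inner ℝ (E a y) (E b y) : ℝ)) =ᶠ[𝓝 (x p)]
        fun _ => if a = b then 1 else 0 := by
      filter_upwards [hE.orthonormal] with y hy
      exact (orthonormal_iff_ite.1 hy) a b
    rw [mvfderiv_congr hconst, mvfderiv_const]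
    rfl
  rw [mvfderiv_congr h1, h2, nablaAlong_eq_sum hd hE.eventually_sum hs,
    nablaAlong_eq_sum hd hE.eventually_sum ht]
  have hz : ∑ a, ((inner ℝ (E a (x p)) (s p) : ℝ) *
        inner ℝ (nabla (E a) (x p) (dx x p v)) (t p) + (inner ℝ (E a (x p)) (t p) : ℝ) *
        inner ℝ (s p) (nabla (E a) (x p) (dx x p v))) = 0 := by
    have e1 : ∀ a, (inner ℝ (nabla (E a) (x p) (dx x p v)) (t p) : ℝ) = ∑ b,
        (inner ℝ (E b (x p)) (t p) : ℝ) * inner ℝ (nabla (E a) (x p) (dx x p v)) (E b (x p)) :=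
      fun a => by
        conv_lhs => rw [← hE.eventually_sum.self_of_nhds (t p)]
        simp only [inner_sum, real_inner_smul_right]
    have e2 : ∀ a, (inner ℝ (s p) (nabla (E a) (x p) (dx x p v)) : ℝ) = ∑ b,
        (inner ℝ (E b (x p)) (s p) : ℝ) * inner ℝ (E b (x p)) (nabla (E a) (x p) (dx x p v)) :=
      fun a => by
        conv_lhs => rw [← hE.eventually_sum.self_of_nhds (s p)]
        simp only [sum_inner, real_inner_smul_left]
    simp only [e1, e2, Finset.mul_sum, Finset.sum_add_distrib]
    conv_lhs => rw [Finset.sum_comm (f := fun a b => (inner ℝ (E a (x p)) (t p) : ℝ) * _)]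
    simp only [← Finset.sum_add_distrib]
    refine Finset.sum_eq_zero fun a _ => Finset.sum_eq_zero fun b _ => ?_
    linear_combination (inner ℝ (E a (x p)) (s p) : ℝ) * inner ℝ (E b (x p)) (t p) * hskew a b
  rw [← sub_eq_zero, ← neg_eq_zero, ← hz]
  simp only [sum_inner, inner_sum, inner_add_left, inner_add_right, real_inner_smul_left,
    real_inner_smul_right, ← Finset.sum_neg_distrib, ← Finset.sum_add_distrib,
    ← Finset.sum_sub_distrib, neg_sub]
  refine Finset.sum_congr rfl fun a _ => ?_
  rw [real_inner_comm (E a (x p)) (s p)]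
  ring

end Frame

section Symmetry

open VectorField

variable {X Y : (q : M) → TangentSpace (𝓡 n) q}

/-- The commutator formula for functions with values in a Euclidean space, by components. -/
lemma mvfderiv_mvfderiv_sub_euclidean {k : ℕ} {f : M → EuclideanSpace ℝ (Fin k)}
    (hf : ContMDiffAt (𝓡 n) 𝓘(ℝ, EuclideanSpace ℝ (Fin k)) ∞ f p)
    (hX : FieldCkAt 2 X p) (hY : FieldCkAt 2 Y p) :
    mvfderiv (𝓡 n) (fun q => mvfderiv (𝓡 n) f q (Y q)) p (X p)
      - mvfderiv (𝓡 n) (fun q => mvfderiv (𝓡 n) f q (X q)) p (Y p)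
      = mvfderiv (𝓡 n) f p (mlieBracket (𝓡 n) X Y p) := by
  ext a
  let L : EuclideanSpace ℝ (Fin k) →L[ℝ] ℝ := EuclideanSpace.proj a
  have hLf : ContMDiffAt (𝓡 n) 𝓘(ℝ) 2 (fun q => L (f q)) p :=
    ContMDiffAt.of_le (L.contMDiff.contMDiffAt.comp p hf) ENat.LEInfty.out
  have h := mvfderiv_mvfderiv_sub hLf hX hY
  have hd : ∀ᶠ q in 𝓝 p, MDifferentiableAt (𝓡 n) 𝓘(ℝ, EuclideanSpace ℝ (Fin k)) f q := by
    filter_upwards [(contMDiffAt_iff_contMDiffAt_nhds (n := 1) (by simp)).1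
      (ContMDiffAt.of_le hf ENat.LEInfty.out)] with q hq
    exact ContMDiffAt.mdifferentiableAt hq (by simp)
  have hder : ∀ U : (q : M) → TangentSpace (𝓡 n) q, FieldCkAt 2 U p →
      MDifferentiableAt (𝓡 n) 𝓘(ℝ, EuclideanSpace ℝ (Fin k))
        (fun q => mvfderiv (𝓡 n) f q (U q)) p := fun U hU =>
    (contMDiffAt_mvfderiv_field (k := 1) hf (ContMDiffAt.of_le hU (by norm_num))
      (by rw [one_add_one_eq_two]; exact ENat.LEInfty.out)).mdifferentiableAt (by simp)
  have hc : ∀ U : (q : M) → TangentSpace (𝓡 n) q,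
      (fun q => mvfderiv (𝓡 n) (fun q => L (f q)) q (U q)) =ᶠ[𝓝 p]
        fun q => L (mvfderiv (𝓡 n) f q (U q)) := fun U => by
    filter_upwards [hd] with q hq
    exact mvfderiv_clm_comp L hq (U q)
  rw [mvfderiv_congr (hc X), mvfderiv_congr (hc Y), mvfderiv_clm_comp L (hder X hX),
    mvfderiv_clm_comp L (hder Y hY), mvfderiv_clm_comp L hd.self_of_nhds] at h
  exact h

/-- The connection along `x` is torsion-free. The right hand side is tangent to the hypersurface,
whence the symmetry of the second fundamental form. -/
lemma nablaAlong_dx_sub (hx : ContMDiff (𝓡 n) (𝓡 (n + 1)) ∞ x) (hX : FieldCkAt 2 X p)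
    (hY : FieldCkAt 2 Y p) :
    nablaAlong x (fun q => dx x q (Y q)) p (X p) - nablaAlong x (fun q => dx x q (X q)) p (Y p)
      = dx x p (mlieBracket (𝓡 n) X Y p) := by
  have hxc := (hx p).continuousAt
  have hmem := mem_chart_source (EuclideanSpace ℝ (Fin (n + 1))) (x p)
  have hF : ContMDiffAt (𝓡 n) 𝓘(ℝ, EuclideanSpace ℝ (Fin (n + 1))) ∞
      (extChartAt (𝓡 (n + 1)) (x p) ∘ x) p :=
    (contMDiffAt_extChartAt_apply hmem).comp p (hx p)
  have hcomp : ∀ {q : M}, x q ∈ (chartAt (EuclideanSpace ℝ (Fin (n + 1))) (x p)).source →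
      ∀ v, mvfderiv (𝓡 n) (extChartAt (𝓡 (n + 1)) (x p) ∘ x) q v =
        mvfderiv (𝓡 (n + 1)) (extChartAt (𝓡 (n + 1)) (x p)) (x q) (dx x q v) := fun hq v =>
    mfderiv_comp_apply _ ((contMDiffAt_extChartAt_apply hq).mdifferentiableAt (by simp))
      ((hx _).mdifferentiableAt (by simp)) v
  have hc : ∀ U : (q : M) → TangentSpace (𝓡 n) q, alongCoords p (fun q => dx x q (U q)) =ᶠ[𝓝 p]
      fun q => mvfderiv (𝓡 n) (extChartAt (𝓡 (n + 1)) (x p) ∘ x) q (U q) := fun U => by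
    filter_upwards [hxc.preimage_mem_nhds
      ((chartAt (EuclideanSpace ℝ (Fin (n + 1))) (x p)).open_source.mem_nhds hmem)] with q hq
    exact (hcomp hq _).symm
  have hcom : ∀ a b : TangentSpace (𝓡 (n + 1)) (x p),
      nabla (ext b) (x p) a - nabla (ext a) (x p) b = 0 := fun a b => by
    have h := nabla_sub_nabla (mdifferentiableAt_ext a) (mdifferentiableAt_ext b)
    rw [ext_self, ext_self, (ext_eq_coordField a).mlieBracket_vectorField_eq
      (ext_eq_coordField b), mlieBracket_coordField hmem] at h
    exact h
  have h1 := mvfderiv_mvfderiv_sub_euclidean hF hX hY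
  have h2 : ∀ a b c d : TangentSpace (𝓡 (n + 1)) (x p), a + b - (c + d) = (a - c) + (b - d) :=
    fun a b c d => by abel
  have h3 : ∀ v w : EuclideanSpace ℝ (Fin (n + 1)), coordField (x p) v (x p) -
      coordField (x p) w (x p) = coordField (x p) (v - w) (x p) := fun v w =>
    (map_sub _ v w).symm
  rw [nablaAlong_eq hxc, nablaAlong_eq hxc, mvfderiv_congr (hc X),
    mvfderiv_congr (hc Y), h2, hcom, add_zero, h3, h1, hcomp hmem,
    coordField_mvfderiv_extChartAt hmem]

end Symmetry

/-! ### The shape operator and the curvature term -/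

section Shape

variable {N : (p : M) → TangentSpace (𝓡 (n + 1)) (x p)}
  {X Y : (q : M) → TangentSpace (𝓡 n) q}

lemma IsUnitNormal.alongCkAt (hN : IsUnitNormal (n := n) x N) (p : M) : AlongCkAt ∞ N p :=
  hN.smooth p

lemma alongCkAt_dx {k l : ℕ∞ω} (hx : ContMDiffAt (𝓡 n) (𝓡 (n + 1)) l x p)
    (hX : FieldCkAt k X p) (h : k + 1 ≤ l) : AlongCkAt k (fun q => dx x q (X q)) p :=
  contMDiffAt_mfderiv_field hx hX h

lemma alongCkAt_dx_infty (hx : ContMDiff (𝓡 n) (𝓡 (n + 1)) ∞ x)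
    (hX : FieldCkAt ∞ X p) : AlongCkAt ∞ (fun q => dx x q (X q)) p :=
  alongCkAt_dx (hx p) hX (by simp)

lemma inner_tangentPart (W : TangentSpace (𝓡 (n + 1)) (x p)) (w : TangentSpace (𝓡 n) p) :
    inner ℝ (tangentPart x p W) w = inner ℝ W (dx x p w) := by
  conv_rhs => rw [← (frame p).sum_repr w]
  simp only [tangentPart, sum_inner, real_inner_smul_left, map_sum, map_smul, inner_sum,
    real_inner_smul_right, OrthonormalBasis.repr_apply_apply]
  exact Finset.sum_congr rfl fun i _ => mul_comm _ _

/-- The shape operator and the curvature term are defined by their values on an orthonormal basis;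
since `Φ` is linear, the defining formula holds for all vectors. -/
lemma inner_constr_tangentPart (Φ : TangentSpace (𝓡 n) p → TangentSpace (𝓡 (n + 1)) (x p))
    (hadd : ∀ v w, Φ (v + w) = Φ v + Φ w) (hsmul : ∀ (a : ℝ) v, Φ (a • v) = a • Φ v)
    (v w : TangentSpace (𝓡 n) p) :
    inner ℝ ((frame p).toBasis.constr ℝ (fun i => tangentPart x p (Φ (frame p i))) v) w =
      inner ℝ (Φ v) (dx x p w) := by
  let Ψ : TangentSpace (𝓡 n) p →ₗ[ℝ] TangentSpace (𝓡 (n + 1)) (x p) :=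
    { toFun := Φ, map_add' := hadd, map_smul' := hsmul }
  let τ : TangentSpace (𝓡 (n + 1)) (x p) →ₗ[ℝ] TangentSpace (𝓡 n) p :=
    { toFun := tangentPart x p
      map_add' := fun a b => ext_inner_right ℝ fun c => by
        rw [inner_add_left, inner_tangentPart, inner_tangentPart, inner_tangentPart,
          inner_add_left]
      map_smul' := fun a b => ext_inner_right ℝ fun c => by
        rw [RingHom.id_apply, real_inner_smul_left, inner_tangentPart, inner_tangentPart,
          real_inner_smul_left] }
  have h : (frame p).toBasis.constr ℝ (fun i => tangentPart x p (Φ (frame p i))) = τ ∘ₗ Ψ := by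
    refine (frame p).toBasis.ext fun i => ?_
    rw [Module.Basis.constr_basis, OrthonormalBasis.coe_toBasis]
    rfl
  rw [h]
  exact inner_tangentPart _ _

lemma inner_shape (hx : ContinuousAt x p) (v w : TangentSpace (𝓡 n) p) :
    inner ℝ (shape x N p v) w = -inner ℝ (nablaAlong x N p v) (dx x p w) := by
  have h : shape x N p = -(frame p).toBasis.constr ℝ
      (fun i => tangentPart x p (nablaAlong x N p (frame p i))) := by
    refine (frame p).toBasis.ext fun i => ?_
    rw [shape, LinearMap.neg_apply, Module.Basis.constr_basis, Module.Basis.constr_basis]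
  rw [h, LinearMap.neg_apply, inner_neg_left, inner_constr_tangentPart _
    (nablaAlong_map_add hx N) (nablaAlong_map_smul hx N)]

/-- The shape operator is the second fundamental form. -/
lemma inner_shape_eq (hx : ContMDiff (𝓡 n) (𝓡 (n + 1)) ∞ x) (hN : IsUnitNormal (n := n) x N)
    (v : TangentSpace (𝓡 n) p) (hY : FieldCkAt ∞ Y p) :
    inner ℝ (shape x N p v) (Y p) =
      inner ℝ (N p) (nablaAlong x (fun q => dx x q (Y q)) p v) := by
  have h := mvfderiv_inner_along (hN.alongCkAt p).diffAt (alongCkAt_dx_infty hx hY).diffAt v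
  have h0 : (fun q => (inner ℝ (N q) (dx x q (Y q)) : ℝ)) = fun _ => 0 :=
    funext fun q => hN.normal q _
  rw [h0, mvfderiv_const] at h
  have h1 : (0 : ℝ) = inner ℝ (nablaAlong x N p v) (dx x p (Y p)) +
    inner ℝ (N p) (nablaAlong x (fun q => dx x q (Y q)) p v) := h
  rw [inner_shape (hx p).continuousAt]
  linarith

lemma shape_isSymmetric (hx : ContMDiff (𝓡 n) (𝓡 (n + 1)) ∞ x)
    (hN : IsUnitNormal (n := n) x N) (p : M) : (shape x N p).IsSymmetric := fun v w => by
  have hv := contMDiffAt_ext v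
  have hw := contMDiffAt_ext w
  have h1 := inner_shape_eq hx hN v hw
  have h2 := inner_shape_eq hx hN w hv
  rw [ext_self] at h1 h2
  have h3 := nablaAlong_dx_sub hx (ContMDiffAt.of_le hv ENat.LEInfty.out)
    (ContMDiffAt.of_le hw ENat.LEInfty.out)
  rw [ext_self, ext_self] at h3
  rw [real_inner_comm (shape x N p w) v, h1, h2, ← sub_eq_zero, ← inner_sub_right, h3, hN.normal]

/-- The shape operator is a smooth field of endomorphisms. -/
lemma endSmoothAt_shape (hx : ContMDiff (𝓡 n) (𝓡 (n + 1)) ∞ x)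
    (hN : IsUnitNormal (n := n) x N) (p : M) : EndSmoothAt (shape x N) p := by
  obtain ⟨e, he⟩ := exists_orthonormalFrameAt (m := n) p
  obtain ⟨E, hE⟩ := exists_orthonormalFrameAt (m := n + 1) (x p)
  refine he.endSmoothAt fun i j => ?_
  have hEx : ∀ a, AlongCkAt ∞ (fun q => E a (x q)) p := fun a => (hE.smooth a).along (hx p)
  have hdx : ∀ i, AlongCkAt ∞ (fun q => dx x q (e i q)) p := fun i =>
    alongCkAt_dx_infty hx (he.smooth i)
  have hEE : ∀ a b, AlongCkAt ∞ (fun q => nabla (E a) (x q) (E b (x q))) p := fun a b =>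
    (FieldCkAt.nabla (k := ⊤) (l := ⊤) le_top (hE.smooth b) (hE.smooth a)).along (hx p)
  have hN' := hN.alongCkAt p
  -- the entry of the shape operator, written out in the ambient frame `E`
  have main : ContMDiffAt (𝓡 n) 𝓘(ℝ) ∞ (fun q => -∑ a,
      (mvfderiv (𝓡 n) (fun q => (inner ℝ (E a (x q)) (N q) : ℝ)) q (e i q) *
        inner ℝ (E a (x q)) (dx x q (e j q)) +
      (inner ℝ (E a (x q)) (N q) : ℝ) * ∑ b, (inner ℝ (E b (x q)) (dx x q (e i q)) : ℝ) *
        inner ℝ (nabla (E a) (x q) (E b (x q))) (dx x q (e j q)))) p := by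
    refine (ContMDiffAt.sum (t := Finset.univ) fun a _ => ?_).neg
    refine ((contMDiffAt_mvfderiv_field (contMDiffAt_inner_along le_rfl (hEx a) hN')
      (he.smooth i) (by simp)).mul (contMDiffAt_inner_along le_rfl (hEx a) (hdx j))).add
      ((contMDiffAt_inner_along le_rfl (hEx a) hN').mul
        (ContMDiffAt.sum (t := Finset.univ) fun b _ => ?_))
    exact (contMDiffAt_inner_along le_rfl (hEx b) (hdx i)).mul
      (contMDiffAt_inner_along le_rfl (hEE a b) (hdx j))
  refine main.congr_of_eventuallyEq ?_
  have hxc := (hx p).continuousAt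
  filter_upwards [hxc.eventually hE.eventually_sum.eventually_nhds,
    hxc.eventually hE.eventually_diffAt] with q hq hq'
  rw [real_inner_comm (shape x N q (e i q)), inner_shape (hx q).continuousAt,
    nablaAlong_eq_sum hq' hq (hN.alongCkAt q).diffAt, sum_inner]
  congr 1
  refine Finset.sum_congr rfl fun a _ => ?_
  rw [inner_add_left, real_inner_smul_left, real_inner_smul_left]
  congr 2
  conv_lhs => rw [← hq.self_of_nhds (dx x q (e i q))]
  simp only [map_sum, map_smul, sum_inner, real_inner_smul_left]

lemma curvature_add_left {m : ℕ} {M : Type*} [TopologicalSpace M]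
    [ChartedSpace (EuclideanSpace ℝ (Fin m)) M]
    [IsManifold (𝓡 m) ∞ M] [RiemannianBundle (fun p : M => TangentSpace (𝓡 m) p)]
    [IsContMDiffRiemannianBundle (𝓡 m) ∞ (EuclideanSpace ℝ (Fin m))
      (fun p : M => TangentSpace (𝓡 m) p)] {p : M} (u u' v w : TangentSpace (𝓡 m) p) :
    curvature p (u + u') v w = curvature p u v w + curvature p u' v w := by
  obtain ⟨E, hE⟩ := exists_orthonormalFrameAt (m := m) p
  have h := curvature_eq_sum (fun a => ContMDiffAt.of_le (hE.smooth a) ENat.LEInfty.out)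
    hE.eventually_sum
  simp only [h, inner_add_right, add_mul, add_smul, Finset.sum_add_distrib]

lemma curvature_smul_left {m : ℕ} {M : Type*} [TopologicalSpace M]
    [ChartedSpace (EuclideanSpace ℝ (Fin m)) M]
    [IsManifold (𝓡 m) ∞ M] [RiemannianBundle (fun p : M => TangentSpace (𝓡 m) p)]
    [IsContMDiffRiemannianBundle (𝓡 m) ∞ (EuclideanSpace ℝ (Fin m))
      (fun p : M => TangentSpace (𝓡 m) p)] {p : M} (a : ℝ) (u v w : TangentSpace (𝓡 m) p) :
    curvature p (a • u) v w = a • curvature p u v w := by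
  obtain ⟨E, hE⟩ := exists_orthonormalFrameAt (m := m) p
  have h := curvature_eq_sum (fun a => ContMDiffAt.of_le (hE.smooth a) ENat.LEInfty.out)
    hE.eventually_sum
  simp only [h, real_inner_smul_right, mul_assoc, Finset.smul_sum, smul_smul]

lemma inner_curvN (v w : TangentSpace (𝓡 n) p) :
    inner ℝ (curvN x N p v) w =
      inner ℝ (curvature (x p) (dx x p v) (N p) (N p)) (dx x p w) := by
  rw [curvN, inner_constr_tangentPart (fun v => curvature (x p) (dx x p v) (N p) (N p))]
  · intro v w
    rw [map_add, curvature_add_left]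
  · intro a v
    rw [map_smul, curvature_smul_left]

/-- Smoothness of `R_N`: by tensoriality its entries are polynomials in the components of the
curvature in a smooth ambient frame, of `N`, and of the differential of `x`. -/
lemma endSmoothAt_curvN (hx : ContMDiff (𝓡 n) (𝓡 (n + 1)) ∞ x)
    (hN : IsUnitNormal (n := n) x N) (p : M) : EndSmoothAt (curvN x N) p := by
  obtain ⟨e, he⟩ := exists_orthonormalFrameAt (m := n) p
  obtain ⟨E, hE⟩ := exists_orthonormalFrameAt (m := n + 1) (x p)
  refine he.endSmoothAt fun i j => ?_
  have hEx : ∀ a, AlongCkAt ∞ (fun q => E a (x q)) p := fun a => (hE.smooth a).along (hx p)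
  have hdx : ∀ i, AlongCkAt ∞ (fun q => dx x q (e i q)) p := fun i =>
    alongCkAt_dx_infty hx (he.smooth i)
  have hR : ∀ a b c, AlongCkAt ∞ (fun q => curvatureField (E a) (E b) (E c) (x q)) p :=
    fun a b c => (fieldCkAt_curvatureField (hE.smooth a) (hE.smooth b) (hE.smooth c)).along (hx p)
  have hN' := hN.alongCkAt p
  have main : ContMDiffAt (𝓡 n) 𝓘(ℝ) ∞ (fun q => ∑ a, ∑ b, ∑ c,
      (inner ℝ (E a (x q)) (dx x q (e i q)) * inner ℝ (E b (x q)) (N q) *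
        inner ℝ (E c (x q)) (N q) : ℝ) *
        inner ℝ (curvatureField (E a) (E b) (E c) (x q)) (dx x q (e j q))) p := by
    refine ContMDiffAt.sum (t := Finset.univ) fun a _ => ContMDiffAt.sum (t := Finset.univ)
      fun b _ => ContMDiffAt.sum (t := Finset.univ) fun c _ => ?_
    exact (((contMDiffAt_inner_along le_rfl (hEx a) (hdx i)).mul
      (contMDiffAt_inner_along le_rfl (hEx b) hN')).mul
      (contMDiffAt_inner_along le_rfl (hEx c) hN')).mul
      (contMDiffAt_inner_along le_rfl (hR a b c) (hdx j))
  refine main.congr_of_eventuallyEq ?_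
  have hxc := (hx p).continuousAt
  have hE2 : ∀ᶠ y in 𝓝 (x p), ∀ a, FieldCkAt 2 (E a) y := eventually_all.2 fun a =>
    (contMDiffAt_iff_contMDiffAt_nhds (n := 2) (by simp)).1
      (ContMDiffAt.of_le (hE.smooth a) ENat.LEInfty.out)
  filter_upwards [hxc.eventually hE.eventually_sum.eventually_nhds, hxc.eventually hE2]
    with q hq hq'
  rw [real_inner_comm (curvN x N q (e i q)), inner_curvN, curvature_eq_sum hq' hq]
  simp only [sum_inner, real_inner_smul_left]

end Shape

/-! ### The Newton transformations and the symmetrized operator -/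

section Newton

variable {N : (p : M) → TangentSpace (𝓡 (n + 1)) (x p)} {r : ℕ}

/-- The elementary symmetric functions of the principal curvatures are, up to sign, the
coefficients of the characteristic polynomial of the shape operator. -/
lemma symmCurv_eq_coeff (hx : ContMDiff (𝓡 n) (𝓡 (n + 1)) ∞ x)
    (hN : IsUnitNormal (n := n) x N) (hr : r ≤ n) (p : M) :
    symmCurv x N r p = (-1) ^ r * (shape x N p).charpoly.coeff (n - r) := by
  have hd : (shape x N p).charpoly.natDegree = n := by
    rw [LinearMap.charpoly_natDegree]
    change Module.finrank ℝ (EuclideanSpace ℝ (Fin n)) = _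
    simp
  have h := Polynomial.coeff_eq_esymm_roots_of_splits
    (shape_isSymmetric hx hN p).splits_charpoly (k := n - r) (by rw [hd]; omega)
  rw [h, (LinearMap.charpoly_monic _).leadingCoeff, hd, Nat.sub_sub_self hr, one_mul,
    ← mul_assoc, ← pow_add, Even.neg_one_pow (Even.add_self r), one_mul, symmCurv]

lemma contMDiffAt_symmCurv (hx : ContMDiff (𝓡 n) (𝓡 (n + 1)) ∞ x)
    (hN : IsUnitNormal (n := n) x N) (hr : r ≤ n) (p : M) :
    ContMDiffAt (𝓡 n) 𝓘(ℝ) ∞ (symmCurv x N r) p := by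
  have h : symmCurv x N r = fun p => (-1) ^ r * (shape x N p).charpoly.coeff (n - r) :=
    funext (symmCurv_eq_coeff hx hN hr)
  rw [h]
  exact contMDiffAt_const.mul ((endSmoothAt_shape hx hN p).charpoly_coeff _)

lemma endSmoothAt_newton (hx : ContMDiff (𝓡 n) (𝓡 (n + 1)) ∞ x)
    (hN : IsUnitNormal (n := n) x N) (hr : r ≤ n) (p : M) : EndSmoothAt (newton x N r) p := by
  induction r with
  | zero => exact EndSmoothAt.id
  | succ r ih =>
    exact (EndSmoothAt.smul (contMDiffAt_symmCurv hx hN hr p) EndSmoothAt.id).sub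
      ((endSmoothAt_shape hx hN p).comp (ih (by omega)))

lemma newton_comm_shape (r : ℕ) (p : M) :
    newton x N r p ∘ₗ shape x N p = shape x N p ∘ₗ newton x N r p := by
  induction r with
  | zero => rfl
  | succ r ih =>
    simp only [newton, LinearMap.sub_comp, LinearMap.comp_sub, LinearMap.smul_comp,
      LinearMap.comp_smul, LinearMap.comp_assoc, ih, LinearMap.id_comp, LinearMap.comp_id]

lemma newton_isSymmetric (hx : ContMDiff (𝓡 n) (𝓡 (n + 1)) ∞ x)
    (hN : IsUnitNormal (n := n) x N) (r : ℕ) (p : M) : (newton x N r p).IsSymmetric := by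
  induction r with
  | zero => exact fun _ _ => rfl
  | succ r ih =>
    intro v w
    have hA := shape_isSymmetric hx hN p
    have hc : shape x N p (newton x N r p w) = newton x N r p (shape x N p w) :=
      (LinearMap.congr_fun (newton_comm_shape (x := x) (N := N) r p) w).symm
    have e : (inner ℝ (shape x N p (newton x N r p v)) w : ℝ) =
        inner ℝ v (shape x N p (newton x N r p w)) := by
      rw [hc]
      exact (hA _ _).trans (ih _ _)
    have h1 : ∀ v, newton x N (r + 1) p v =
      symmCurv x N (r + 1) p • v - shape x N p (newton x N r p v) := fun v => rfl
    rw [h1, h1, inner_sub_left, inner_sub_right, real_inner_smul_left, real_inner_smul_right, e]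

lemma contMDiffAt_potential (hx : ContMDiff (𝓡 n) (𝓡 (n + 1)) ∞ x)
    (hN : IsUnitNormal (n := n) x N) (hr : r ≤ n) (p : M) :
    ContMDiffAt (𝓡 n) 𝓘(ℝ) ∞ (potential x N r) p := by
  have hP := endSmoothAt_newton hx hN hr p
  have hA := endSmoothAt_shape hx hN p
  have h1 : ContMDiffAt (𝓡 n) 𝓘(ℝ) ∞ (fun q => LinearMap.trace ℝ (TangentSpace (𝓡 n) q)
      (newton x N r q ∘ₗ shape x N q ∘ₗ shape x N q)) p :=
    contMDiffAt_trace le_rfl (hP.comp (hA.comp hA))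
  have h2 : ContMDiffAt (𝓡 n) 𝓘(ℝ) ∞ (fun q => LinearMap.trace ℝ (TangentSpace (𝓡 n) q)
      (newton x N r q ∘ₗ curvN x N q)) p :=
    contMDiffAt_trace le_rfl (hP.comp (endSmoothAt_curvN hx hN p))
  exact h1.add h2

lemma isUnit_newton (hdef : NewtonPosDef x N r ∨ NewtonNegDef x N r) (p : M) :
    IsUnit (newton x N r p : Module.End ℝ (TangentSpace (𝓡 n) p)) := by
  rw [LinearMap.isUnit_iff_ker_eq_bot, LinearMap.ker_eq_bot']
  intro v hv
  by_contra h0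
  rcases hdef with h | h
  · have := h p v h0
    rw [hv, inner_zero_left] at this
    exact this.false
  · have := h p v h0
    rw [hv, inner_zero_left] at this
    exact this.false

lemma newton_driftField (hdef : NewtonPosDef x N r ∨ NewtonNegDef x N r) (p : M) :
    newton x N r p (driftField x N r p) = -traceNabla (fun q => newton x N r q) p := by
  rw [driftField, map_neg]
  congr 1
  exact LinearMap.congr_fun (Ring.mul_inverse_cancel _ (isUnit_newton hdef p)) _

lemma fieldCkAt_driftField (hx : ContMDiff (𝓡 n) (𝓡 (n + 1)) ∞ x)
    (hN : IsUnitNormal (n := n) x N) (hr : r ≤ n)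
    (hdef : NewtonPosDef x N r ∨ NewtonNegDef x N r) (p : M) :
    FieldCkAt ∞ (fun q => driftField x N r q) p := by
  have h := (endSmoothAt_newton hx hN hr p).ringInverse (isUnit_newton hdef) _
    (fieldCkAt_traceNabla (p := p) (fun q => endSmoothAt_newton hx hN hr q)
      (newton_isSymmetric hx hN r))
  refine FieldCkAt.congr_of_eventuallyEq (FieldCkAt.const_smul (-1) h)
    (Eventually.of_forall fun q => ?_)
  simp [driftField]
  rfl

lemma traceNabla_const_smul {P : (q : M) → TangentSpace (𝓡 n) q →ₗ[ℝ] TangentSpace (𝓡 n) q}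
    (hP : EndSmoothAt P p) (c : ℝ) :
    traceNabla (fun q => c • P q) p = c • traceNabla P p := by
  rw [traceNabla, traceNabla, Finset.smul_sum]
  refine Finset.sum_congr rfl fun i _ => ?_
  have h : (fun q => (c • P q) (ext (frame p i) q)) = c • fun q => P q (ext (frame p i) q) := rfl
  rw [h, nabla_const_smul c (hP.fieldDiffAt (mdifferentiableAt_ext _)), LinearMap.smul_apply,
    LinearMap.smul_apply, smul_sub]

lemma inner_newtonSign_smul_newton_nonneg (hdef : NewtonPosDef x N r ∨ NewtonNegDef x N r)
    (p : M) (v : TangentSpace (𝓡 n) p) :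
    0 ≤ inner ℝ ((newtonSign x N r • newton x N r p) v) v := by
  rcases eq_or_ne v 0 with rfl | hv
  · simp
  rw [LinearMap.smul_apply, real_inner_smul_left, newtonSign]
  split_ifs with h
  · simpa using (h p v hv).le
  · have := (hdef.resolve_left h) p v hv
    linarith

/-- The symmetrized stability operator in terms of the positive definite field `P = ε P_r`; the
field `X` is the same for `P` and for `P_r`. -/
lemma symmStabOp_eq (hx : ContMDiff (𝓡 n) (𝓡 (n + 1)) ∞ x)
    (hN : IsUnitNormal (n := n) x N) (hr : r ≤ n)
    (hdef : NewtonPosDef x N r ∨ NewtonNegDef x N r) {f : M → ℝ}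
    (hf : ContMDiff (𝓡 n) 𝓘(ℝ) 2 f) (p : M) :
    symmStabOp x N r f p =
      div (fun q => (newtonSign x N r • newton x N r q) (grad f q)) p +
        (newtonSign x N r * potential x N r p
          - (1 / 2 : ℝ) * div (fun q => (newtonSign x N r • newton x N r q)
              (driftField x N r q)) p
          - inner ℝ ((newtonSign x N r • newton x N r p) (driftField x N r p))
              (driftField x N r p) / 4) * f p := by
  have hP := endSmoothAt_newton hx hN hr p
  have h1 : FieldDiffAt (fun q => newton x N r q (grad f q)) p :=
    hP.fieldDiffAt (FieldCkAt.diffAt (k := ((1 : ℕ∞) : ℕ∞ω))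
      (fieldCkAt_grad (hf p) (by norm_num)))
  have h2 : FieldDiffAt (fun q => newton x N r q (driftField x N r q)) p :=
    hP.fieldDiffAt (fieldCkAt_driftField hx hN hr hdef p).diffAt
  have e1 := div_const_smul (newtonSign x N r) h1
  have e2 := div_const_smul (newtonSign x N r) h2
  have e3 : (fun q => (newtonSign x N r • newton x N r q) (grad f q)) =
    newtonSign x N r • fun q => newton x N r q (grad f q) := rfl
  have e4 : (fun q => (newtonSign x N r • newton x N r q) (driftField x N r q)) =
    newtonSign x N r • fun q => newton x N r q (driftField x N r q) := rfl
  rw [e3, e4, e1, e2, LinearMap.smul_apply, real_inner_smul_left, symmStabOp]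
  ring

lemma stabOp_eq (u : M → ℝ) (p : M) :
    stabOp x N r u p = LinearMap.trace ℝ (TangentSpace (𝓡 n) p)
      ((newtonSign x N r • newton x N r p) ∘ₗ hess u p)
        + newtonSign x N r * potential x N r p * u p := by
  rw [stabOp, LinearMap.smul_comp, map_smul, smul_eq_mul]
  ring

lemma contMDiffAt_symmStabOp (hx : ContMDiff (𝓡 n) (𝓡 (n + 1)) ∞ x)
    (hN : IsUnitNormal (n := n) x N) (hr : r ≤ n)
    (hdef : NewtonPosDef x N r ∨ NewtonNegDef x N r) {f : M → ℝ}
    (hf : ContMDiff (𝓡 n) 𝓘(ℝ) 2 f) (p : M) :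
    ContMDiffAt (𝓡 n) 𝓘(ℝ) 0 (symmStabOp x N r f) p := by
  have hP := endSmoothAt_newton hx hN hr p
  have hX := fieldCkAt_driftField hx hN hr hdef p
  have h1 : ContMDiffAt (𝓡 n) 𝓘(ℝ) 0 (div fun q => newton x N r q (grad f q)) p :=
    contMDiffAt_div (k := 0) (l := 1) (by simp)
      (hP.apply ENat.LEInfty.out (fieldCkAt_grad (k := 1) (hf p) (by norm_num)))
  have h2 : ContMDiffAt (𝓡 n) 𝓘(ℝ) 0
      (div fun q => newton x N r q (driftField x N r q)) p :=
    contMDiffAt_div (k := 0) (l := ⊤) le_top (hP _ hX)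
  have h3 := contMDiffAt_inner le_rfl (hP _ hX) hX
  have h4 := contMDiffAt_potential hx hN hr p
  exact contMDiffAt_const.mul (h1.add ((((h4.of_le (by simp)).sub (contMDiffAt_const.mul h2)).sub
    ((h3.of_le (by simp)).div_const 4)).mul ((hf p).of_le (by simp))))

end Newton

/-! ### Nonnegativity of the symmetrized stability form -/

section Stability

variable {N : (p : M) → TangentSpace (𝓡 (n + 1)) (x p)} {r : ℕ}

/-- The nonnegativity of the symmetrized stability form, for a hypersurface with a positive
supersolution of the stability operator: integrate the pointwise inequality
`div V ≤ -f 𝒯 f`, where the field `V` vanishes off the support of `f`. -/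
theorem integral_mul_symmStabOp_nonpos [T2Space M] [SecondCountableTopology M] [Nonempty M]
    [MeasurableSpace M] [BorelSpace M] (hx : ContMDiff (𝓡 n) (𝓡 (n + 1)) ∞ x)
    (hN : IsUnitNormal (n := n) x N) (hr : r ≤ n)
    (hdef : NewtonPosDef x N r ∨ NewtonNegDef x N r) (hstab : IsRStable x N r) {f : M → ℝ}
    (hf : ContMDiff (𝓡 n) 𝓘(ℝ) 2 f) (hfc : HasCompactSupport f) :
    Integrable (fun p => f p * symmStabOp x N r f p) (riemVolume (m := n)) ∧
      0 ≤ -∫ p, f p * symmStabOp x N r f p ∂(riemVolume (m := n)) := by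
  obtain ⟨u, hu, hu0, huT⟩ := hstab
  have hP : ∀ q, EndSmoothAt (fun q => newtonSign x N r • newton x N r q) q := fun q =>
    (endSmoothAt_newton hx hN hr q).smul contMDiffAt_const
  have hs : ∀ q, (newtonSign x N r • newton x N r q).IsSymmetric := fun q =>
    (newton_isSymmetric hx hN r q).smul (by simp)
  have hint : Integrable (fun p => f p * symmStabOp x N r f p) (riemVolume (m := n)) :=
    (hf.continuous.mul (continuous_iff_continuousAt.2 fun q =>
      (contMDiffAt_symmStabOp hx hN hr hdef hf q).continuousAt)).integrable_of_hasCompactSupport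
      hfc.mul_right
  refine ⟨hint, ?_⟩
  set V : (q : M) → TangentSpace (𝓡 n) q := (fun q => f q ^ 2) •
    (fun q => riccatiField (fun q => newtonSign x N r • newton x N r q) u q) -
      f • fun q => (newtonSign x N r • newton x N r q) (grad f q)
  have hle : ∀ q, div V q ≤ -(f q * symmStabOp x N r f q) := fun q => by
    rw [symmStabOp_eq hx hN hr hdef hf q]
    refine div_le_neg_mul_of_supersolution hP hs (inner_newtonSign_smul_newton_nonneg hdef q) hu hu0
      (by rw [← stabOp_eq]; exact huT q) hf fun q => ?_
    rw [traceNabla_const_smul (endSmoothAt_newton hx hN hr q), LinearMap.smul_apply,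
      newton_driftField hdef q, smul_neg]
  have hf1 : ∀ q, ContMDiffAt (𝓡 n) 𝓘(ℝ) 1 f q := fun q => (hf q).of_le (by norm_num)
  have hV : ∀ q, FieldCkAt 1 V q := fun q => by
    have hui : ContMDiffAt (𝓡 n) 𝓘(ℝ) ∞ (fun q => (u q)⁻¹) q := (hu q).inv₀ (hu0 q).ne'
    have hW : FieldCkAt ∞ (fun q =>
        riccatiField (fun q => newtonSign x N r • newton x N r q) u q) q :=
      FieldCkAt.sub (FieldCkAt.smul hui (hP q _ (fieldCkAt_grad (k := ⊤) (hu q) (by norm_num))))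
        (FieldCkAt.const_smul _ (fieldCkAt_traceNabla hP hs))
    exact FieldCkAt.sub
      (FieldCkAt.smul ((hf1 q).pow 2) (ContMDiffAt.of_le hW (by simp)))
      (FieldCkAt.smul (hf1 q) ((hP q).apply (by simp) (fieldCkAt_grad (k := 1) (hf q)
        (by norm_num))))
  have hV0 : ∀ q, q ∉ tsupport f → V q = 0 := fun q hq => by
    have h0 := image_eq_zero_of_notMem_tsupport hq
    change f q ^ 2 • riccatiField (fun q => newtonSign x N r • newton x N r q) u q -
      f q • (newtonSign x N r • newton x N r q) (grad f q) = 0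
    rw [h0]
    simp
  rw [← integral_neg, ← integral_div_eq_zero hV hfc.isCompact hV0]
  exact integral_mono ((continuous_div hV).integrable_of_hasCompactSupport
    (hasCompactSupport_div hfc.isCompact hV0)) hint.neg hle

end Stability

end Hypersurface

end RiemGeom

end

theorem mainTheorem4 {n r : ℕ} (hr : r < n)
    {M : Type*} [TopologicalSpace M] [T2Space M] [SecondCountableTopology M] [ConnectedSpace M]
    [ChartedSpace (EuclideanSpace ℝ (Fin n)) M] [IsManifold (𝓡 n) ∞ M]
    [RiemannianBundle (fun p : M => TangentSpace (𝓡 n) p)]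
    [IsContMDiffRiemannianBundle (𝓡 n) ∞ (EuclideanSpace ℝ (Fin n))
      (fun p : M => TangentSpace (𝓡 n) p)]
    [MeasurableSpace M] [BorelSpace M]
    {Mbar : Type*} [TopologicalSpace Mbar] [T2Space Mbar] [SecondCountableTopology Mbar]
    [ChartedSpace (EuclideanSpace ℝ (Fin (n + 1))) Mbar] [IsManifold (𝓡 (n + 1)) ∞ Mbar]
    [RiemannianBundle (fun p : Mbar => TangentSpace (𝓡 (n + 1)) p)]
    [IsContMDiffRiemannianBundle (𝓡 (n + 1)) ∞ (EuclideanSpace ℝ (Fin (n + 1)))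
      (fun p : Mbar => TangentSpace (𝓡 (n + 1)) p)]
    (x : M → Mbar) (N : (p : M) → TangentSpace (𝓡 (n + 1)) (x p))
    (hadm : RiemGeom.IsAdmissible x N r) (hstab : RiemGeom.IsRStable x N r)
    (f : M → ℝ) (hf : ContMDiff (𝓡 n) 𝓘(ℝ) 2 f) (hfc : HasCompactSupport f) :
    Integrable (fun p => f p * RiemGeom.symmStabOp x N r f p) (RiemGeom.riemVolume (m := n)) ∧
      0 ≤ -∫ p, f p * RiemGeom.symmStabOp x N r f p ∂(RiemGeom.riemVolume (m := n)) := by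
  exact RiemGeom.integral_mul_symmStabOp_nonpos hadm.immersion.smooth hadm.normal hr.le
    hadm.definite hstab hf hfc
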